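/- **Theorem 2.4 (Uniqueness of Entropy Solutions).** *Setting.* Let $J\subseteq\mathbb R$ be an interval and let $f\in C^2(J)$ be such that $f'$ is bounded on every bounded subset of $J$ (automatic if $J$ is closed). Let $N\ge 0$, $\Gamma=[-1,1]^N$, let $\rho:\Gamma\to[0,\infty)$ be a probability density with $\rho\in L^\infty(\Gamma)$, and let $0<T\le\infty$. Consider $$\partial_t u+\partial_x f(u)=0,\qquad u(x,0,y)=u_0(x,y),\qquad (x,t,y)\in\mathbb R\times(0,T)\times\Gamma,$$ where $u_0\in L^\infty(\mathbb R\times\Gamma)$ takes values in $J$ almost everywhere. For $w\in L^\infty(\mathbb R\times\Gamma)$ and $t_0\in[0,T)$ we say that $u$ *has the mean trace $w$ at $t_0$* if, for every compact $V\subset\mathbb R$, $$\lim_{h\to0^+}\frac1h\int_{t_0}^{t_0+h}\int_V\int_\Gamma|u(x,t,y)-w(x,y)|\,\rho(y)\,dy\,dx\,dt=0 .$$ A *weak entropy solution* with initial data $u_0$ is a function $u\in L^\infty(\mathbb R\times(0,T)\times\Gamma)$ with values in $J$ almost everywhere such that 1. $\int_0^T\!\int_{\mathbb R}\int_\Gamma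 (u\,\partial_t\varphi+f(u)\,\partial_x\varphi)\rho\,dy\,dx\,dt+\int_{\mathbb R}\int_\Gamma u_0(x,y)\,\varphi(x,0,y)\,\rho(y)\,dy\,dx=0$ for all $\varphi\in C_c^\infty(\mathbb R\times[0,T)\times\Gamma)$; 2. $\int_0^T\!\int_{\mathbb R}\int_\Gamma (\ell(u)\,\partial_t\varphi+q(u)\,\partial_x\varphi)\rho\,dy\,dx\,dt\ge0$ for all $0\le\varphi\in C_c^\infty(\mathbb R\times(0,T)\times\Gamma)$ and all convex $\ell:\mathbb R\to\mathbb R$ of class $C^2$ on $J$, where $q(v)=\int_a^v\ell'(\theta)f'(\theta)\,d\theta$ with an arbitrary base point $a\in J$; 3. $u$ has the mean trace $u_0$ at $t_0=0$. *Contraction.* Let $K\subseteq J$ be an interval on which $f'$ is bounded. Then there is $\alpha>0$ depending only on $f$ and $K$ (in particular not on $N$, $\rho$, $T$, the data or the solutions) such that the following holds. If $u,\tilde u$ are weak entropy solutions with initial data $u_0,\tilde u_0$ and with values in $K$ almost everywhere, then for almost every $t\in(0,T)$, for every $m>0$ and every measurable $\Gamma_1\subseteq\Gamma$, $$\int_{|x|\le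 m}\int_{\Gamma_1}|u(x,t,y)-\tilde u(x,t,y)|\,\rho^2(y)\,dy\,dx\le\int_{|x|\le m+\alpha t}\int_{\Gamma_1}|u_0(x,y)-\tilde u_0(x,y)|\,\rho^2(y)\,dy\,dx .$$ Moreover, the inequality holds (for all such $m$ and $\Gamma_1$) at every $t\in(0,T)$ at which $u$ and $\tilde u$ have mean traces $w,\tilde w\in L^\infty(\mathbb R\times\Gamma)$, with $w(x,y),\tilde w(x,y)$ in place of $u(x,t,y),\tilde u(x,t,y)$. *Uniqueness.* For every initial datum $u_0$ there is at most one weak entropy solution: two weak entropy solutions with the same initial data coincide almost everywhere with respect to $\rho(y)\,dx\,dt\,dy$. -/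

import Mathlib

open MeasureTheory Set Filter Topology
open scoped ContDiff

noncomputable section

/-- The parameter domain `Γ = [-1,1]^N` in `ℝ^N`. -/
def paramCube (N : ℕ) : Set (Fin N → ℝ) := Icc (fun _ => -1) (fun _ => 1)

/-- The open time interval `(0,T)`, where `0 < T ≤ ∞`. -/
def timeInterval (T : EReal) : Set ℝ := {t : ℝ | 0 < t ∧ (t : EReal) < T}

/-- The domain `ℝ × (0,T) × Γ` of the solutions; points are written `(x,t,y)`. -/
def solDomain (N : ℕ) (T : EReal) : Set (ℝ × ℝ × (Fin N → ℝ)) :=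
  univ ×ˢ timeInterval T ×ˢ paramCube N

/-- The domain `ℝ × Γ` of the initial data; points are written `(x,y)`. -/
def dataDomain (N : ℕ) : Set (ℝ × (Fin N → ℝ)) := univ ×ˢ paramCube N

/-- `ρ : Γ → [0,∞)` is a probability density (with respect to Lebesgue measure on `Γ`)
that belongs to `L^∞(Γ)`. -/
structure IsBoundedDensity {N : ℕ} (ρ : (Fin N → ℝ) → ℝ) : Prop where
  nonneg : ∀ y ∈ paramCube N, 0 ≤ ρ y
  memLp : MemLp ρ ⊤ (volume.restrict (paramCube N))
  integral_eq_one : ∫ y in paramCube N, ρ y = 1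

/-- The partial derivative `∂_x φ`. -/
def partialX {N : ℕ} (φ : ℝ × ℝ × (Fin N → ℝ) → ℝ) (p : ℝ × ℝ × (Fin N → ℝ)) : ℝ :=
  deriv (fun x : ℝ => φ (x, p.2.1, p.2.2)) p.1

/-- The partial derivative `∂_t φ`. -/
def partialT {N : ℕ} (φ : ℝ × ℝ × (Fin N → ℝ) → ℝ) (p : ℝ × ℝ × (Fin N → ℝ)) : ℝ :=
  deriv (fun t : ℝ => φ (p.1, t, p.2.2)) p.2.1

/-- `φ ∈ C_c^∞(ℝ × I × Γ)` for a set `I` of times. Test functions on `ℝ × [0,T) × Γ` are the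
restrictions to `t ≥ 0` of the functions for `I = (-∞,T)`. -/
structure IsTestFunction {N : ℕ} (I : Set ℝ) (φ : ℝ × ℝ × (Fin N → ℝ) → ℝ) : Prop where
  smooth : ContDiff ℝ ∞ φ
  compact : HasCompactSupport φ
  support : tsupport φ ⊆ univ ×ˢ I ×ˢ paramCube N

/-- The entropy flux `q(v) = ∫_a^v ℓ'(θ) f'(θ) dθ` on the interval `J`, normalized at `a ∈ J`. -/
def entropyFlux (J : Set ℝ) (f ℓ : ℝ → ℝ) (a v : ℝ) : ℝ :=
  ∫ θ in a..v, derivWithin ℓ J θ * derivWithin f J θ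

/-- `w` is the value of `u` at time `t₀` (from the right) in the averaged sense:
`(1/h) ∫_{t₀}^{t₀+h} ∫_V ∫_Γ |u(x,t,y) - w(x,y)| ρ(y) dy dx dt → 0` as `h → 0+`,
for every compact `V ⊆ ℝ`. -/
def IsMeanTrace {N : ℕ} (ρ : (Fin N → ℝ) → ℝ) (u : ℝ × ℝ × (Fin N → ℝ) → ℝ) (t₀ : ℝ)
    (w : ℝ × (Fin N → ℝ) → ℝ) : Prop :=
  ∀ V : Set ℝ, IsCompact V →
    Tendsto (fun h : ℝ => h⁻¹ *
        ∫ p in V ×ˢ Ioo t₀ (t₀ + h) ×ˢ paramCube N, |u p - w (p.1, p.2.2)| * ρ p.2.2)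
      (𝓝[>] 0) (𝓝 0)

/-- Weak solutions `u ∈ L^∞(ℝ × (0,T) × Γ)` with values in `J` of
`∂_t u + ∂_x f(u) = 0`, `u(x,0,y) = u₀(x,y)`, where `u₀ ∈ L^∞(ℝ × Γ)` has values in `J`. -/
structure IsWeakSolution {N : ℕ} (J : Set ℝ) (f : ℝ → ℝ) (ρ : (Fin N → ℝ) → ℝ) (T : EReal)
    (u₀ : ℝ × (Fin N → ℝ) → ℝ) (u : ℝ × ℝ × (Fin N → ℝ) → ℝ) : Prop where
  data_memLp : MemLp u₀ ⊤ (volume.restrict (dataDomain N))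
  data_mem : ∀ᵐ z ∂volume.restrict (dataDomain N), u₀ z ∈ J
  memLp : MemLp u ⊤ (volume.restrict (solDomain N T))
  mem : ∀ᵐ p ∂volume.restrict (solDomain N T), u p ∈ J
  weak_eq : ∀ φ : ℝ × ℝ × (Fin N → ℝ) → ℝ, IsTestFunction {t : ℝ | (t : EReal) < T} φ →
    (∫ p in solDomain N T, (u p * partialT φ p + f (u p) * partialX φ p) * ρ p.2.2)
      + ∫ z in dataDomain N, u₀ z * φ (z.1, 0, z.2) * ρ z.2 = 0

/-- Weak entropy solutions: weak solutions that satisfy the entropy inequality for every convex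
`ℓ : ℝ → ℝ` of class `C²` on `J`, and that attain the initial data in the averaged sense. -/
structure IsWeakEntropySolution {N : ℕ} (J : Set ℝ) (f : ℝ → ℝ) (ρ : (Fin N → ℝ) → ℝ)
    (T : EReal) (u₀ : ℝ × (Fin N → ℝ) → ℝ) (u : ℝ × ℝ × (Fin N → ℝ) → ℝ) : Prop
    extends IsWeakSolution J f ρ T u₀ u where
  entropy_ineq : ∀ ℓ : ℝ → ℝ, ConvexOn ℝ univ ℓ → ContDiffOn ℝ 2 ℓ J → ∀ a ∈ J,
    ∀ φ : ℝ × ℝ × (Fin N → ℝ) → ℝ, IsTestFunction (timeInterval T) φ → (∀ p, 0 ≤ φ p) →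
      0 ≤ ∫ p in solDomain N T,
        (ℓ (u p) * partialT φ p + entropyFlux J f ℓ a (u p) * partialX φ p) * ρ p.2.2
  initial : IsMeanTrace ρ u 0 u₀

end

/-! The parameter y is only a label: the theorem is Kruzkov's L¹ contraction for almost every y with
ρ(y) ≠ 0, integrated against a weight in y.

Inserting the convex functions √((θ - k)² + ε²) into the entropy inequality and letting ε → 0 gives
Kruzkov's inequality for |u - k| with flux F(u,k) = sign(u - k)(f(u) - f(k)). Test functions
φ(x,t)ψ(y) with arbitrary ψ ≥ 0 localize it to almost every y where ρ does not vanish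
(`isKruzkov_of_entropy`). Continuity in k makes the exceptional null set independent of k
(`IsKruzkov.ae_forall`), so k may be the value of the other solution at another point (x',t') with
the same y. Doubling only the variables (x,t) and letting the mollifier concentrate at Lebesgue
points yields Kato's inequality for |u - ũ| (`IsKruzkov.kato`).

Kato's inequality is then tested with a smooth backward cone |x| ≤ R - Cs times a time cutoff, where
C bounds |f'|. Since |F(a,b)| ≤ C|a - b|, the terms from the lateral boundary have a favourable sign
(`kruzkovIntegrand_cone_le`). Hence a time average of the distance just after t is bounded by one
just after 0 over a larger interval (`distAverage_le`). Mean traces turn these averages into values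
at t and 0 (`integral_abs_sub_le_of_kato`), and by Lebesgue differentiation in time u(·,t,·) is its
own trace, along a sequence h → 0, for almost every t (`ae_forall_tendsto_traceDefect`).

The weight ρ² restricted to Γ₁ is at most a constant times ρ, so traces in the sense of ρ suffice,
and it vanishes where ρ does, so Kato's inequality is needed only where ρ ≠ 0
(`contraction_of_traceDefect`). The speed is α = C + 1; the additional 1 absorbs the smoothing of
the cone. Uniqueness is the contraction on J ∩ [-M,M] with equal data. -/

noncomputable section

/-! ### Smooth approximations of the Kruzkov entropies -/

/-- The smooth convex approximation `θ ↦ √((θ - k)² + ε²)` of `θ ↦ |θ - k|`. -/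
def sqrtEntropy (ε k θ : ℝ) : ℝ := √((θ - k) ^ 2 + ε ^ 2)

/-- The Kruzkov flux `sign (a - b) (g a - g b)`. -/
def kruzkovFlux (g : ℝ → ℝ) (a b : ℝ) : ℝ := g (max a b) - g (min a b)

/-- The function is the modulus of the complex number (θ - k) + iε, which is affine in θ, so the
triangle inequality gives convexity without second derivatives. -/
lemma convexOn_sqrtEntropy (ε k : ℝ) : ConvexOn ℝ univ (sqrtEntropy ε k) := by
  have h : sqrtEntropy ε k = fun θ => ‖(((θ - k : ℝ) : ℂ) + (ε : ℂ) * Complex.I)‖ := by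
    funext θ
    rw [Complex.norm_add_mul_I]; rfl
  rw [h]
  refine ⟨convex_univ, fun x _ y _ a b ha hb hab => ?_⟩
  have e : (((a • x + b • y - k : ℝ) : ℂ) + (ε : ℂ) * Complex.I)
      = (a : ℂ) * (((x - k : ℝ) : ℂ) + (ε : ℂ) * Complex.I)
        + (b : ℂ) * (((y - k : ℝ) : ℂ) + (ε : ℂ) * Complex.I) := by
    have hb' : b = 1 - a := by linarith
    subst hb'
    simp only [smul_eq_mul]
    push_cast
    ring
  simp only [e]
  refine (norm_add_le _ _).trans ?_
  rw [norm_mul, norm_mul, Complex.norm_real, Complex.norm_real, Real.norm_of_nonneg ha,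
    Real.norm_of_nonneg hb]
  rfl

lemma sqrtEntropy_arg_pos {ε : ℝ} (hε : 0 < ε) (k θ : ℝ) : 0 < (θ - k) ^ 2 + ε ^ 2 := by
  positivity

lemma contDiff_sqrtEntropy {ε : ℝ} (hε : 0 < ε) (k : ℝ) {n : WithTop ℕ∞} :
    ContDiff ℝ n (sqrtEntropy ε k) := by
  unfold sqrtEntropy
  exact ContDiff.sqrt (by fun_prop) fun θ => (sqrtEntropy_arg_pos hε k θ).ne'

lemma sqrtEntropy_le {ε : ℝ} (hε : 0 < ε) (k θ : ℝ) : sqrtEntropy ε k θ ≤ |θ - k| + ε := by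
  refine Real.sqrt_le_iff.2 ⟨by positivity, ?_⟩
  nlinarith [sq_abs (θ - k), abs_nonneg (θ - k)]

lemma sqrtEntropy_nonneg (ε k θ : ℝ) : 0 ≤ sqrtEntropy ε k θ := Real.sqrt_nonneg _

lemma continuous_sqrtEntropy (k : ℝ) : Continuous fun p : ℝ × ℝ => sqrtEntropy p.1 k p.2 := by
  unfold sqrtEntropy
  fun_prop

lemma hasDerivAt_sqrtEntropy {ε : ℝ} (hε : 0 < ε) (k θ : ℝ) :
    HasDerivAt (sqrtEntropy ε k) ((θ - k) / √((θ - k) ^ 2 + ε ^ 2)) θ := by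
  have h1 : HasDerivAt (fun θ : ℝ => (θ - k) ^ 2 + ε ^ 2) (2 * (θ - k)) θ := by
    simpa using (((hasDerivAt_id θ).sub_const k).pow 2).add_const (ε ^ 2)
  have h2 := h1.sqrt (sqrtEntropy_arg_pos hε k θ).ne'
  rwa [mul_div_mul_left _ _ two_ne_zero] at h2

lemma abs_deriv_sqrtEntropy_le (ε k θ : ℝ) :
    |(θ - k) / √((θ - k) ^ 2 + ε ^ 2)| ≤ 1 := by
  rw [abs_div, abs_of_nonneg (Real.sqrt_nonneg _)]
  refine div_le_one_of_le₀ ?_ (Real.sqrt_nonneg _)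
  exact Real.abs_le_sqrt (by nlinarith [sq_nonneg ε])

/-- An interval with two distinct points has nonempty interior. This separates off a one-point J,
where `derivWithin` carries no information; there every flux integral is over a trivial interval. -/
lemma OrdConnected.uniqueDiffOn_of_ne {J : Set ℝ} (hJ : J.OrdConnected) {a b : ℝ} (ha : a ∈ J)
    (hb : b ∈ J) (hab : a ≠ b) : UniqueDiffOn ℝ J := by
  refine uniqueDiffOn_convex hJ.convex ?_
  have h1 : uIcc a b ⊆ J := hJ.uIcc_subset ha hb
  refine Set.Nonempty.mono (interior_mono h1) ?_
  rw [uIcc, interior_Icc]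
  exact nonempty_Ioo.2 (min_lt_max.2 hab)

/-! ### Entropy fluxes and their limit as ε → 0 -/

section Flux

variable {J K : Set ℝ} {f : ℝ → ℝ} {C : ℝ}

lemma intervalIntegrable_entropyFlux (hJ : J.OrdConnected) (hf : ContDiffOn ℝ 2 f J)
    (hu : UniqueDiffOn ℝ J) {ε k : ℝ} (hε : 0 < ε) {a b : ℝ} (ha : a ∈ J) (hb : b ∈ J) :
    IntervalIntegrable (fun θ => derivWithin (sqrtEntropy ε k) J θ * derivWithin f J θ)
      volume a b := by
  refine ContinuousOn.intervalIntegrable (ContinuousOn.mono (s := J) ?_ (hJ.uIcc_subset ha hb))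
  exact ((contDiff_sqrtEntropy hε k (n := 2)).contDiffOn.continuousOn_derivWithin hu
    (by norm_num)).mul (hf.continuousOn_derivWithin hu (by norm_num))

/-- The entropies have slope at most 1, so their fluxes inherit the Lipschitz constant of f on K,
uniformly in ε. This gives both domination and measurability later. -/
lemma entropyFlux_sub_le (hJ : J.OrdConnected) (hf : ContDiffOn ℝ 2 f J) (hKJ : K ⊆ J)
    (hK : K.OrdConnected) (hC : ∀ s ∈ K, |derivWithin f J s| ≤ C) {ε k : ℝ} (hε : 0 < ε)
    (hk : k ∈ K) {v w : ℝ} (hv : v ∈ K) (hw : w ∈ K) :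
    |entropyFlux J f (sqrtEntropy ε k) k v - entropyFlux J f (sqrtEntropy ε k) k w|
      ≤ C * |v - w| := by
  rcases eq_or_ne v w with rfl | hvw
  · simp
  have hu := OrdConnected.uniqueDiffOn_of_ne hJ (hKJ hv) (hKJ hw) hvw
  unfold entropyFlux
  rw [intervalIntegral.integral_interval_sub_left
    (intervalIntegrable_entropyFlux hJ hf hu hε (hKJ hk) (hKJ hv))
    (intervalIntegrable_entropyFlux hJ hf hu hε (hKJ hk) (hKJ hw))]
  have := intervalIntegral.norm_integral_le_of_norm_le_const (a := w) (b := v) (C := C)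
    (f := fun θ => derivWithin (sqrtEntropy ε k) J θ * derivWithin f J θ) ?_
  · simpa using this
  intro θ hθ
  have hθK : θ ∈ K := hK.uIcc_subset hw hv (uIoc_subset_uIcc hθ)
  rw [norm_mul, (hasDerivAt_sqrtEntropy hε k θ).hasDerivWithinAt.derivWithin (hu θ (hKJ hθK))]
  have h1 := abs_deriv_sqrtEntropy_le ε k θ
  have h2 := hC θ hθK
  calc _ ≤ 1 * C := mul_le_mul h1 h2 (abs_nonneg _) zero_le_one
    _ = C := one_mul C

/-- The slopes tend pointwise to sign(θ - k) and are bounded by 1, so dominated convergence applies,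
and the fundamental theorem of calculus evaluates the limit. With base point k no additive constant
appears. The function g stands for a Lipschitz extension of f from K. -/
lemma tendsto_entropyFlux (hJ : J.OrdConnected) (hf : ContDiffOn ℝ 2 f J) (hKJ : K ⊆ J)
    (hK : K.OrdConnected) {g : ℝ → ℝ}
    (hg : EqOn f g K) {k v : ℝ} (hk : k ∈ K) (hv : v ∈ K) {ε : ℕ → ℝ} (hε : ∀ n, 0 < ε n)
    (hε0 : Tendsto ε atTop (𝓝 0)) :
    Tendsto (fun n => entropyFlux J f (sqrtEntropy (ε n) k) k v) atTop
      (𝓝 (kruzkovFlux g v k)) := by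
  rcases eq_or_ne v k with rfl | hvk
  · simp [entropyFlux, kruzkovFlux]
  have hu := OrdConnected.uniqueDiffOn_of_ne hJ (hKJ hv) (hKJ hk) hvk
  have hsub : uIcc k v ⊆ K := hK.uIcc_subset hk hv
  have hint : IntervalIntegrable (derivWithin f J) volume k v :=
    ((hf.continuousOn_derivWithin hu (by norm_num)).mono (hsub.trans hKJ)).intervalIntegrable
  have hftc : ∀ a b, a ∈ K → b ∈ K → a ≤ b → ∫ θ in a..b, derivWithin f J θ = f b - f a := by
    intro a b ha hb hab
    have hs : Icc a b ⊆ J := (hK.out ha hb).trans hKJ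
    refine intervalIntegral.integral_eq_sub_of_hasDerivAt_of_le hab (hf.continuousOn.mono hs)
      (fun x hx => ?_) ?_
    · have h1 : J ∈ 𝓝 x := mem_of_superset (Icc_mem_nhds hx.1 hx.2) hs
      exact ((hf.differentiableOn (by norm_num) x (mem_of_mem_nhds h1)).hasDerivWithinAt).hasDerivAt
        h1
    · rw [← uIcc_of_le hab] at hs
      exact ((hf.continuousOn_derivWithin hu (by norm_num)).mono hs).intervalIntegrable
  have hlim : ∫ θ in k..v, SignType.sign (θ - k) * derivWithin f J θ = kruzkovFlux g v k := by
    unfold kruzkovFlux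
    rcases lt_or_gt_of_ne hvk with h | h
    · rw [max_eq_right h.le, min_eq_left h.le, ← hg hk, ← hg hv, ← hftc v k hv hk h.le,
        intervalIntegral.integral_symm, ← intervalIntegral.integral_neg]
      refine intervalIntegral.integral_congr_ae ?_
      -- The half-open interval from v to k contains its right end k, where the sign is 0 and not
      -- -1.
      have : ∀ᵐ x : ℝ, x ≠ k := by simp [ae_iff, measure_singleton]
      filter_upwards [this] with x hx hx'
      rw [uIoc_of_le h.le] at hx'
      have : x - k < 0 := sub_neg.2 (lt_of_le_of_ne hx'.2 hx)
      simp [sign_neg this]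
    · rw [max_eq_left h.le, min_eq_right h.le, ← hg hk, ← hg hv, ← hftc k v hk hv h.le]
      refine intervalIntegral.integral_congr_ae (Eventually.of_forall fun x hx => ?_)
      rw [uIoc_of_le h.le] at hx
      have : 0 < x - k := sub_pos.2 hx.1
      simp [sign_pos this]
  rw [← hlim]
  refine intervalIntegral.tendsto_integral_filter_of_dominated_convergence
    (fun θ => |derivWithin f J θ|) ?_ ?_ hint.abs ?_
  · exact Eventually.of_forall fun n => (intervalIntegrable_iff.1
      (intervalIntegrable_entropyFlux hJ hf hu (hε n) (hKJ hk) (hKJ hv))).aestronglyMeasurable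
  · refine Eventually.of_forall fun n => Eventually.of_forall fun θ hθ => ?_
    have hθK : θ ∈ K := hsub (uIoc_subset_uIcc hθ)
    rw [norm_mul, (hasDerivAt_sqrtEntropy (hε n) k θ).hasDerivWithinAt.derivWithin
      (hu θ (hKJ hθK))]
    exact mul_le_of_le_one_left (abs_nonneg _) (abs_deriv_sqrtEntropy_le (ε n) k θ)
  · refine Eventually.of_forall fun θ hθ => ?_
    have hθK : θ ∈ K := hsub (uIoc_subset_uIcc hθ)
    refine Tendsto.mul_const _ ?_
    have he : ∀ n, derivWithin (sqrtEntropy (ε n) k) J θ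
        = (θ - k) / √((θ - k) ^ 2 + ε n ^ 2) := fun n =>
      (hasDerivAt_sqrtEntropy (hε n) k θ).hasDerivWithinAt.derivWithin (hu θ (hKJ hθK))
    simp only [he]
    rcases eq_or_ne θ k with rfl | hne
    · simp
    have h0 : θ - k ≠ 0 := sub_ne_zero.2 hne
    have : Tendsto (fun n => (θ - k) / √((θ - k) ^ 2 + ε n ^ 2)) atTop
        (𝓝 ((θ - k) / √((θ - k) ^ 2 + 0 ^ 2))) := by
      refine Tendsto.div tendsto_const_nhds ?_ (by
        simpa [Real.sqrt_sq_eq_abs] using h0)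
      exact (Real.continuous_sqrt.tendsto _).comp (tendsto_const_nhds.add (hε0.pow 2))
    convert this using 2
    simp only [ne_eq, OfNat.ofNat_ne_zero, not_false_eq_true, zero_pow, add_zero,
      Real.sqrt_sq_eq_abs]
    rcases lt_or_gt_of_ne h0 with h | h
    · rw [sign_neg h, abs_of_neg h, div_neg, div_self h0]; simp
    · rw [sign_pos h, abs_of_pos h]; simp [h0]

end Flux

/-! ### Lipschitz bounds for the Kruzkov flux -/

section KruzkovFlux

variable {g : ℝ → ℝ} {C : NNReal}

lemma kruzkovFlux_comm (g : ℝ → ℝ) (a b : ℝ) : kruzkovFlux g a b = kruzkovFlux g b a := by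
  simp [kruzkovFlux, max_comm, min_comm]

/-- This is finite speed of propagation: the flux of |a - b| is at most C times |a - b|, which later
fixes the slope of the cone. -/
lemma abs_kruzkovFlux_le (hg : LipschitzWith C g) (a b : ℝ) :
    |kruzkovFlux g a b| ≤ C * |a - b| := by
  have := hg.dist_le_mul (max a b) (min a b)
  rw [Real.dist_eq, Real.dist_eq, max_sub_min_eq_abs, abs_abs, abs_sub_comm b a] at this
  exact this

lemma abs_kruzkovFlux_sub_le (hg : LipschitzWith C g) (a b b' : ℝ) :
    |kruzkovFlux g a b - kruzkovFlux g a b'| ≤ 2 * C * |b - b'| := by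
  have h1 := hg.dist_le_mul (max a b) (max a b')
  have h2 := hg.dist_le_mul (min a b) (min a b')
  rw [Real.dist_eq, Real.dist_eq] at h1 h2
  have h3 : |max a b - max a b'| ≤ |b - b'| := by
    simpa using abs_max_sub_max_le_max a b a b'
  have h4 : |min a b - min a b'| ≤ |b - b'| := by
    simpa using abs_min_sub_min_le_max a b a b'
  have hC : (0 : ℝ) ≤ C := C.2
  unfold kruzkovFlux
  calc _ = |(g (max a b) - g (max a b')) - (g (min a b) - g (min a b'))| := by ring_nf
    _ ≤ |g (max a b) - g (max a b')| + |g (min a b) - g (min a b')| := abs_sub _ _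
    _ ≤ C * |b - b'| + C * |b - b'| :=
      add_le_add (h1.trans (by gcongr)) (h2.trans (by gcongr))
    _ = _ := by ring

lemma continuous_kruzkovFlux (hg : LipschitzWith C g) :
    Continuous fun p : ℝ × ℝ => kruzkovFlux g p.1 p.2 := by
  have := hg.continuous
  unfold kruzkovFlux
  fun_prop

end KruzkovFlux

/-! ### Kruzkov's inequality with variable constants -/

/-- Nonnegative test functions in the variables `(x,t)` with support in `O`. -/
structure IsCutoff (O : Set (ℝ × ℝ)) (φ : ℝ × ℝ → ℝ) : Prop where
  smooth : ContDiff ℝ ∞ φ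
  compact : HasCompactSupport φ
  support : tsupport φ ⊆ O
  nonneg : ∀ z, 0 ≤ φ z

/-- The integrand `|a - b| ∂_t φ + F(a,b) ∂_x φ` of Kruzkov's inequality. -/
def kruzkovIntegrand (g : ℝ → ℝ) (φ : ℝ × ℝ → ℝ) (z : ℝ × ℝ) (a b : ℝ) : ℝ :=
  |a - b| * fderiv ℝ φ z (0, 1) + kruzkovFlux g a b * fderiv ℝ φ z (1, 0)

/-- Kruzkov's inequality for almost every parameter, for each constant in `K` and each cutoff. -/
def IsKruzkov {Y : Type*} [MeasurableSpace Y] (ν : Measure Y) (O : Set (ℝ × ℝ)) (K : Set ℝ)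
    (g : ℝ → ℝ) (U : ℝ × ℝ → Y → ℝ) : Prop :=
  ∀ k ∈ K, ∀ φ, IsCutoff O φ → ∀ᵐ y ∂ν, 0 ≤ ∫ z, kruzkovIntegrand g φ z (U z y) k

lemma Measurable.integrable_mul_of_hasCompactSupport {X : Type*} [TopologicalSpace X]
    [MeasurableSpace X] [OpensMeasurableSpace X] {μ : Measure X}
    [IsFiniteMeasureOnCompacts μ] {a b : X → ℝ} {B : ℝ} (ha : Measurable a)
    (hB : ∀ x, |a x| ≤ B) (hb : Continuous b) (hc : HasCompactSupport b) :
    Integrable (fun x => a x * b x) μ :=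
  (hb.integrable_of_hasCompactSupport hc).bdd_mul ha.aestronglyMeasurable
    (Eventually.of_forall hB)

lemma IsCutoff.continuous_fderiv_apply {O : Set (ℝ × ℝ)} {φ : ℝ × ℝ → ℝ} (hφ : IsCutoff O φ)
    (v : ℝ × ℝ) : Continuous fun z => fderiv ℝ φ z v :=
  (hφ.smooth.continuous_fderiv (by simp)).clm_apply continuous_const

lemma IsCutoff.hasCompactSupport_fderiv_apply {O : Set (ℝ × ℝ)} {φ : ℝ × ℝ → ℝ}
    (hφ : IsCutoff O φ) (v : ℝ × ℝ) : HasCompactSupport fun z => fderiv ℝ φ z v :=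
  hφ.compact.fderiv_apply ℝ v

section Doubling

variable {Y : Type*} [MeasurableSpace Y] {ν : Measure Y} {O : Set (ℝ × ℝ)} {K : Set ℝ}
  {g : ℝ → ℝ} {C : NNReal} {M : ℝ} {U V : ℝ × ℝ → Y → ℝ} {φ : ℝ × ℝ → ℝ}

lemma abs_sub_le_two_mul {a b : ℝ} (ha : |a| ≤ M) (hb : |b| ≤ M) : |a - b| ≤ 2 * M :=
  (abs_sub _ _).trans (by linarith)

lemma abs_kruzkovFlux_le_of_abs_le (hg : LipschitzWith C g) {a b : ℝ} (ha : |a| ≤ M)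
    (hb : |b| ≤ M) : |kruzkovFlux g a b| ≤ C * (2 * M) :=
  (abs_kruzkovFlux_le hg a b).trans
    (mul_le_mul_of_nonneg_left (abs_sub_le_two_mul ha hb) C.2)

lemma abs_kruzkovIntegrand_le (hg : LipschitzWith C g) {a b : ℝ} (ha : |a| ≤ M) (hb : |b| ≤ M)
    (φ : ℝ × ℝ → ℝ) (z : ℝ × ℝ) :
    |kruzkovIntegrand g φ z a b|
      ≤ 2 * M * |fderiv ℝ φ z (0, 1)| + C * (2 * M) * |fderiv ℝ φ z (1, 0)| := by
  refine (abs_add_le _ _).trans ?_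
  rw [abs_mul, abs_mul, abs_abs]
  gcongr
  · exact abs_sub_le_two_mul ha hb
  · exact abs_kruzkovFlux_le_of_abs_le hg ha hb

lemma IsCutoff.integrable_bound (hφ : IsCutoff O φ) (A B : ℝ) :
    Integrable (fun z => A * |fderiv ℝ φ z (0, 1)| + B * |fderiv ℝ φ z (1, 0)|) volume :=
  (((hφ.continuous_fderiv_apply _).integrable_of_hasCompactSupport
    (hφ.hasCompactSupport_fderiv_apply _)).abs.const_mul _).add
  (((hφ.continuous_fderiv_apply _).integrable_of_hasCompactSupport
    (hφ.hasCompactSupport_fderiv_apply _)).abs.const_mul _)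

lemma continuous_kruzkovIntegrand (hg : LipschitzWith C g) (hφ : IsCutoff O φ) :
    Continuous fun p : (ℝ × ℝ) × ℝ × ℝ => kruzkovIntegrand g φ p.1 p.2.1 p.2.2 := by
  have h1 := hφ.continuous_fderiv_apply (0, 1)
  have h2 := hφ.continuous_fderiv_apply (1, 0)
  have h3 := continuous_kruzkovFlux hg
  unfold kruzkovIntegrand
  refine Continuous.add (by fun_prop) ?_
  exact (h3.comp continuous_snd).mul (h2.comp continuous_fst)

/-- The null set in `IsKruzkov` may depend on k. A countable dense set of constants has one common
null set, and the integral is continuous in k by dominated convergence, so the inequality extends to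
all of K. -/
lemma IsKruzkov.ae_forall (hU : IsKruzkov ν O K g U) (hg : LipschitzWith C g)
    (hUm : Measurable fun p : (ℝ × ℝ) × Y => U p.1 p.2) (hUM : ∀ z y, |U z y| ≤ M)
    (hKM : ∀ k ∈ K, |k| ≤ M) (hφ : IsCutoff O φ) :
    ∀ᵐ y ∂ν, ∀ k ∈ K, 0 ≤ ∫ z, kruzkovIntegrand g φ z (U z y) k := by
  obtain ⟨D, hDc, hDd⟩ := TopologicalSpace.exists_countable_dense K
  have h1 : ∀ᵐ y ∂ν, ∀ k ∈ D, 0 ≤ ∫ z, kruzkovIntegrand g φ z (U z y) k :=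
    (ae_ball_iff hDc).2 fun k _ => hU k k.2 φ hφ
  filter_upwards [h1] with y hy
  have hUy : Measurable fun z => U z y := hUm.comp (measurable_id.prodMk measurable_const)
  have hcont : Continuous fun k : K => ∫ z, kruzkovIntegrand g φ z (U z y) k := by
    refine continuous_of_dominated (bound := fun z =>
      2 * M * |fderiv ℝ φ z (0, 1)| + C * (2 * M) * |fderiv ℝ φ z (1, 0)|) (fun k => ?_)
      (fun k => ?_) (hφ.integrable_bound _ _) ?_
    · exact ((continuous_kruzkovIntegrand hg hφ).measurable.comp
        (measurable_id.prodMk (hUy.prodMk measurable_const))).aestronglyMeasurable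
    · exact Eventually.of_forall fun z => abs_kruzkovIntegrand_le hg (hUM z y) (hKM k k.2) φ z
    · refine Eventually.of_forall fun z => ?_
      exact (continuous_kruzkovIntegrand hg hφ).comp
        (continuous_const.prodMk (continuous_const.prodMk continuous_subtype_val))
  have hcl : IsClosed {k : K | 0 ≤ ∫ z, kruzkovIntegrand g φ z (U z y) k} :=
    isClosed_le continuous_const hcont
  intro k hk
  have : (⟨k, hk⟩ : K) ∈ {k : K | 0 ≤ ∫ z, kruzkovIntegrand g φ z (U z y) k} := by
    have hsub : D ⊆ {k : K | 0 ≤ ∫ z, kruzkovIntegrand g φ z (U z y) k} := hy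
    exact closure_minimal hsub hcl (hDd _)
  exact this

/-- Kruzkov's inequality with the constant `k` replaced by `V z' y` and integrated over `z'`. -/
lemma IsKruzkov.ae_integral_nonneg [SFinite ν] (hU : IsKruzkov ν O K g U)
    (hg : LipschitzWith C g)
    (hUm : Measurable fun p : (ℝ × ℝ) × Y => U p.1 p.2) (hUM : ∀ z y, |U z y| ≤ M)
    (hKM : ∀ k ∈ K, |k| ≤ M) (hVm : Measurable fun p : (ℝ × ℝ) × Y => V p.1 p.2)
    (hVK : ∀ z y, V z y ∈ K) {Φ : ℝ × ℝ → ℝ × ℝ → ℝ} (hΦ : ∀ z', IsCutoff O (Φ z'))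
    {Φx Φt : (ℝ × ℝ) × (ℝ × ℝ) → ℝ} (hx : ∀ z' z, fderiv ℝ (Φ z') z (1, 0) = Φx (z', z))
    (ht : ∀ z' z, fderiv ℝ (Φ z') z (0, 1) = Φt (z', z)) (hxm : Measurable Φx)
    (htm : Measurable Φt) :
    ∀ᵐ y ∂ν, 0 ≤ ∫ z', ∫ z,
      (|U z y - V z' y| * Φt (z', z) + kruzkovFlux g (U z y) (V z' y) * Φx (z', z)) := by
  have h1 : ∀ z', ∀ᵐ y ∂ν, 0 ≤ ∫ z,
      (|U z y - V z' y| * Φt (z', z) + kruzkovFlux g (U z y) (V z' y) * Φx (z', z)) := by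
    -- The constant `V z' y` depends on y, hence the need for one null set serving all constants.
    intro z'
    filter_upwards [hU.ae_forall hg hUm hUM hKM (hΦ z')] with y hy
    simpa only [kruzkovIntegrand, hx, ht] using hy (V z' y) (hVK z' y)
  have hmeas : Measurable fun p : (ℝ × ℝ) × Y => ∫ z,
      (|U z p.2 - V p.1 p.2| * Φt (p.1, z)
        + kruzkovFlux g (U z p.2) (V p.1 p.2) * Φx (p.1, z)) := by
    refine StronglyMeasurable.measurable (StronglyMeasurable.integral_prod_right
      (f := fun (p : (ℝ × ℝ) × Y) (z : ℝ × ℝ) => |U z p.2 - V p.1 p.2| * Φt (p.1, z)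
        + kruzkovFlux g (U z p.2) (V p.1 p.2) * Φx (p.1, z)) (Measurable.stronglyMeasurable ?_))
    have m1 : Measurable fun q : ((ℝ × ℝ) × Y) × (ℝ × ℝ) => U q.2 q.1.2 :=
      hUm.comp (measurable_snd.prodMk (measurable_snd.comp measurable_fst))
    have m2 : Measurable fun q : ((ℝ × ℝ) × Y) × (ℝ × ℝ) => V q.1.1 q.1.2 :=
      hVm.comp measurable_fst
    have m3 : Measurable fun q : ((ℝ × ℝ) × Y) × (ℝ × ℝ) => ((q.1.1, q.2) : (ℝ × ℝ) × (ℝ × ℝ)) :=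
      (measurable_fst.comp measurable_fst).prodMk measurable_snd
    exact ((m1.sub m2).abs.mul (htm.comp m3)).add
      (((continuous_kruzkovFlux hg).measurable.comp (m1.prodMk m2)).mul (hxm.comp m3))
  -- Joint measurability permits exchanging "every z', almost every y" for "almost every y, almost
  -- every z'".
  have h2 := (Measure.ae_ae_comm (μ := (volume : Measure (ℝ × ℝ))) (ν := ν)
    (p := fun z' y => 0 ≤ ∫ z,
      (|U z y - V z' y| * Φt (z', z) + kruzkovFlux g (U z y) (V z' y) * Φx (z', z)))
    (measurableSet_le measurable_const hmeas)).1 (Eventually.of_forall h1)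
  filter_upwards [h2] with y hy
  exact integral_nonneg_of_ae hy

end Doubling

/-! ### Doubling of variables and Kato's inequality -/

section Kato

variable {Y : Type*} [MeasurableSpace Y] {ν : Measure Y} {O : Set (ℝ × ℝ)} {K : Set ℝ}
  {g : ℝ → ℝ} {C : NNReal} {M : ℝ} {U V : ℝ × ℝ → Y → ℝ} {φ : ℝ × ℝ → ℝ}

lemma abs_kruzkovIntegrand_sub_le (hg : LipschitzWith C g) (φ : ℝ × ℝ → ℝ) (z : ℝ × ℝ)
    (a b b' : ℝ) :
    |kruzkovIntegrand g φ z a b - kruzkovIntegrand g φ z a b'|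
      ≤ (|fderiv ℝ φ z (0, 1)| + 2 * C * |fderiv ℝ φ z (1, 0)|) * |b - b'| := by
  have h1 : |(|a - b| - |a - b'|)| ≤ |b - b'| := by
    refine (abs_abs_sub_abs_le _ _).trans (le_of_eq ?_)
    rw [abs_sub_comm b b']; congr 1; ring
  have h2 := abs_kruzkovFlux_sub_le hg a b b'
  unfold kruzkovIntegrand
  calc _ = |(|a - b| - |a - b'|) * fderiv ℝ φ z (0, 1)
        + (kruzkovFlux g a b - kruzkovFlux g a b') * fderiv ℝ φ z (1, 0)| := by ring_nf
    _ ≤ |b - b'| * |fderiv ℝ φ z (0, 1)| + 2 * C * |b - b'| * |fderiv ℝ φ z (1, 0)| := by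
      refine (abs_add_le _ _).trans ?_
      rw [abs_mul, abs_mul]
      gcongr
    _ = _ := by ring

lemma ContDiffBump.integral_normed_sub (b : ContDiffBump (0 : ℝ × ℝ)) (z : ℝ × ℝ) :
    ∫ z', b.normed volume (z' - z) = 1 := by
  rw [integral_sub_right_eq_self (fun z' => b.normed volume z'), b.integral_normed]

lemma measurable_kruzkovIntegrand_comp (hg : LipschitzWith C g) (hφ : IsCutoff O φ)
    {u v : ℝ × ℝ → ℝ} (hu : Measurable u) (hv : Measurable v) :
    Measurable fun p : (ℝ × ℝ) × (ℝ × ℝ) => kruzkovIntegrand g φ p.1 (u p.1) (v p.2) :=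
  (continuous_kruzkovIntegrand hg hφ).measurable.comp
    (measurable_fst.prodMk ((hu.comp measurable_fst).prodMk (hv.comp measurable_snd)))

/-- This is the limit z' → z after doubling. For almost every z the inner integral converges because
z is a Lebesgue point of v; the bounded integrand and unit mass of the bumps give domination in z.
The condition `hb` bounds each bump by a fixed multiple of the inverse volume of its ball, so that
it is controlled by plain averages. -/
lemma integral_kruzkovIntegrand_nonneg_of_bump (hg : LipschitzWith C g) (hφ : IsCutoff O φ)
    {u v : ℝ × ℝ → ℝ} (hu : Measurable u) (hv : Measurable v) (huM : ∀ z, |u z| ≤ M)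
    (hvM : ∀ z, |v z| ≤ M) {b : ℕ → ContDiffBump (0 : ℝ × ℝ)} {B : ℝ}
    (hb0 : Tendsto (fun n => (b n).rOut) atTop (𝓝 0)) (hb : ∀ n, (b n).rOut ≤ B * (b n).rIn)
    (h : ∀ᶠ n in atTop,
      0 ≤ ∫ z, ∫ z', kruzkovIntegrand g φ z (u z) (v z') * (b n).normed volume (z' - z)) :
    0 ≤ ∫ z, kruzkovIntegrand g φ z (u z) (v z) := by
  refine ge_of_tendsto ?_ h
  have hPm := measurable_kruzkovIntegrand_comp hg hφ hu hv
  have hbd : ∀ z z', |kruzkovIntegrand g φ z (u z) (v z')|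
      ≤ 2 * M * |fderiv ℝ φ z (0, 1)| + C * (2 * M) * |fderiv ℝ φ z (1, 0)| := fun z z' =>
    abs_kruzkovIntegrand_le hg (huM z) (hvM z') φ z
  have hvl : LocallyIntegrable v volume :=
    (memLp_top_of_bound hv.aestronglyMeasurable M (Eventually.of_forall hvM)).locallyIntegrable
      le_top
  refine tendsto_integral_of_dominated_convergence _ (fun n => ?_)
    (hφ.integrable_bound (2 * M) (C * (2 * M))) (fun n => Eventually.of_forall fun z => ?_) ?_
  · refine (StronglyMeasurable.integral_prod_right (f := fun z z' : ℝ × ℝ =>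
      kruzkovIntegrand g φ z (u z) (v z') * (b n).normed volume (z' - z))
      (Measurable.stronglyMeasurable ?_)).aestronglyMeasurable
    exact hPm.mul ((b n).continuous_normed.measurable.comp (measurable_snd.sub measurable_fst))
  · have hi : Integrable (fun z' => (b n).normed volume (z' - z)) volume :=
      (b n).integrable_normed.comp_sub_right z
    refine (norm_integral_le_of_norm_le (hi.const_mul
      (2 * M * |fderiv ℝ φ z (0, 1)| + C * (2 * M) * |fderiv ℝ φ z (1, 0)|))
      (Eventually.of_forall fun z' => ?_)).trans (le_of_eq ?_)
    · rw [norm_mul, Real.norm_of_nonneg ((b n).nonneg_normed _)]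
      exact mul_le_mul_of_nonneg_right (hbd z z') ((b n).nonneg_normed _)
    · rw [integral_const_mul, ContDiffBump.integral_normed_sub, mul_one]
  -- Lebesgue points of v alone suffice, since for fixed z the integrand is Lipschitz in the value
  -- `v z'`.
  · filter_upwards [IsUnifLocDoublingMeasure.ae_tendsto_average_norm_sub volume hvl 1] with z hz
    have hr : Tendsto (fun n => (b n).rOut) atTop (𝓝[>] 0) :=
      tendsto_nhdsWithin_iff.2 ⟨hb0, Eventually.of_forall fun n => (b n).rOut_pos⟩
    have hz' := hz (fun _ : ℕ => z) _ hr
      (Eventually.of_forall fun n => Metric.mem_closedBall_self (by simpa using (b n).rOut_pos.le))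
    have hPz : Measurable fun z' => kruzkovIntegrand g φ z (u z) (v z') :=
      hPm.comp (measurable_const.prodMk measurable_id)
    have hPl : LocallyIntegrable (fun z' => kruzkovIntegrand g φ z (u z) (v z')) volume :=
      (memLp_top_of_bound hPz.aestronglyMeasurable _ (Eventually.of_forall (hbd z))).locallyIntegrable
        le_top
    have hav : Tendsto (fun n => ⨍ z' in Metric.closedBall z (b n).rOut,
        ‖kruzkovIntegrand g φ z (u z) (v z') - kruzkovIntegrand g φ z (u z) (v z)‖) atTop
        (𝓝 0) := by
      have hz'' := hz'.const_mul (|fderiv ℝ φ z (0, 1)| + 2 * C * |fderiv ℝ φ z (1, 0)|)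
      rw [mul_zero] at hz''
      refine squeeze_zero (fun n => ?_) (fun n => ?_) hz''
      · rw [setAverage_eq]
        exact smul_nonneg (inv_nonneg.2 measureReal_nonneg) (integral_nonneg fun _ => norm_nonneg _)
      · simp only [setAverage_eq, smul_eq_mul]
        rw [mul_left_comm, ← integral_const_mul
          (|fderiv ℝ φ z (0, 1)| + 2 * C * |fderiv ℝ φ z (1, 0)|)]
        refine mul_le_mul_of_nonneg_left ?_ (inv_nonneg.2 measureReal_nonneg)
        have hc := isCompact_closedBall z (b n).rOut
        refine integral_mono ?_ ?_ fun z' => abs_kruzkovIntegrand_sub_le hg φ z _ _ _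
        · exact ((hPl.integrableOn_isCompact hc).sub
            (integrableOn_const hc.measure_ne_top)).norm
        · exact (((hvl.integrableOn_isCompact hc).sub
            (integrableOn_const hc.measure_ne_top)).norm).const_mul _
    have := tendsto_integral_smul_of_tendsto_average_norm_sub
      (B ^ (Module.finrank ℝ (ℝ × ℝ))) hav
      (Eventually.of_forall fun n => hPl.integrableOn_isCompact (isCompact_closedBall _ _))
      (g := fun n z' => (b n).normed volume (z' - z)) ?_ ?_ ?_
    · simpa only [smul_eq_mul, mul_comm] using this
    · simp only [ContDiffBump.integral_normed_sub]
      exact tendsto_const_nhds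
    · refine Eventually.of_forall fun n z' hz' => ?_
      have : z' - z ∈ Function.support ((b n).normed volume) := hz'
      rw [(b n).support_normed_eq, mem_ball_zero_iff] at this
      exact mem_closedBall_iff_norm.2 this.le
    · refine Eventually.of_forall fun n z' => ?_
      rw [abs_of_nonneg ((b n).nonneg_normed _), Measure.addHaar_real_closedBall_center]
      exact (b n).normed_le_div_measure_closedBall_rOut _ _ (hb n) _

lemma fderiv_mul_comp_sub {δ : ℝ × ℝ → ℝ} (hφ : ContDiff ℝ ∞ φ) (hδ : ContDiff ℝ ∞ δ)
    (z' z v : ℝ × ℝ) :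
    fderiv ℝ (fun z => φ z * δ (z' - z)) z v
      = fderiv ℝ φ z v * δ (z' - z) - φ z * fderiv ℝ δ (z' - z) v := by
  have h1 := (hφ.differentiable (by simp) z).hasFDerivAt
  have h2 := ((hδ.differentiable (by simp) (z' - z)).hasFDerivAt).comp z
    ((hasFDerivAt_id z).const_sub z')
  have h3 : HasFDerivAt (fun z => φ z * δ (z' - z)) _ z := h1.mul h2
  rw [h3.fderiv]
  simp
  ring

lemma fderiv_const_mul_comp_sub {δ : ℝ × ℝ → ℝ} (c : ℝ) (hδ : ContDiff ℝ ∞ δ)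
    (z' z v : ℝ × ℝ) :
    fderiv ℝ (fun z' => c * δ (z' - z)) z' v = c * fderiv ℝ δ (z' - z) v := by
  have h2 := ((hδ.differentiable (by simp) (z' - z)).hasFDerivAt).comp z'
    ((hasFDerivAt_id z').sub_const z)
  have h3 : HasFDerivAt (fun z' => c * δ (z' - z)) _ z' := h2.const_mul c
  rw [h3.fderiv]
  simp

/-- Doubling of the variables: the inequality for a pair of solutions, tested with
`φ(z) δ(z' - z)`. -/
lemma ae_integral_doubled_nonneg [SFinite ν] (hU : IsKruzkov ν O K g U) (hV : IsKruzkov ν O K g V)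
    (hg : LipschitzWith C g)
    (hUm : Measurable fun p : (ℝ × ℝ) × Y => U p.1 p.2)
    (hVm : Measurable fun p : (ℝ × ℝ) × Y => V p.1 p.2)
    (hUK : ∀ z y, U z y ∈ K) (hVK : ∀ z y, V z y ∈ K) (hKM : ∀ k ∈ K, |k| ≤ M)
    (hφ : IsCutoff O φ) {δ : ℝ × ℝ → ℝ} (hδ : ContDiff ℝ ∞ δ) (hδc : HasCompactSupport δ)
    (hδ0 : ∀ z, 0 ≤ δ z) (hsupp : ∀ z ∈ tsupport φ, ∀ w ∈ tsupport δ, z + w ∈ O) :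
    ∀ᵐ y ∂ν, 0 ≤ ∫ z, ∫ z', kruzkovIntegrand g φ z (U z y) (V z' y) * δ (z' - z) := by
  have hUM : ∀ z y, |U z y| ≤ M := fun z y => hKM _ (hUK z y)
  have hVM : ∀ z y, |V z y| ≤ M := fun z y => hKM _ (hVK z y)
  have hδd : ∀ v, Continuous fun z => fderiv ℝ δ z v := fun v =>
    (hδ.continuous_fderiv (by simp)).clm_apply continuous_const
  have hφd := hφ.continuous_fderiv_apply
  have hφ0 := hφ.smooth.continuous
  have hδ0' := hδ.continuous
  have hA : ∀ v, Continuous fun p : (ℝ × ℝ) × (ℝ × ℝ) =>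
      fderiv ℝ φ p.2 v * δ (p.1 - p.2) - φ p.2 * fderiv ℝ δ (p.1 - p.2) v := by
    intro v
    have h1 := hφd v
    have h2 := hδd v
    fun_prop
  have hB : ∀ v, Continuous fun p : (ℝ × ℝ) × (ℝ × ℝ) =>
      φ p.1 * fderiv ℝ δ (p.2 - p.1) v := by
    intro v
    have h2 := hδd v
    fun_prop
  -- U is tested in z with constant `V z' y`, and below V is tested in z' with constant `U z y`. The
  -- cutoff depends on z only, so the second test function differentiates δ alone.
  have h1 := hU.ae_integral_nonneg hg hUm hUM hKM hVm hVK
    (Φ := fun z' z => φ z * δ (z' - z)) (fun z' => ?_)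
    (Φx := fun p => fderiv ℝ φ p.2 (1, 0) * δ (p.1 - p.2) - φ p.2 * fderiv ℝ δ (p.1 - p.2) (1, 0))
    (Φt := fun p => fderiv ℝ φ p.2 (0, 1) * δ (p.1 - p.2) - φ p.2 * fderiv ℝ δ (p.1 - p.2) (0, 1))
    (fun z' z => fderiv_mul_comp_sub hφ.smooth hδ z' z _)
    (fun z' z => fderiv_mul_comp_sub hφ.smooth hδ z' z _) (hA _).measurable (hA _).measurable
  have h2 := hV.ae_integral_nonneg hg hVm hVM hKM hUm hUK
    (Φ := fun z z' => φ z * δ (z' - z)) (fun z => ?_)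
    (Φx := fun p => φ p.1 * fderiv ℝ δ (p.2 - p.1) (1, 0))
    (Φt := fun p => φ p.1 * fderiv ℝ δ (p.2 - p.1) (0, 1))
    (fun z z' => fderiv_const_mul_comp_sub (φ z) hδ z' z _)
    (fun z z' => fderiv_const_mul_comp_sub (φ z) hδ z' z _) (hB _).measurable (hB _).measurable
  · filter_upwards [h1, h2] with y hy1 hy2
    have hUy : Measurable fun z => U z y := hUm.comp (measurable_id.prodMk measurable_const)
    have hVy : Measurable fun z => V z y := hVm.comp (measurable_id.prodMk measurable_const)
    -- In the coordinates (z',z), everything is supported in the compact image of pairs (z,w) with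
    -- z' = z + w; this justifies Fubini.
    have hc : IsCompact ((fun q : (ℝ × ℝ) × (ℝ × ℝ) => (q.1 + q.2, q.1)) ''
        (tsupport φ ×ˢ tsupport δ)) :=
      (hφ.compact.isCompact.prod hδc.isCompact).image (by fun_prop)
    have hzero : ∀ p : (ℝ × ℝ) × (ℝ × ℝ), p ∉ (fun q : (ℝ × ℝ) × (ℝ × ℝ) => (q.1 + q.2, q.1)) ''
        (tsupport φ ×ˢ tsupport δ) → p.2 ∉ tsupport φ ∨ p.1 - p.2 ∉ tsupport δ := by
      intro p hp
      by_contra! hcon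
      exact hp ⟨(p.2, p.1 - p.2), ⟨hcon.1, hcon.2⟩, by simp⟩
    have hφz : ∀ z ∉ tsupport φ, φ z = 0 ∧ ∀ v, fderiv ℝ φ z v = 0 := fun z hz =>
      ⟨image_eq_zero_of_notMem_tsupport hz, fun v => by
        rw [image_eq_zero_of_notMem_tsupport fun h => hz (tsupport_fderiv_subset ℝ h)]; rfl⟩
    have hδz : ∀ z ∉ tsupport δ, δ z = 0 ∧ ∀ v, fderiv ℝ δ z v = 0 := fun z hz =>
      ⟨image_eq_zero_of_notMem_tsupport hz, fun v => by
        rw [image_eq_zero_of_notMem_tsupport fun h => hz (tsupport_fderiv_subset ℝ h)]; rfl⟩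
    have hAc : ∀ v, HasCompactSupport fun p : (ℝ × ℝ) × (ℝ × ℝ) =>
        fderiv ℝ φ p.2 v * δ (p.1 - p.2) - φ p.2 * fderiv ℝ δ (p.1 - p.2) v := by
      refine fun v => HasCompactSupport.intro hc fun p hp => ?_
      rcases hzero p hp with h | h
      · simp [hφz _ h]
      · simp [hδz _ h]
    have hBc : ∀ v, HasCompactSupport fun p : (ℝ × ℝ) × (ℝ × ℝ) =>
        φ p.2 * fderiv ℝ δ (p.1 - p.2) v := by
      refine fun v => HasCompactSupport.intro hc fun p hp => ?_
      rcases hzero p hp with h | h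
      · simp [hφz _ h]
      · simp [hδz _ h]
    have hB' : ∀ v, Continuous fun p : (ℝ × ℝ) × (ℝ × ℝ) =>
        φ p.2 * fderiv ℝ δ (p.1 - p.2) v := by
      intro v
      have h2 := hδd v
      fun_prop
    have hm1 : Measurable fun p : (ℝ × ℝ) × (ℝ × ℝ) => |U p.2 y - V p.1 y| :=
      ((hUy.comp measurable_snd).sub (hVy.comp measurable_fst)).abs
    have hm2 : Measurable fun p : (ℝ × ℝ) × (ℝ × ℝ) => kruzkovFlux g (U p.2 y) (V p.1 y) :=
      (continuous_kruzkovFlux hg).measurable.comp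
        ((hUy.comp measurable_snd).prodMk (hVy.comp measurable_fst))
    have hb1 : ∀ p : (ℝ × ℝ) × (ℝ × ℝ), |(|U p.2 y - V p.1 y|)| ≤ 2 * M := fun p => by
      rw [abs_abs]; exact abs_sub_le_two_mul (hUM _ _) (hVM _ _)
    have hb2 : ∀ p : (ℝ × ℝ) × (ℝ × ℝ), |kruzkovFlux g (U p.2 y) (V p.1 y)| ≤ C * (2 * M) :=
      fun p => abs_kruzkovFlux_le_of_abs_le hg (hUM _ _) (hVM _ _)
    have hi1 : Integrable (fun p : (ℝ × ℝ) × (ℝ × ℝ) =>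
        |U p.2 y - V p.1 y| * (fderiv ℝ φ p.2 (0, 1) * δ (p.1 - p.2)
            - φ p.2 * fderiv ℝ δ (p.1 - p.2) (0, 1))
          + kruzkovFlux g (U p.2 y) (V p.1 y) * (fderiv ℝ φ p.2 (1, 0) * δ (p.1 - p.2)
            - φ p.2 * fderiv ℝ δ (p.1 - p.2) (1, 0))) (volume.prod volume) :=
      (hm1.integrable_mul_of_hasCompactSupport hb1 (hA _) (hAc _)).add
        (hm2.integrable_mul_of_hasCompactSupport hb2 (hA _) (hAc _))
    have hi2 : Integrable (fun p : (ℝ × ℝ) × (ℝ × ℝ) =>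
        |U p.2 y - V p.1 y| * (φ p.2 * fderiv ℝ δ (p.1 - p.2) (0, 1))
          + kruzkovFlux g (U p.2 y) (V p.1 y) * (φ p.2 * fderiv ℝ δ (p.1 - p.2) (1, 0)))
        (volume.prod volume) :=
      (hm1.integrable_mul_of_hasCompactSupport hb1 (hB' _) (hBc _)).add
        (hm2.integrable_mul_of_hasCompactSupport hb2 (hB' _) (hBc _))
    have e1 := integral_integral_swap (f := fun z' z : ℝ × ℝ =>
        |U z y - V z' y| * (fderiv ℝ φ z (0, 1) * δ (z' - z)
            - φ z * fderiv ℝ δ (z' - z) (0, 1))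
          + kruzkovFlux g (U z y) (V z' y) * (fderiv ℝ φ z (1, 0) * δ (z' - z)
            - φ z * fderiv ℝ δ (z' - z) (1, 0))) hi1
    rw [e1] at hy1
    have hi1' := hi1.integral_prod_right
    have hi2' := hi2.integral_prod_right
    have e2 : ∀ z z', kruzkovFlux g (V z' y) (U z y) = kruzkovFlux g (U z y) (V z' y) :=
      fun z z' => kruzkovFlux_comm g _ _
    simp only [abs_sub_comm (V _ y) (U _ y), e2] at hy2
    -- The z- and z'-derivatives of δ(z' - z) are opposite and the flux is symmetric, so the terms
    -- with ∇δ cancel in the sum and only ∇φ times δ remains.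
    have hsum := add_nonneg hy1 hy2
    rw [← integral_add hi1' hi2'] at hsum
    refine hsum.trans (le_of_eq (integral_congr_ae ?_))
    filter_upwards [hi1.prod_left_ae, hi2.prod_left_ae] with z hz1 hz2
    rw [← integral_add hz1 hz2]
    refine integral_congr_ae (Eventually.of_forall fun z' => ?_)
    simp only [kruzkovIntegrand]
    ring
  · have hts : tsupport (fun z' => φ z * δ (z' - z)) ⊆ (fun w => w - z) ⁻¹' tsupport δ := by
      refine closure_minimal (fun z' hz' => ?_)
        ((isClosed_tsupport δ).preimage (continuous_id.sub continuous_const))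
      exact subset_tsupport _ (right_ne_zero_of_mul hz')
    refine ⟨?_, ?_, ?_, fun z' => mul_nonneg (hφ.nonneg z) (hδ0 _)⟩
    · exact contDiff_const.mul (hδ.comp (contDiff_id.sub contDiff_const))
    · exact HasCompactSupport.mul_left (hδc.comp_homeomorph (Homeomorph.subRight z))
    · by_cases hz : z ∈ tsupport φ
      · intro z' hz'
        have := hsupp z hz _ (hts hz')
        simpa using this
      · have h0 : φ z = 0 := image_eq_zero_of_notMem_tsupport hz
        simp [h0, tsupport]
  · refine ⟨?_, ?_, ?_, fun z => mul_nonneg (hφ.nonneg z) (hδ0 _)⟩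
    · exact hφ.smooth.mul (hδ.comp (contDiff_const.sub contDiff_id))
    · exact hφ.compact.mul_right
    · exact (tsupport_mul_subset_left).trans hφ.support

/-- Kato's inequality for two solutions of Kruzkov's inequalities. -/
theorem IsKruzkov.kato [SFinite ν] (hO : IsOpen O) (hU : IsKruzkov ν O K g U)
    (hV : IsKruzkov ν O K g V) (hg : LipschitzWith C g)
    (hUm : Measurable fun p : (ℝ × ℝ) × Y => U p.1 p.2)
    (hVm : Measurable fun p : (ℝ × ℝ) × Y => V p.1 p.2)
    (hUK : ∀ z y, U z y ∈ K) (hVK : ∀ z y, V z y ∈ K) (hKM : ∀ k ∈ K, |k| ≤ M)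
    (hφ : IsCutoff O φ) :
    ∀ᵐ y ∂ν, 0 ≤ ∫ z, kruzkovIntegrand g φ z (U z y) (V z y) := by
  -- The radii shrink to 0 with fixed ratio 2, which is the constant required by the Lebesgue point
  -- argument.
  let b : ℕ → ContDiffBump (0 : ℝ × ℝ) := fun n =>
    ⟨1 / (2 * (n + 1)), 1 / (n + 1), by positivity, by
      rw [one_div_lt_one_div (by positivity) (by positivity)]
      have : (0 : ℝ) ≤ n := n.cast_nonneg
      linarith⟩
  have hb0 : Tendsto (fun n => (b n).rOut) atTop (𝓝 0) := tendsto_one_div_add_atTop_nhds_zero_nat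
  have hb : ∀ n, (b n).rOut ≤ 2 * (b n).rIn := fun n => by
    simp only [b]
    apply le_of_eq
    field_simp
  -- Mollifiers of radius at most r keep the doubled test functions supported in O.
  obtain ⟨r, hr, hrO⟩ := hφ.compact.isCompact.exists_cthickening_subset_open hO hφ.support
  have hev : ∀ᶠ n in atTop, (b n).rOut ≤ r := hb0.eventually_le_const hr
  have hall : ∀ᵐ y ∂ν, ∀ n, (b n).rOut ≤ r → 0 ≤ ∫ z, ∫ z',
      kruzkovIntegrand g φ z (U z y) (V z' y) * (b n).normed volume (z' - z) := by
    refine ae_all_iff.2 fun n => ?_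
    by_cases hn : (b n).rOut ≤ r
    · have := ae_integral_doubled_nonneg hU hV hg hUm hVm hUK hVK hKM hφ
        (δ := (b n).normed volume) ((b n).contDiff_normed) (b n).hasCompactSupport_normed
        (b n).nonneg_normed ?_
      · filter_upwards [this] with y hy _ using hy
      · intro z hz w hw
        rw [(b n).tsupport_normed_eq, mem_closedBall_zero_iff] at hw
        refine hrO (Metric.mem_cthickening_of_dist_le _ z r _ hz ?_)
        rw [dist_eq_norm]
        simpa using hw.trans hn
    · exact Eventually.of_forall fun y h => absurd h hn
  filter_upwards [hall] with y hy
  exact integral_kruzkovIntegrand_nonneg_of_bump hg hφ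
    (hUm.comp (measurable_id.prodMk measurable_const))
    (hVm.comp (measurable_id.prodMk measurable_const)) (fun z => hKM _ (hUK z y))
    (fun z => hKM _ (hVK z y)) hb0 hb (hev.mono fun n hn => hy n hn)

end Kato

/-! ### Smooth cutoffs and the backward cone -/

lemma hasDerivAt_fst_of_differentiable {φ : ℝ × ℝ → ℝ} (hφ : Differentiable ℝ φ) (x t : ℝ) :
    HasDerivAt (fun x => φ (x, t)) (fderiv ℝ φ (x, t) (1, 0)) x :=
  (hφ (x, t)).hasFDerivAt.comp_hasDerivAt x ((hasDerivAt_id x).prodMk (hasDerivAt_const x t))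

lemma hasDerivAt_snd_of_differentiable {φ : ℝ × ℝ → ℝ} (hφ : Differentiable ℝ φ) (x t : ℝ) :
    HasDerivAt (fun t => φ (x, t)) (fderiv ℝ φ (x, t) (0, 1)) t :=
  (hφ (x, t)).hasFDerivAt.comp_hasDerivAt t ((hasDerivAt_const t x).prodMk (hasDerivAt_id t))

/-- A smooth monotone ramp from `0` on `(-∞,1/2]` to `1` on `[1,∞)`. -/
def ramp (r : ℝ) : ℝ := Real.smoothTransition (2 * r - 1)

lemma contDiff_ramp {n : ℕ∞} : ContDiff ℝ n ramp :=
  Real.smoothTransition.contDiff.comp (by fun_prop)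

lemma hasDerivAt_ramp (r : ℝ) : HasDerivAt ramp (deriv ramp r) r :=
  ((contDiff_ramp (n := 1)).differentiable (by norm_num) r).hasDerivAt

lemma continuous_deriv_ramp : Continuous (deriv ramp) :=
  (contDiff_ramp (n := 1)).continuous_deriv (by norm_num)

lemma monotone_ramp : Monotone ramp := fun a b hab =>
  Real.smoothTransition.monotone (by linarith)

lemma deriv_ramp_nonneg (r : ℝ) : 0 ≤ deriv ramp r := monotone_ramp.deriv_nonneg

lemma ramp_nonneg (r : ℝ) : 0 ≤ ramp r := Real.smoothTransition.nonneg _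

lemma ramp_le_one (r : ℝ) : ramp r ≤ 1 := Real.smoothTransition.le_one _

lemma ramp_of_le {r : ℝ} (h : r ≤ 1 / 2) : ramp r = 0 :=
  Real.smoothTransition.zero_of_nonpos (by linarith)

lemma ramp_of_ge {r : ℝ} (h : 1 ≤ r) : ramp r = 1 :=
  Real.smoothTransition.one_of_one_le (by linarith)

lemma deriv_ramp_eq_zero {r : ℝ} (h : r ∉ Ioo (0 : ℝ) 1) : deriv ramp r = 0 := by
  have key : Ioi (1 : ℝ) ⊆ {r | deriv ramp r = 0} ∧ Iio (1 / 2 : ℝ) ⊆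
      {r | deriv ramp r = 0} := by
    refine ⟨fun x hx => ?_, fun x hx => ?_⟩
    · have : ramp =ᶠ[𝓝 x] fun _ => 1 := by
        filter_upwards [Ioi_mem_nhds hx] with y hy using ramp_of_ge (le_of_lt hy)
      simp [this.deriv_eq]
    · have : ramp =ᶠ[𝓝 x] fun _ => 0 := by
        filter_upwards [Iio_mem_nhds hx] with y hy using ramp_of_le (le_of_lt hy)
      simp [this.deriv_eq]
  have hcl : IsClosed {r | deriv ramp r = 0} := isClosed_eq continuous_deriv_ramp continuous_const
  by_cases h0 : r ≤ 0
  · exact key.2 (show r < 1 / 2 by linarith)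
  · have h1 : 1 ≤ r := by
      by_contra! h1
      exact h ⟨not_le.1 h0, h1⟩
    -- At the endpoint 1 the ramp is not locally constant, so continuity of its derivative is used
    -- there.
    have := closure_minimal key.1 hcl
    rw [closure_Ioi] at this
    exact this h1

lemma exists_deriv_ramp_le : ∃ B : ℝ, ∀ r, deriv ramp r ≤ B := by
  obtain ⟨B, hB⟩ := (isCompact_Icc (a := (0 : ℝ)) (b := 1)).exists_bound_of_continuousOn
    continuous_deriv_ramp.continuousOn
  refine ⟨B, fun r => ?_⟩
  by_cases h : r ∈ Icc (0 : ℝ) 1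
  · exact (le_abs_self _).trans (hB r h)
  · rw [deriv_ramp_eq_zero fun h' => h ⟨h'.1.le, h'.2.le⟩]
    exact (norm_nonneg _).trans (hB 0 (by simp))

/-- A smooth probability density supported in `[t,t+h]`. -/
def rampKernel (t h s : ℝ) : ℝ := deriv ramp ((s - t) / h) / h

lemma rampKernel_nonneg {h : ℝ} (hh : 0 < h) (t s : ℝ) : 0 ≤ rampKernel t h s :=
  div_nonneg (deriv_ramp_nonneg _) hh.le

lemma continuous_rampKernel (t h : ℝ) : Continuous (rampKernel t h) := by
  have := continuous_deriv_ramp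
  unfold rampKernel
  fun_prop

lemma rampKernel_eq_zero {h : ℝ} (hh : 0 < h) {t s : ℝ} (hs : s ∉ Ioo t (t + h)) :
    rampKernel t h s = 0 := by
  unfold rampKernel
  rw [deriv_ramp_eq_zero, zero_div]
  rintro ⟨h1, h2⟩
  rw [lt_div_iff₀ hh] at h1
  rw [div_lt_iff₀ hh] at h2
  exact hs ⟨by linarith, by linarith⟩

lemma hasDerivAt_ramp_comp (t h s : ℝ) :
    HasDerivAt (fun s => ramp ((s - t) / h)) (rampKernel t h s) s := by
  have h1 : HasDerivAt (fun s : ℝ => (s - t) / h) (1 / h) s :=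
    ((hasDerivAt_id s).sub_const t).div_const h
  refine ((hasDerivAt_ramp ((s - t) / h)).comp s h1).congr_deriv ?_
  unfold rampKernel
  ring

lemma integrable_rampKernel {h : ℝ} (hh : 0 < h) (t : ℝ) : Integrable (rampKernel t h) volume :=
  (continuous_rampKernel t h).integrable_of_hasCompactSupport
    (HasCompactSupport.intro isCompact_Icc fun _ hs =>
      rampKernel_eq_zero hh fun h' => hs (Ioo_subset_Icc_self h'))

lemma integral_rampKernel {h : ℝ} (hh : 0 < h) (t : ℝ) : ∫ s, rampKernel t h s = 1 := by
  have h1 : ∫ s in t..t + h, rampKernel t h s = 1 := by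
    rw [intervalIntegral.integral_eq_sub_of_hasDerivAt (fun _ _ => hasDerivAt_ramp_comp t h _)
      ((continuous_rampKernel t h).intervalIntegrable _ _)]
    rw [ramp_of_ge (by simp [hh.ne']), ramp_of_le (by simp)]
    norm_num
  rw [intervalIntegral.integral_of_le (by linarith)] at h1
  rw [← h1, setIntegral_eq_integral_of_forall_compl_eq_zero]
  exact fun s hs => rampKernel_eq_zero hh fun h' => hs (Ioo_subset_Ioc_self h')

/-- A smooth cutoff in time, supported in `[h'/2,t+h]`. -/
def timeCutoff (t h h' s : ℝ) : ℝ := ramp ((s - 0) / h') - ramp ((s - t) / h)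

/-- A smooth approximation of the indicator function of the cone `|x| ≤ R - c s`. -/
def coneCutoff (c R ε : ℝ) (z : ℝ × ℝ) : ℝ :=
  (1 - ramp ((z.1 + c * z.2 - R) / ε)) * (1 - ramp ((-z.1 + c * z.2 - R) / ε))

lemma timeCutoff_nonneg {t h h' : ℝ} (hh : 0 < h) (hh' : 0 < h') (ht : h' ≤ t) (s : ℝ) :
    0 ≤ timeCutoff t h h' s := by
  unfold timeCutoff
  rcases le_or_gt s t with hs | hs
  · rw [ramp_of_le (r := (s - t) / h)]
    · simpa using ramp_nonneg _
    · exact (div_nonpos_of_nonpos_of_nonneg (by linarith) hh.le).trans (by norm_num)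
  · rw [ramp_of_ge (r := (s - 0) / h')]
    · linarith [ramp_le_one ((s - t) / h)]
    · rw [le_div_iff₀ hh']; linarith

lemma timeCutoff_eq_zero {t h h' : ℝ} (hh : 0 < h) (hh' : 0 < h') (ht : h' ≤ t) {s : ℝ}
    (hs : s ∉ Icc (h' / 2) (t + h)) : timeCutoff t h h' s = 0 := by
  unfold timeCutoff
  rcases lt_or_ge s (h' / 2) with h1 | h1
  · rw [ramp_of_le (r := (s - 0) / h'), ramp_of_le (r := (s - t) / h)]
    · simp
    · exact (div_nonpos_of_nonpos_of_nonneg (by linarith) hh.le).trans (by norm_num)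
    · rw [div_le_iff₀ hh']; linarith
  · have h2 : t + h < s := by
      by_contra! h2
      exact hs ⟨h1, h2⟩
    rw [ramp_of_ge (r := (s - 0) / h'), ramp_of_ge (r := (s - t) / h)]
    · simp
    · rw [le_div_iff₀ hh]; linarith
    · rw [le_div_iff₀ hh']; linarith

lemma coneCutoff_nonneg (c R ε : ℝ) (z : ℝ × ℝ) : 0 ≤ coneCutoff c R ε z :=
  mul_nonneg (sub_nonneg.2 (ramp_le_one _)) (sub_nonneg.2 (ramp_le_one _))

lemma coneCutoff_le_one (c R ε : ℝ) (z : ℝ × ℝ) : coneCutoff c R ε z ≤ 1 :=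
  mul_le_one₀ (sub_le_self _ (ramp_nonneg _)) (sub_nonneg.2 (ramp_le_one _))
    (sub_le_self _ (ramp_nonneg _))

lemma coneCutoff_eq_zero {c R ε : ℝ} (hε : 0 < ε) (hc : 0 ≤ c) {z : ℝ × ℝ} (hz : 0 ≤ z.2)
    (h : z.1 ∉ Icc (-(R + ε)) (R + ε)) : coneCutoff c R ε z = 0 := by
  unfold coneCutoff
  have h0 := mul_nonneg hc hz
  rcases lt_or_ge (R + ε) z.1 with h1 | h1
  · rw [ramp_of_ge (r := (z.1 + c * z.2 - R) / ε)]
    · simp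
    · rw [le_div_iff₀ hε]; linarith
  · have h2 : z.1 < -(R + ε) := by
      by_contra! h2
      exact h ⟨h2, h1⟩
    rw [ramp_of_ge (r := (-z.1 + c * z.2 - R) / ε)]
    · simp
    · rw [le_div_iff₀ hε]; linarith

lemma coneCutoff_eq_one {c R ε : ℝ} (hε : 0 < ε) {z : ℝ × ℝ}
    (h : |z.1| + c * z.2 ≤ R) : coneCutoff c R ε z = 1 := by
  unfold coneCutoff
  have h1 := le_abs_self z.1
  have h2 := neg_le_abs z.1
  rw [ramp_of_le, ramp_of_le]
  · simp
  · exact (div_nonpos_of_nonpos_of_nonneg (by linarith) hε.le).trans (by norm_num)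
  · exact (div_nonpos_of_nonpos_of_nonneg (by linarith) hε.le).trans (by norm_num)

lemma contDiff_coneCutoff (c R ε : ℝ) {n : ℕ∞} : ContDiff ℝ n (coneCutoff c R ε) :=
  (contDiff_const.sub (contDiff_ramp.comp (by fun_prop))).mul
    (contDiff_const.sub (contDiff_ramp.comp (by fun_prop)))

lemma contDiff_timeCutoff (t h h' : ℝ) {n : ℕ∞} : ContDiff ℝ n (timeCutoff t h h') :=
  (contDiff_ramp.comp (by fun_prop)).sub (contDiff_ramp.comp (by fun_prop))

lemma isCutoff_cone {O : Set (ℝ × ℝ)} {t h h' c R ε : ℝ} (hh : 0 < h) (hh' : 0 < h')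
    (ht : h' ≤ t) (hε : 0 < ε) (hc : 0 ≤ c)
    (hO : (univ : Set ℝ) ×ˢ Icc (h' / 2) (t + h) ⊆ O) :
    IsCutoff O fun z => timeCutoff t h h' z.2 * coneCutoff c R ε z := by
  refine ⟨?_, ?_, ?_, fun z => mul_nonneg (timeCutoff_nonneg hh hh' ht _) (coneCutoff_nonneg ..)⟩
  · exact ((contDiff_timeCutoff t h h').comp contDiff_snd).mul (contDiff_coneCutoff c R ε)
  · refine HasCompactSupport.intro ((isCompact_Icc (a := -(R + ε)) (b := R + ε)).prod
      (isCompact_Icc (a := h' / 2) (b := t + h))) fun z hz => ?_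
    by_cases h2 : z.2 ∈ Icc (h' / 2) (t + h)
    · rw [coneCutoff_eq_zero hε hc (by linarith [h2.1]) fun h1 => hz ⟨h1, h2⟩, mul_zero]
    · rw [timeCutoff_eq_zero hh hh' ht h2, zero_mul]
  · refine (closure_minimal (fun z hz => ?_) (isClosed_univ.prod isClosed_Icc)).trans hO
    refine ⟨mem_univ _, ?_⟩
    by_contra h2
    exact hz (by simp only [timeCutoff_eq_zero hh hh' ht h2, zero_mul])

/-- The cone cutoff AB has ∂_s = -C(pB + Aq) and ∂_x = -pB + Aq with p, q, A, B ≥ 0. Its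
contribution is -pB(C|a - b| + F) - Aq(C|a - b| - F), up to the nonnegative time cutoff, and both
brackets are nonnegative. Only the derivative of the time cutoff survives. -/
lemma kruzkovIntegrand_cone_le {g : ℝ → ℝ} {C : NNReal} (hg : LipschitzWith C g)
    {t h h' R ε : ℝ} (hh : 0 < h) (hh' : 0 < h') (ht : h' ≤ t) (hε : 0 < ε) (z : ℝ × ℝ)
    (a b : ℝ) :
    kruzkovIntegrand g (fun z => timeCutoff t h h' z.2 * coneCutoff C R ε z) z a b
      ≤ |a - b| * ((rampKernel 0 h' z.2 - rampKernel t h z.2) * coneCutoff C R ε z) := by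
  obtain ⟨x, s⟩ := z
  have hsm : Differentiable ℝ fun z : ℝ × ℝ => timeCutoff t h h' z.2 * coneCutoff C R ε z :=
    (((contDiff_timeCutoff t h h' (n := 1)).comp contDiff_snd).mul
      (contDiff_coneCutoff C R ε)).differentiable (by norm_num)
  have hr : ∀ {q : ℝ → ℝ} {q' r : ℝ}, HasDerivAt q q' r →
      HasDerivAt (fun r => 1 - ramp ((q r - R) / ε)) (-(rampKernel R ε (q r) * q')) r :=
    fun {q q' r} hq => ((hasDerivAt_ramp_comp R ε (q r)).comp r hq).const_sub 1
  have hx1 := hr ((hasDerivAt_id x).add_const (C * s))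
  have hx2 := hr ((hasDerivAt_neg x).add_const (C * s))
  have ht1 := hr (((hasDerivAt_id s).const_mul (C : ℝ)).const_add x)
  have ht2 := hr (((hasDerivAt_id s).const_mul (C : ℝ)).const_add (-x))
  have hθ : HasDerivAt (timeCutoff t h h') (rampKernel 0 h' s - rampKernel t h s) s :=
    (hasDerivAt_ramp_comp 0 h' s).sub (hasDerivAt_ramp_comp t h s)
  have ex := (hasDerivAt_fst_of_differentiable hsm x s).unique
    ((hx1.mul hx2).const_mul (timeCutoff t h h' s))
  have et := (hasDerivAt_snd_of_differentiable hsm x s).unique (hθ.mul (ht1.mul ht2))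
  unfold kruzkovIntegrand
  rw [ex, et]
  simp only [id, coneCutoff]
  set p := rampKernel R ε (x + C * s)
  set q := rampKernel R ε (-x + C * s)
  have hp : 0 ≤ p := rampKernel_nonneg hε _ _
  have hq : 0 ≤ q := rampKernel_nonneg hε _ _
  set A := 1 - ramp ((x + C * s - R) / ε)
  set B := 1 - ramp ((-x + C * s - R) / ε)
  have hA : 0 ≤ A := sub_nonneg.2 (ramp_le_one _)
  have hB : 0 ≤ B := sub_nonneg.2 (ramp_le_one _)
  have hT := timeCutoff_nonneg hh hh' ht s
  have hF := abs_le.1 (abs_kruzkovFlux_le hg a b)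
  have h1 : 0 ≤ timeCutoff t h h' s * (p * B) * (C * |a - b| + kruzkovFlux g a b) :=
    mul_nonneg (mul_nonneg hT (mul_nonneg hp hB)) (by linarith)
  have h2 : 0 ≤ timeCutoff t h h' s * (A * q) * (C * |a - b| - kruzkovFlux g a b) :=
    mul_nonneg (mul_nonneg hT (mul_nonneg hA hq)) (by linarith)
  linarith

lemma IsCutoff.integrable_kruzkovIntegrand {O : Set (ℝ × ℝ)} {φ : ℝ × ℝ → ℝ} {g : ℝ → ℝ}
    {C : NNReal} {M : ℝ} (hφ : IsCutoff O φ) (hg : LipschitzWith C g)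
    {u v : ℝ × ℝ → ℝ} (hu : Measurable u) (hv : Measurable v) (huM : ∀ z, |u z| ≤ M)
    (hvM : ∀ z, |v z| ≤ M) :
    Integrable (fun z => kruzkovIntegrand g φ z (u z) (v z)) volume :=
  (hφ.integrable_bound (2 * M) (C * (2 * M))).mono'
    ((continuous_kruzkovIntegrand hg hφ).measurable.comp
      (measurable_id.prodMk (hu.prodMk hv))).aestronglyMeasurable
    (Eventually.of_forall fun z => abs_kruzkovIntegrand_le hg (huM z) (hvM z) φ z)

/-- Integrating the preceding pointwise bound turns Kato's inequality into a comparison of two time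
averages over the cone. -/
lemma integral_cone_le {g : ℝ → ℝ} {C : NNReal} {M : ℝ} (hg : LipschitzWith C g)
    {t h h' R ε : ℝ} (hh : 0 < h) (hh' : 0 < h') (ht : h' ≤ t) (hε : 0 < ε)
    {u v : ℝ × ℝ → ℝ} (hu : Measurable u) (hv : Measurable v) (huM : ∀ z, |u z| ≤ M)
    (hvM : ∀ z, |v z| ≤ M)
    (H : 0 ≤ ∫ z, kruzkovIntegrand g (fun z => timeCutoff t h h' z.2 * coneCutoff C R ε z) z
      (u z) (v z)) :
    ∫ z, |u z - v z| * (rampKernel t h z.2 * coneCutoff C R ε z)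
      ≤ ∫ z, |u z - v z| * (rampKernel 0 h' z.2 * coneCutoff C R ε z) := by
  have hφ : IsCutoff univ fun z : ℝ × ℝ => timeCutoff t h h' z.2 * coneCutoff C R ε z :=
    isCutoff_cone hh hh' ht hε C.coe_nonneg (subset_univ _)
  have hm : Measurable fun z => |u z - v z| := (hu.sub hv).abs
  have hb : ∀ z, |(|u z - v z|)| ≤ 2 * M := fun z => by
    rw [abs_abs]; exact abs_sub_le_two_mul (huM z) (hvM z)
  have hk : ∀ t' h'', 0 ≤ t' → 0 < h'' →
      Integrable (fun z => |u z - v z| * (rampKernel t' h'' z.2 * coneCutoff C R ε z)) volume := by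
    intro t' h'' ht' hh''
    refine hm.integrable_mul_of_hasCompactSupport hb
      (((continuous_rampKernel t' h'').comp continuous_snd).mul
        (contDiff_coneCutoff C R ε (n := 0)).continuous) ?_
    refine HasCompactSupport.intro ((isCompact_Icc (a := -(R + ε)) (b := R + ε)).prod
      (isCompact_Icc (a := t') (b := t' + h''))) fun z hz => ?_
    by_cases h2 : z.2 ∈ Icc t' (t' + h'')
    · rw [coneCutoff_eq_zero hε C.coe_nonneg (by linarith [h2.1]) fun h1 => hz ⟨h1, h2⟩, mul_zero]
    · rw [rampKernel_eq_zero hh'' fun h' => h2 (Ioo_subset_Icc_self h'),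
        zero_mul]
  have h1 := hk t h (by linarith) hh
  have h2 := hk 0 h' le_rfl hh'
  rw [← sub_nonneg, ← integral_sub h2 h1]
  refine H.trans (integral_mono (hφ.integrable_kruzkovIntegrand hg hu hv huM hvM) (h2.sub h1)
    fun z => ?_)
  refine (kruzkovIntegrand_cone_le hg hh hh' ht hε z (u z) (v z)).trans (le_of_eq ?_)
  ring

/-! ### Localization of the entropy inequality in the parameter -/

/-- A locally integrable function with nonnegative integrals against all smooth nonnegative
functions with compact support in `s` is nonnegative almost everywhere in the interior of `s`. -/
lemma ae_nonneg_of_forall_integral_contDiff_mul_nonneg {N : ℕ} {s : Set (Fin N → ℝ)}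
    {h : (Fin N → ℝ) → ℝ} (hh : LocallyIntegrable h volume)
    (H : ∀ ψ : (Fin N → ℝ) → ℝ, ContDiff ℝ ∞ ψ → HasCompactSupport ψ → tsupport ψ ⊆ s →
      (∀ y, 0 ≤ ψ y) → 0 ≤ ∫ y, ψ y * h y) :
    ∀ᵐ y, y ∈ interior s → 0 ≤ h y := by
  let b : ℕ → ContDiffBump (0 : Fin N → ℝ) := fun n =>
    ⟨1 / (2 * (n + 1)), 1 / (n + 1), by positivity, by
      rw [one_div_lt_one_div (by positivity) (by positivity)]
      have : (0 : ℝ) ≤ n := n.cast_nonneg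
      linarith⟩
  have hb0 : Tendsto (fun n => (b n).rOut) atTop (𝓝 0) := tendsto_one_div_add_atTop_nhds_zero_nat
  have hb : ∀ n, (b n).rOut ≤ 2 * (b n).rIn := fun n => by
    simp only [b]
    apply le_of_eq
    field_simp
  -- Mollifications converge to h almost everywhere, and near an interior point of s each small
  -- mollifier is an admissible ψ.
  filter_upwards [ContDiffBump.ae_convolution_tendsto_right_of_locallyIntegrable (μ := volume) hb0
    (Eventually.of_forall hb) hh] with y hy hys
  obtain ⟨r, hr, hrs⟩ := Metric.isOpen_iff.1 isOpen_interior y hys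
  refine ge_of_tendsto hy ?_
  filter_upwards [hb0.eventually_lt_const hr] with n hn
  rw [convolution_eq_swap]
  have hts : tsupport (fun t => (b n).normed volume (y - t)) ⊆ Metric.closedBall y (b n).rOut := by
    refine closure_minimal (fun t ht => ?_) Metric.isClosed_closedBall
    have : y - t ∈ Function.support ((b n).normed volume) := ht
    rw [(b n).support_normed_eq, mem_ball_zero_iff] at this
    rw [mem_closedBall_iff_norm, norm_sub_rev]
    exact this.le
  refine H (fun t => (b n).normed volume (y - t)) ?_ ?_ ?_ fun t => (b n).nonneg_normed _
  · exact ((b n).contDiff_normed).comp (contDiff_const.sub contDiff_id)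
  · exact HasCompactSupport.of_support_subset_isCompact (isCompact_closedBall y (b n).rOut)
      ((subset_tsupport _).trans hts)
  · exact hts.trans ((Metric.closedBall_subset_ball hn).trans (hrs.trans interior_subset))

/-- The time-space domain `ℝ × (0,T)`. -/
def spaceTime (T : EReal) : Set (ℝ × ℝ) := {z | z.2 ∈ timeInterval T}

lemma isOpen_timeInterval (T : EReal) : IsOpen (timeInterval T) :=
  (isOpen_lt continuous_const continuous_id).inter
    (isOpen_lt continuous_coe_real_ereal continuous_const)

lemma isOpen_spaceTime (T : EReal) : IsOpen (spaceTime T) :=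
  (isOpen_timeInterval T).preimage continuous_snd

lemma measurableSet_paramCube (N : ℕ) : MeasurableSet (paramCube N) := isClosed_Icc.measurableSet

/-- The tensor product of functions of `(x,t)` and of `y`. -/
def tensorFun {N : ℕ} (φ : ℝ × ℝ → ℝ) (ψ : (Fin N → ℝ) → ℝ) (p : ℝ × ℝ × (Fin N → ℝ)) : ℝ :=
  φ (p.1, p.2.1) * ψ p.2.2

section

variable {N : ℕ} {T : EReal} {φ : ℝ × ℝ → ℝ} {ψ : (Fin N → ℝ) → ℝ}

lemma tensorFun_eq_zero {p : ℝ × ℝ × (Fin N → ℝ)}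
    (hp : ¬((p.1, p.2.1) ∈ tsupport φ ∧ p.2.2 ∈ tsupport ψ)) : tensorFun φ ψ p = 0 := by
  unfold tensorFun
  by_contra h
  exact hp ⟨subset_tsupport _ (left_ne_zero_of_mul h), subset_tsupport _ (right_ne_zero_of_mul h)⟩

lemma hasCompactSupport_tensorFun (hφ : HasCompactSupport φ) (hψ : HasCompactSupport ψ) :
    HasCompactSupport (tensorFun φ ψ) := by
  have : IsCompact ((fun q : (ℝ × ℝ) × (Fin N → ℝ) => (q.1.1, q.1.2, q.2)) ''
      (tsupport φ ×ˢ tsupport ψ)) := (hφ.isCompact.prod hψ.isCompact).image (by fun_prop)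
  refine HasCompactSupport.intro this fun p hp => tensorFun_eq_zero fun h => hp ?_
  exact ⟨((p.1, p.2.1), p.2.2), h, rfl⟩

lemma continuous_tensorFun (hφ : Continuous φ) (hψ : Continuous ψ) :
    Continuous (tensorFun φ ψ) := by
  unfold tensorFun
  fun_prop

lemma IsCutoff.isTestFunction_tensorFun (hφ : IsCutoff (spaceTime T) φ) (hψ : ContDiff ℝ ∞ ψ)
    (hψc : HasCompactSupport ψ) (hψs : tsupport ψ ⊆ paramCube N) :
    IsTestFunction (timeInterval T) (tensorFun φ ψ) := by
  refine ⟨?_, hasCompactSupport_tensorFun hφ.compact hψc, ?_⟩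
  · exact (hφ.smooth.comp (contDiff_fst.prodMk (contDiff_fst.comp contDiff_snd))).mul
      (hψ.comp (contDiff_snd.comp contDiff_snd))
  · have hcl : IsClosed {p : ℝ × ℝ × (Fin N → ℝ) | (p.1, p.2.1) ∈ tsupport φ ∧
        p.2.2 ∈ tsupport ψ} :=
      ((isClosed_tsupport φ).preimage (by fun_prop)).inter
        ((isClosed_tsupport ψ).preimage (by fun_prop))
    refine (closure_minimal (fun p hp => ?_) hcl).trans fun p hp =>
      ⟨mem_univ _, hφ.support hp.1, hψs hp.2⟩
    by_contra h
    exact hp (tensorFun_eq_zero h)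

lemma partialT_tensorFun (hφ : Differentiable ℝ φ) (p : ℝ × ℝ × (Fin N → ℝ)) :
    partialT (tensorFun φ ψ) p = tensorFun (fun z => fderiv ℝ φ z (0, 1)) ψ p :=
  ((hasDerivAt_snd_of_differentiable hφ p.1 p.2.1).mul_const (ψ p.2.2)).deriv

lemma partialX_tensorFun (hφ : Differentiable ℝ φ) (p : ℝ × ℝ × (Fin N → ℝ)) :
    partialX (tensorFun φ ψ) p = tensorFun (fun z => fderiv ℝ φ z (1, 0)) ψ p :=
  ((hasDerivAt_fst_of_differentiable hφ p.1 p.2.1).mul_const (ψ p.2.2)).deriv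

end

/-- Integration over `ℝ × ℝ × Y`, first in `(x,t)` and then in `y`. -/
lemma integral_prod_assoc_symm {Y : Type*} [MeasurableSpace Y] {ν : Measure Y} [SFinite ν]
    {F : (ℝ × ℝ) × Y → ℝ}
    (hF : Integrable (fun p : ℝ × ℝ × Y => F ((p.1, p.2.1), p.2.2)) (volume.prod (volume.prod ν))) :
    ∫ p : ℝ × ℝ × Y, F ((p.1, p.2.1), p.2.2) ∂(volume.prod (volume.prod ν))
      = ∫ y, (∫ z, F (z, y)) ∂ν := by
  have hmp := (measurePreserving_prodAssoc (volume : Measure ℝ) (volume : Measure ℝ) ν).symm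
  have e := hmp.integral_comp' F
  have hi := (hmp.integrable_comp_emb (MeasurableEquiv.measurableEmbedding _)).1 hF
  exact e.trans (integral_prod_symm F hi)

lemma integrable_prod_assoc_symm {Y : Type*} [MeasurableSpace Y] {ν : Measure Y} [SFinite ν]
    {F : (ℝ × ℝ) × Y → ℝ}
    (hF : Integrable (fun p : ℝ × ℝ × Y => F ((p.1, p.2.1), p.2.2)) (volume.prod (volume.prod ν))) :
    Integrable F (volume.prod ν) :=
  ((measurePreserving_prodAssoc (volume : Measure ℝ) (volume : Measure ℝ)
    ν).symm.integrable_comp_emb (MeasurableEquiv.measurableEmbedding _)).1 hF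

section Localization

variable {N : ℕ} {T : EReal} {J K : Set ℝ} {f g : ℝ → ℝ} {C : NNReal} {M R : ℝ}
  {ρ : (Fin N → ℝ) → ℝ} {U : ℝ × ℝ → (Fin N → ℝ) → ℝ} {φ : ℝ × ℝ → ℝ} {ψ : (Fin N → ℝ) → ℝ}

/-- The hypothesis is the entropy inequality for every ε > 0. It is applied to the product φψ with ε
= 1/(n + 1), and the limit is taken by dominated convergence. -/
lemma integral_tensorFun_nonneg (hJ : J.OrdConnected) (hf : ContDiffOn ℝ 2 f J) (hKJ : K ⊆ J)
    (hK : K.OrdConnected) (hC : ∀ s ∈ K, |derivWithin f J s| ≤ C)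
    (hfg : EqOn f g K) (hKM : ∀ k ∈ K, |k| ≤ M)
    (hUm : Measurable fun p : (ℝ × ℝ) × (Fin N → ℝ) => U p.1 p.2) (hUK : ∀ z y, U z y ∈ K)
    (hρm : Measurable ρ) (hρR : ∀ y, |ρ y| ≤ R) {k : ℝ} (hk : k ∈ K)
    (H : ∀ ε : ℝ, 0 < ε → ∀ Φ : ℝ × ℝ × (Fin N → ℝ) → ℝ, IsTestFunction (timeInterval T) Φ →
      (∀ p, 0 ≤ Φ p) → 0 ≤ ∫ p in solDomain N T,
        (sqrtEntropy ε k (U (p.1, p.2.1) p.2.2) * partialT Φ p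
          + entropyFlux J f (sqrtEntropy ε k) k (U (p.1, p.2.1) p.2.2) * partialX Φ p) * ρ p.2.2)
    (hφ : IsCutoff (spaceTime T) φ) (hψ : ContDiff ℝ ∞ ψ)
    (hψc : HasCompactSupport ψ) (hψs : tsupport ψ ⊆ paramCube N) (hψ0 : ∀ y, 0 ≤ ψ y) :
    0 ≤ ∫ p : ℝ × ℝ × (Fin N → ℝ),
      kruzkovIntegrand g φ (p.1, p.2.1) (U (p.1, p.2.1) p.2.2) k * ψ p.2.2 * ρ p.2.2 := by
  have hd := hφ.smooth.differentiable (by simp)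
  have hUm' : Measurable fun p : ℝ × ℝ × (Fin N → ℝ) => U (p.1, p.2.1) p.2.2 :=
    hUm.comp (f := fun p : ℝ × ℝ × (Fin N → ℝ) => (((p.1, p.2.1), p.2.2) : (ℝ × ℝ) × (Fin N → ℝ)))
      (by fun_prop)
  have hρm' : Measurable fun p : ℝ × ℝ × (Fin N → ℝ) => ρ p.2.2 := hρm.comp (by fun_prop)
  have hTc : ∀ v, Continuous (tensorFun (fun z => fderiv ℝ φ z v) ψ) := fun v =>
    continuous_tensorFun (hφ.continuous_fderiv_apply v) hψ.continuous
  have hTs : ∀ v, HasCompactSupport (tensorFun (fun z => fderiv ℝ φ z v) ψ) := fun v =>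
    hasCompactSupport_tensorFun (hφ.hasCompactSupport_fderiv_apply v) hψc
  have hTi : ∀ v, Integrable (tensorFun (fun z => fderiv ℝ φ z v) ψ) := fun v =>
    (hTc v).integrable_of_hasCompactSupport (hTs v)
  have hε : ∀ n : ℕ, (0 : ℝ) < 1 / (n + 1) := fun n => by positivity
  have hε0 : Tendsto (fun n : ℕ => (1 : ℝ) / (n + 1)) atTop (𝓝 0) :=
    tendsto_one_div_add_atTop_nhds_zero_nat
  -- The product of cutoffs is supported in the solution domain, so integration may run over the
  -- whole space.
  have hset : ∫ p : ℝ × ℝ × (Fin N → ℝ),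
        kruzkovIntegrand g φ (p.1, p.2.1) (U (p.1, p.2.1) p.2.2) k * ψ p.2.2 * ρ p.2.2
      = ∫ p in solDomain N T,
        kruzkovIntegrand g φ (p.1, p.2.1) (U (p.1, p.2.1) p.2.2) k * ψ p.2.2 * ρ p.2.2 := by
    refine (setIntegral_eq_integral_of_forall_compl_eq_zero fun p hp => ?_).symm
    by_cases h2 : p.2.2 ∈ tsupport ψ
    · have h1 : (p.1, p.2.1) ∉ tsupport φ := fun h1 => hp ⟨mem_univ _, hφ.support h1, hψs h2⟩
      have h3 : fderiv ℝ φ (p.1, p.2.1) = 0 :=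
        image_eq_zero_of_notMem_tsupport fun h => h1 (tsupport_fderiv_subset ℝ h)
      simp [kruzkovIntegrand, h3]
    · simp [image_eq_zero_of_notMem_tsupport h2]
  rw [hset]
  refine ge_of_tendsto' (x := atTop) ?_ fun n : ℕ => H (1 / (n + 1)) (hε n) (tensorFun φ ψ)
    (hφ.isTestFunction_tensorFun hψ hψc hψs) fun p => mul_nonneg (hφ.nonneg _) (hψ0 _)
  simp only [partialT_tensorFun hd, partialX_tensorFun hd]
  have hqK : ∀ n : ℕ, LipschitzOnWith C (entropyFlux J f (sqrtEntropy (1 / (n + 1)) k) k) K :=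
    fun n => LipschitzOnWith.of_dist_le_mul fun v hv w hw =>
      entropyFlux_sub_le hJ hf hKJ hK hC (hε n) hk hv hw
  have hqb : ∀ n : ℕ, ∀ v ∈ K,
      |entropyFlux J f (sqrtEntropy (1 / (n + 1)) k) k v| ≤ C * (2 * M) := by
    intro n v hv
    have := entropyFlux_sub_le hJ hf hKJ hK hC (hε n) hk hv hk
    have h0 : entropyFlux J f (sqrtEntropy (1 / (n + 1)) k) k k = 0 := by simp [entropyFlux]
    rw [h0, sub_zero] at this
    exact this.trans (mul_le_mul_of_nonneg_left
      (abs_sub_le_two_mul (hKM _ hv) (hKM _ hk)) C.coe_nonneg)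
  -- The constant 2M + 1 comes from √((θ - k)² + ε²) ≤ |θ - k| + ε and ε ≤ 1.
  refine tendsto_integral_of_dominated_convergence (fun p =>
    ((2 * M + 1) * |tensorFun (fun z => fderiv ℝ φ z (0, 1)) ψ p|
      + C * (2 * M) * |tensorFun (fun z => fderiv ℝ φ z (1, 0)) ψ p|) * R) (fun n => ?_) ?_
    (fun n => ?_) ?_
  -- The flux is controlled on K only; a Lipschitz extension to ℝ makes its composition with U
  -- measurable.
  · obtain ⟨q, hq, hqeq⟩ := (hqK n).extend_real
    have e : ∀ p : ℝ × ℝ × (Fin N → ℝ),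
        entropyFlux J f (sqrtEntropy (1 / (n + 1)) k) k (U (p.1, p.2.1) p.2.2)
          = q (U (p.1, p.2.1) p.2.2) := fun p => hqeq (hUK _ _)
    simp only [e]
    have m1 : Measurable fun p : ℝ × ℝ × (Fin N → ℝ) =>
        sqrtEntropy (1 / (n + 1)) k (U (p.1, p.2.1) p.2.2) :=
      (contDiff_sqrtEntropy (hε n) k (n := 0)).continuous.measurable.comp hUm'
    have m2 := hq.continuous.measurable.comp hUm'
    exact (((m1.mul (hTc _).measurable).add (m2.mul (hTc _).measurable)).mul
      hρm').aestronglyMeasurable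
  · exact ((((hTi _).abs.const_mul _).add ((hTi _).abs.const_mul _)).mul_const _).integrableOn
  · refine Eventually.of_forall fun p => ?_
    have hUp := hKM _ (hUK (p.1, p.2.1) p.2.2)
    rw [norm_mul]
    refine mul_le_mul ?_ (hρR _) (norm_nonneg _) ?_
    · refine (norm_add_le _ _).trans ?_
      rw [norm_mul, norm_mul]
      refine add_le_add (mul_le_mul_of_nonneg_right ?_ (norm_nonneg _))
        (mul_le_mul_of_nonneg_right (hqb n _ (hUK _ _)) (norm_nonneg _))
      rw [Real.norm_of_nonneg (sqrtEntropy_nonneg _ _ _)]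
      refine (sqrtEntropy_le (hε n) _ _).trans
        (add_le_add (abs_sub_le_two_mul hUp (hKM _ hk)) ?_)
      rw [div_le_one (by positivity)]
      have : (0 : ℝ) ≤ n := n.cast_nonneg
      linarith
    · have hM : 0 ≤ M := (abs_nonneg _).trans hUp
      positivity
  · refine Eventually.of_forall fun p => ?_
    have e : kruzkovIntegrand g φ (p.1, p.2.1) (U (p.1, p.2.1) p.2.2) k * ψ p.2.2
        = |U (p.1, p.2.1) p.2.2 - k| * tensorFun (fun z => fderiv ℝ φ z (0, 1)) ψ p
          + kruzkovFlux g (U (p.1, p.2.1) p.2.2) k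
            * tensorFun (fun z => fderiv ℝ φ z (1, 0)) ψ p := by
      unfold kruzkovIntegrand tensorFun
      ring
    rw [e]
    refine (Tendsto.add (Tendsto.mul_const _ ?_) (Tendsto.mul_const _ ?_)).mul_const _
    · have := ((continuous_sqrtEntropy k).tendsto (0, U (p.1, p.2.1) p.2.2)).comp
        (hε0.prodMk_nhds (tendsto_const_nhds (x := U (p.1, p.2.1) p.2.2)))
      simpa [sqrtEntropy, Real.sqrt_sq_eq_abs, Function.comp_def] using this
    · exact tendsto_entropyFlux hJ hf hKJ hK hfg hk (hUK _ _) hε hε0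

/-- Let G(y) be the Kruzkov integral over (x,t). Varying ψ gives G(y)ρ(y) ≥ 0 almost everywhere in
the interior of the cube, whose frontier is null because the cube is convex. Dividing by ρ requires
ρ(y) ≠ 0, hence the restricted measure. -/
theorem isKruzkov_of_entropy (hJ : J.OrdConnected) (hf : ContDiffOn ℝ 2 f J) (hKJ : K ⊆ J)
    (hK : K.OrdConnected) (hC : ∀ s ∈ K, |derivWithin f J s| ≤ C) (hg : LipschitzWith C g)
    (hfg : EqOn f g K) (hKM : ∀ k ∈ K, |k| ≤ M)
    (hUm : Measurable fun p : (ℝ × ℝ) × (Fin N → ℝ) => U p.1 p.2) (hUK : ∀ z y, U z y ∈ K)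
    (hρm : Measurable ρ) (hρ0 : ∀ y, 0 ≤ ρ y) (hρR : ∀ y, ρ y ≤ R)
    (H : ∀ k ∈ K, ∀ ε : ℝ, 0 < ε → ∀ Φ : ℝ × ℝ × (Fin N → ℝ) → ℝ,
      IsTestFunction (timeInterval T) Φ → (∀ p, 0 ≤ Φ p) → 0 ≤ ∫ p in solDomain N T,
        (sqrtEntropy ε k (U (p.1, p.2.1) p.2.2) * partialT Φ p
          + entropyFlux J f (sqrtEntropy ε k) k (U (p.1, p.2.1) p.2.2) * partialX Φ p)
            * ρ p.2.2) :
    IsKruzkov ((volume.restrict (paramCube N)).restrict {y | ρ y ≠ 0}) (spaceTime T) K g U := by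
  intro k hk φ hφ
  have hρR' : ∀ y, |ρ y| ≤ R := fun y => by rw [abs_of_nonneg (hρ0 y)]; exact hρR y
  have hGm : Measurable fun y => ∫ z, kruzkovIntegrand g φ z (U z y) k := by
    refine (StronglyMeasurable.integral_prod_right (f := fun (y : Fin N → ℝ) (z : ℝ × ℝ) =>
      kruzkovIntegrand g φ z (U z y) k) (Measurable.stronglyMeasurable ?_)).measurable
    exact (continuous_kruzkovIntegrand hg hφ).measurable.comp
      (measurable_snd.prodMk ((hUm.comp measurable_swap).prodMk measurable_const))
  obtain ⟨B, hGB⟩ : ∃ B : ℝ, ∀ y, |∫ z, kruzkovIntegrand g φ z (U z y) k| ≤ B :=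
    ⟨_, fun y => norm_integral_le_of_norm_le
      (f := fun z => kruzkovIntegrand g φ z (U z y) k) (hφ.integrable_bound (2 * M) (C * (2 * M)))
      (Eventually.of_forall fun z =>
        abs_kruzkovIntegrand_le hg (hKM _ (hUK z y)) (hKM _ hk) φ z)⟩
  have hloc : LocallyIntegrable (fun y => (∫ z, kruzkovIntegrand g φ z (U z y) k) * ρ y)
      volume := by
    refine (memLp_top_of_bound (hGm.mul hρm).aestronglyMeasurable (B * R)
      (Eventually.of_forall fun y => ?_)).locallyIntegrable le_top
    rw [Pi.mul_apply, norm_mul]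
    exact mul_le_mul (hGB y) (hρR' y) (norm_nonneg _) ((abs_nonneg _).trans (hGB y))
  have hae := ae_nonneg_of_forall_integral_contDiff_mul_nonneg (s := paramCube N) hloc
    fun ψ hψ hψc hψs hψ0 => ?_
  · have hfr : volume (frontier (paramCube N)) = 0 :=
      (convex_Icc (𝕜 := ℝ) (fun _ : Fin N => (-1 : ℝ)) fun _ => 1).addHaar_frontier volume
    have hne : MeasurableSet {y | ρ y ≠ 0} := hρm (measurableSet_singleton 0).compl
    rw [ae_restrict_iff' hne,
      ae_restrict_iff' (measurableSet_paramCube N)]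
    have hfr' : ∀ᵐ y, y ∉ frontier (paramCube N) := measure_eq_zero_iff_ae_notMem.1 hfr
    filter_upwards [hae, hfr'] with y hy hyf hyc hyρ
    have hin : y ∈ interior (paramCube N) := by
      by_contra hin
      exact hyf ⟨subset_closure hyc, hin⟩
    exact nonneg_of_mul_nonneg_left (hy hin) (lt_of_le_of_ne (hρ0 y) (Ne.symm hyρ))
  · have h1 := integral_tensorFun_nonneg hJ hf hKJ hK hC hfg hKM hUm hUK hρm hρR' hk (H k hk)
      hφ hψ hψc hψs hψ0
    have e := integral_prod_assoc_symm (ν := (volume : Measure (Fin N → ℝ)))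
      (F := fun q => kruzkovIntegrand g φ q.1 (U q.1 q.2) k * ψ q.2 * ρ q.2) ?_
    · have h2 : 0 ≤ ∫ y, (∫ z, kruzkovIntegrand g φ z (U z y) k * ψ y * ρ y) := h1.trans_eq e
      refine h2.trans_eq (integral_congr_ae (Eventually.of_forall fun y => ?_))
      simp only [mul_assoc]
      rw [integral_mul_const]
      ring
    · have hUm' : Measurable fun p : ℝ × ℝ × (Fin N → ℝ) => U (p.1, p.2.1) p.2.2 :=
        hUm.comp (f := fun p : ℝ × ℝ × (Fin N → ℝ) =>
          (((p.1, p.2.1), p.2.2) : (ℝ × ℝ) × (Fin N → ℝ))) (by fun_prop)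
      have hTi : ∀ v, Integrable (tensorFun (fun z => fderiv ℝ φ z v) ψ) := fun v =>
        (continuous_tensorFun (hφ.continuous_fderiv_apply v)
          hψ.continuous).integrable_of_hasCompactSupport
          (hasCompactSupport_tensorFun (hφ.hasCompactSupport_fderiv_apply v) hψc)
      have hm : Measurable fun p : ℝ × ℝ × (Fin N → ℝ) =>
          kruzkovIntegrand g φ (p.1, p.2.1) (U (p.1, p.2.1) p.2.2) k * ψ p.2.2 * ρ p.2.2 := by
        refine (Measurable.mul ?_ (hψ.continuous.measurable.comp (by fun_prop))).mul
          (hρm.comp (by fun_prop))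
        exact (continuous_kruzkovIntegrand hg hφ).measurable.comp
          ((by fun_prop : Measurable fun p : ℝ × ℝ × (Fin N → ℝ) => (p.1, p.2.1)).prodMk
            (hUm'.prodMk measurable_const))
      refine ((((hTi (0, 1)).abs.const_mul (2 * M)).add
        ((hTi (1, 0)).abs.const_mul (C * (2 * M)))).mul_const R).mono' hm.aestronglyMeasurable
        (Eventually.of_forall fun p => ?_)
      have hUp := hKM _ (hUK (p.1, p.2.1) p.2.2)
      have hM : 0 ≤ M := (abs_nonneg _).trans hUp
      rw [norm_mul, norm_mul]
      simp only [Pi.add_apply, tensorFun, abs_mul]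
      refine mul_le_mul ?_ (hρR' _) (norm_nonneg _) (by positivity)
      refine (mul_le_mul_of_nonneg_right
        (abs_kruzkovIntegrand_le hg hUp (hKM _ hk) φ _) (norm_nonneg _)).trans (le_of_eq ?_)
      rw [Real.norm_eq_abs]
      ring

end Localization

/-! ### Time averages of the distance -/

lemma abs_weight_mul_abs_sub_le {Y : Type*} {M B : ℝ} {b : Y → ℝ} (hb0 : ∀ y, 0 ≤ b y) (hbB : ∀ y, b y ≤ B)
    {a c : ℝ} (ha : |a| ≤ M) (hc : |c| ≤ M) (y : Y) : |b y * (|a - c|)| ≤ B * (2 * M) := by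
  rw [abs_mul, abs_abs, abs_of_nonneg (hb0 y)]
  exact mul_le_mul (hbB y) (abs_sub_le_two_mul ha hc) (abs_nonneg _) ((hb0 y).trans (hbB y))

section Averages

variable {Y : Type*} [MeasurableSpace Y] {ν : Measure Y} {g : ℝ → ℝ} {C : NNReal} {M B : ℝ}
  {U V : ℝ × ℝ → Y → ℝ} {b : Y → ℝ}

/-- The slab `|x| ≤ m` in the space of the points `(x,t,y)`. -/
def slab (Y : Type*) (m : ℝ) : Set (ℝ × ℝ × Y) := Icc (-m) m ×ˢ univ

lemma measurableSet_slab (m : ℝ) : MeasurableSet (slab Y m) :=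
  measurableSet_Icc.prod MeasurableSet.univ

lemma integrableOn_slab_mul_rampKernel [IsFiniteMeasure ν] {G : ℝ × ℝ × Y → ℝ} {A : ℝ}
    (hG : Measurable G) (hGA : ∀ p, |G p| ≤ A) (m t : ℝ) {h : ℝ} (hh : 0 < h) :
    IntegrableOn (fun p => G p * rampKernel t h p.2.1) (slab Y m)
      (volume.prod (volume.prod ν)) := by
  have h1 : Integrable (fun q : ℝ × Y => rampKernel t h q.1) (volume.prod ν) :=
    (integrable_rampKernel hh t).comp_fst ν
  have h2 : Integrable (fun p : ℝ × ℝ × Y => rampKernel t h p.2.1)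
      ((volume.restrict (Icc (-m) m)).prod (volume.prod ν)) := h1.comp_snd _
  rw [IntegrableOn, slab, ← Measure.prod_restrict, Measure.restrict_univ]
  exact h2.bdd_mul hG.aestronglyMeasurable (Eventually.of_forall hGA)

/-- The weighted average of `|U - V|` over `|x| ≤ m` and times in `[t,t+h]`. -/
def distAverage (ν : Measure Y) (b : Y → ℝ) (U V : ℝ × ℝ → Y → ℝ) (m t h : ℝ) : ℝ :=
  ∫ p in slab Y m, b p.2.2 * |U (p.1, p.2.1) p.2.2 - V (p.1, p.2.1) p.2.2|
    * rampKernel t h p.2.1 ∂(volume.prod (volume.prod ν))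

lemma measurable_comp_assoc (hUm : Measurable fun p : (ℝ × ℝ) × Y => U p.1 p.2) :
    Measurable fun p : ℝ × ℝ × Y => U (p.1, p.2.1) p.2.2 :=
  hUm.comp (f := fun p : ℝ × ℝ × Y => (((p.1, p.2.1), p.2.2) : (ℝ × ℝ) × Y)) (by fun_prop)

lemma measurable_weight_mul_abs_sub (hbm : Measurable b)
    (hUm : Measurable fun p : (ℝ × ℝ) × Y => U p.1 p.2)
    (hVm : Measurable fun p : (ℝ × ℝ) × Y => V p.1 p.2) :
    Measurable fun p : ℝ × ℝ × Y =>
      b p.2.2 * |U (p.1, p.2.1) p.2.2 - V (p.1, p.2.1) p.2.2| :=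
  (hbm.comp (by fun_prop)).mul ((measurable_comp_assoc hUm).sub (measurable_comp_assoc hVm)).abs

lemma distAverage_mono [IsFiniteMeasure ν] (hbm : Measurable b) (hb0 : ∀ y, 0 ≤ b y)
    (hbB : ∀ y, b y ≤ B) (hUm : Measurable fun p : (ℝ × ℝ) × Y => U p.1 p.2)
    (hVm : Measurable fun p : (ℝ × ℝ) × Y => V p.1 p.2)
    (hUM : ∀ z y, |U z y| ≤ M) (hVM : ∀ z y, |V z y| ≤ M) {m m' t h : ℝ} (hm : m ≤ m')
    (hh : 0 < h) : distAverage ν b U V m t h ≤ distAverage ν b U V m' t h := by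
  refine setIntegral_mono_set (integrableOn_slab_mul_rampKernel
    (measurable_weight_mul_abs_sub hbm hUm hVm)
    (fun p => abs_weight_mul_abs_sub_le hb0 hbB (hUM _ _) (hVM _ _) _) m' t hh) ?_ ?_
  · exact Eventually.of_forall fun p => mul_nonneg (mul_nonneg (hb0 _) (abs_nonneg _))
      (rampKernel_nonneg hh _ _)
  · exact LE.le.eventuallyLE
      (prod_mono (Icc_subset_Icc (neg_le_neg hm) hm) subset_rfl)

/-- The averaged contraction inequality between the time intervals `[0,h']` and `[t,t+h]`. -/
lemma distAverage_le [IsFiniteMeasure ν] {T : EReal} (hg : LipschitzWith C g)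
    (hbm : Measurable b) (hb0 : ∀ y, 0 ≤ b y)
    (hbB : ∀ y, b y ≤ B) (hUm : Measurable fun p : (ℝ × ℝ) × Y => U p.1 p.2)
    (hVm : Measurable fun p : (ℝ × ℝ) × Y => V p.1 p.2)
    (hUM : ∀ z y, |U z y| ≤ M) (hVM : ∀ z y, |V z y| ≤ M)
    (hkato : ∀ φ, IsCutoff (spaceTime T) φ → ∀ᵐ y ∂ν, b y ≠ 0 →
      0 ≤ ∫ z, kruzkovIntegrand g φ z (U z y) (V z y))
    {m t h h' ε : ℝ} (hh : 0 < h) (hh' : 0 < h') (ht : h' ≤ t) (hε : 0 < ε)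
    (hT : t + h ∈ timeInterval T) :
    distAverage ν b U V m t h ≤ distAverage ν b U V (m + C * (t + h) + ε) 0 h' := by
  -- For every time s ≤ t + h the cone |x| + Cs ≤ R still contains |x| ≤ m.
  set R := m + C * (t + h)
  have hcut : IsCutoff (spaceTime T) fun z => timeCutoff t h h' z.2 * coneCutoff C R ε z := by
    refine isCutoff_cone hh hh' ht hε C.coe_nonneg fun z hz => ⟨?_, ?_⟩
    · exact lt_of_lt_of_le (by positivity) hz.2.1
    · exact lt_of_le_of_lt (EReal.coe_le_coe_iff.2 hz.2.2) hT.2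
  set G : ℝ × ℝ × Y → ℝ := fun p =>
    b p.2.2 * |U (p.1, p.2.1) p.2.2 - V (p.1, p.2.1) p.2.2| with hGdef
  have hGm : Measurable G := measurable_weight_mul_abs_sub hbm hUm hVm
  have hGb : ∀ p, |G p| ≤ B * (2 * M) := fun p =>
    abs_weight_mul_abs_sub_le hb0 hbB (hUM _ _) (hVM _ _) _
  have hG0 : ∀ p, 0 ≤ G p := fun p => mul_nonneg (hb0 _) (abs_nonneg _)
  set F : ℝ → ℝ → (ℝ × ℝ) × Y → ℝ := fun t' h'' q =>
    b q.2 * (|U q.1 q.2 - V q.1 q.2| * (rampKernel t' h'' q.1.2 * coneCutoff C R ε q.1)) with hF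
  have hFG : ∀ t' h'' (p : ℝ × ℝ × Y), F t' h'' ((p.1, p.2.1), p.2.2)
      = G p * coneCutoff C R ε (p.1, p.2.1) * rampKernel t' h'' p.2.1 := by
    intro t' h'' p
    simp only [hF, hGdef]
    ring
  -- The kernel confines the time to s > t' ≥ 0, where the cone cutoff vanishes outside |x| ≤ R + ε.
  have hFind : ∀ t' h'', 0 ≤ t' → 0 < h'' → ∀ p : ℝ × ℝ × Y,
      F t' h'' ((p.1, p.2.1), p.2.2) = (slab Y (R + ε)).indicator
        (fun p => G p * coneCutoff C R ε (p.1, p.2.1) * rampKernel t' h'' p.2.1) p := by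
    intro t' h'' ht' hh'' p
    rw [hFG]
    by_cases hp : p ∈ slab Y (R + ε)
    · rw [indicator_of_mem hp]
    · rw [indicator_of_notMem hp]
      by_cases hs : p.2.1 ∈ Ioo t' (t' + h'')
      · rw [coneCutoff_eq_zero hε C.coe_nonneg (z := (p.1, p.2.1)) (ht'.trans hs.1.le)
          fun h1 => hp ⟨h1, mem_univ _⟩]
        simp
      · rw [rampKernel_eq_zero hh'' hs, mul_zero]
  have hcone : Measurable fun p : ℝ × ℝ × Y => coneCutoff C R ε (p.1, p.2.1) :=
    (contDiff_coneCutoff (C : ℝ) R ε (n := 0)).continuous.measurable.comp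
      (f := fun p : ℝ × ℝ × Y => (p.1, p.2.1)) (by fun_prop)
  have hGc : ∀ p, |G p * coneCutoff C R ε (p.1, p.2.1)| ≤ B * (2 * M) := fun p => by
    rw [abs_mul, abs_of_nonneg (coneCutoff_nonneg _ _ _ _)]
    exact (mul_le_of_le_one_right (abs_nonneg _) (coneCutoff_le_one _ _ _ _)).trans (hGb p)
  have hFi : ∀ t' h'', 0 ≤ t' → 0 < h'' →
      Integrable (fun p : ℝ × ℝ × Y => F t' h'' ((p.1, p.2.1), p.2.2))
        (volume.prod (volume.prod ν)) := by
    intro t' h'' ht' hh''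
    rw [funext (hFind t' h'' ht' hh''), integrable_indicator_iff (measurableSet_slab _)]
    exact integrableOn_slab_mul_rampKernel (hGm.mul hcone) hGc _ _ hh''
  have ht0 : 0 ≤ t := hh'.le.trans ht
  have key : ∫ p : ℝ × ℝ × Y, F t h ((p.1, p.2.1), p.2.2) ∂(volume.prod (volume.prod ν))
      ≤ ∫ p : ℝ × ℝ × Y, F 0 h' ((p.1, p.2.1), p.2.2) ∂(volume.prod (volume.prod ν)) := by
    have hi1 := hFi t h ht0 hh
    have hi2 := hFi 0 h' le_rfl hh'
    rw [integral_prod_assoc_symm hi1, integral_prod_assoc_symm hi2]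
    refine integral_mono_ae (integrable_prod_assoc_symm hi1).integral_prod_right
      (integrable_prod_assoc_symm hi2).integral_prod_right ?_
    filter_upwards [hkato _ hcut] with y hy
    simp only [hF, integral_const_mul]
    rcases eq_or_ne (b y) 0 with h0 | h0
    · simp [h0]
    · exact mul_le_mul_of_nonneg_left (integral_cone_le hg hh hh' ht hε
        (hUm.comp (measurable_id.prodMk measurable_const))
        (hVm.comp (measurable_id.prodMk measurable_const)) (fun z => hUM z y)
        (fun z => hVM z y) (hy h0)) (hb0 y)
  -- On the left the cone cutoff equals 1 wherever |x| ≤ m and the kernel is nonzero; on the right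
  -- it is at most 1.
  refine le_trans ?_ (key.trans ?_)
  · unfold distAverage
    rw [← integral_indicator (measurableSet_slab _)]
    refine integral_mono ?_ (hFi t h ht0 hh) fun p => ?_
    · rw [integrable_indicator_iff (measurableSet_slab _)]
      exact integrableOn_slab_mul_rampKernel hGm hGb _ _ hh
    · simp only [hFG]
      by_cases hp : p ∈ slab Y m
      · rw [indicator_of_mem hp]
        by_cases hs : p.2.1 ∈ Ioo t (t + h)
        · rw [coneCutoff_eq_one hε (z := (p.1, p.2.1)), mul_one]
          have h1 : |p.1| ≤ m := abs_le.2 hp.1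
          have h2 := mul_le_mul_of_nonneg_left hs.2.le C.coe_nonneg
          simp only [R]
          linarith
        · rw [rampKernel_eq_zero hh hs]; simp
      · rw [indicator_of_notMem hp]
        exact mul_nonneg (mul_nonneg (hG0 _) (coneCutoff_nonneg _ _ _ _)) (rampKernel_nonneg hh _ _)
  · unfold distAverage
    rw [funext (hFind 0 h' le_rfl hh'), integral_indicator (measurableSet_slab _)]
    refine integral_mono (integrableOn_slab_mul_rampKernel (hGm.mul hcone) hGc _ _ hh')
      (integrableOn_slab_mul_rampKernel hGm hGb _ _ hh') fun p => ?_
    exact mul_le_mul_of_nonneg_right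
      (mul_le_of_le_one_right (hG0 p) (coneCutoff_le_one _ _ _ _)) (rampKernel_nonneg hh' _ _)

/-- The averaged distance of `U` to `w` over `|x| ≤ m` and the time interval `(t,t+h)`. -/
def traceDefect (ν : Measure Y) (b : Y → ℝ) (U : ℝ × ℝ → Y → ℝ) (w : ℝ × Y → ℝ)
    (m t h : ℝ) : ℝ :=
  h⁻¹ * ∫ p in Icc (-m) m ×ˢ Ioo t (t + h) ×ˢ univ,
    |U (p.1, p.2.1) p.2.2 - w (p.1, p.2.2)| * b p.2.2 ∂(volume.prod (volume.prod ν))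

/-- The kernel has mass 1, so a time-independent integrand is its own average. This puts the limit
of `distAverage` in a form that can be subtracted from it. -/
lemma integral_slab_mul_rampKernel [IsFiniteMeasure ν] {G : ℝ × Y → ℝ} {A : ℝ}
    (hG : Measurable G) (hGA : ∀ p, |G p| ≤ A) (m t : ℝ) {h : ℝ} (hh : 0 < h) :
    ∫ p in slab Y m, G (p.1, p.2.2) * rampKernel t h p.2.1 ∂(volume.prod (volume.prod ν))
      = ∫ q in Icc (-m) m ×ˢ univ, G q ∂(volume.prod ν) := by
  have hG' : Measurable fun p : ℝ × ℝ × Y => G (p.1, p.2.2) := hG.comp (by fun_prop)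
  have hi := integrableOn_slab_mul_rampKernel (ν := ν) hG' (fun p => hGA _) m t hh
  rw [slab, IntegrableOn, ← Measure.prod_restrict, Measure.restrict_univ] at hi
  rw [slab, ← Measure.prod_restrict, Measure.restrict_univ, integral_prod _ hi,
    ← Measure.prod_restrict, Measure.restrict_univ, integral_prod]
  · refine integral_congr_ae (Eventually.of_forall fun x => ?_)
    have := integral_prod_mul (μ := (volume : Measure ℝ)) (ν := ν) (rampKernel t h)
      fun y => G (x, y)
    rw [integral_rampKernel hh, one_mul] at this
    simp only [mul_comm]
    rw [← this]
  · have : IsFiniteMeasure (volume.restrict (Icc (-m) m)) := ⟨by simp⟩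
    exact Integrable.of_bound hG.aestronglyMeasurable A (Eventually.of_forall hGA)

/-- The smooth kernel is at most D/h, and |U - V| differs from |w₁ - w₂| by at most |U - w₁| + |V -
w₂|. The error is therefore at most D times the sum of the two trace defects. -/
lemma tendsto_distAverage [IsFiniteMeasure ν] (hbm : Measurable b) (hb0 : ∀ y, 0 ≤ b y)
    (hbB : ∀ y, b y ≤ B) (hUm : Measurable fun p : (ℝ × ℝ) × Y => U p.1 p.2)
    (hVm : Measurable fun p : (ℝ × ℝ) × Y => V p.1 p.2)
    (hUM : ∀ z y, |U z y| ≤ M) (hVM : ∀ z y, |V z y| ≤ M) {w₁ w₂ : ℝ × Y → ℝ}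
    (hw₁m : Measurable w₁) (hw₂m : Measurable w₂) (hw₁M : ∀ q, |w₁ q| ≤ M)
    (hw₂M : ∀ q, |w₂ q| ≤ M) {m t : ℝ} {h : ℕ → ℝ} (hh : ∀ n, 0 < h n)
    (h₁ : Tendsto (fun n => traceDefect ν b U w₁ m t (h n)) atTop (𝓝 0))
    (h₂ : Tendsto (fun n => traceDefect ν b V w₂ m t (h n)) atTop (𝓝 0)) :
    Tendsto (fun n => distAverage ν b U V m t (h n)) atTop
      (𝓝 (∫ q in Icc (-m) m ×ˢ univ, b q.2 * |w₁ q - w₂ q| ∂(volume.prod ν))) := by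
  obtain ⟨D, hD⟩ := exists_deriv_ramp_le
  rw [tendsto_iff_dist_tendsto_zero]
  refine squeeze_zero (fun _ => dist_nonneg) (fun n => ?_)
    (by simpa using (h₁.add h₂).const_mul D)
  have hw : Measurable fun q : ℝ × Y => b q.2 * |w₁ q - w₂ q| :=
    (hbm.comp measurable_snd).mul (hw₁m.sub hw₂m).abs
  have hwb : ∀ q : ℝ × Y, |b q.2 * (|w₁ q - w₂ q|)| ≤ B * (2 * M) := fun q =>
    abs_weight_mul_abs_sub_le hb0 hbB (hw₁M q) (hw₂M q) q.2
  have hG := measurable_weight_mul_abs_sub hbm hUm hVm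
  have hGb : ∀ p : ℝ × ℝ × Y, |b p.2.2 * (|U (p.1, p.2.1) p.2.2 - V (p.1, p.2.1) p.2.2|)|
      ≤ B * (2 * M) := fun p => abs_weight_mul_abs_sub_le hb0 hbB (hUM _ _) (hVM _ _) _
  have hw' : Measurable fun p : ℝ × ℝ × Y => b p.2.2 * |w₁ (p.1, p.2.2) - w₂ (p.1, p.2.2)| :=
    hw.comp (f := fun p : ℝ × ℝ × Y => (p.1, p.2.2)) (by fun_prop)
  rw [Real.dist_eq, distAverage, ← integral_slab_mul_rampKernel hw hwb m t (hh n),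
    ← integral_sub (integrableOn_slab_mul_rampKernel hG hGb m t (hh n))
      (integrableOn_slab_mul_rampKernel hw' (fun p => hwb (p.1, p.2.2)) m t (hh n))]
  set S : Set (ℝ × ℝ × Y) := Icc (-m) m ×ˢ Ioo t (t + h n) ×ˢ univ with hS
  have hSm : MeasurableSet S := measurableSet_Icc.prod (measurableSet_Ioo.prod MeasurableSet.univ)
  have hSfin : IsFiniteMeasure ((volume.prod (volume.prod ν)).restrict S) := by
    rw [hS, ← Measure.prod_restrict, ← Measure.prod_restrict]
    have i1 : IsFiniteMeasure ((volume : Measure ℝ).restrict (Icc (-m) m)) := ⟨by simp⟩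
    have i2 : IsFiniteMeasure ((volume : Measure ℝ).restrict (Ioo t (t + h n))) := ⟨by simp⟩
    infer_instance
  have hdef : ∀ {Z : ℝ × ℝ → Y → ℝ} {w : ℝ × Y → ℝ},
      Measurable (fun p : (ℝ × ℝ) × Y => Z p.1 p.2) → Measurable w → (∀ z y, |Z z y| ≤ M) →
      (∀ q, |w q| ≤ M) → IntegrableOn (fun p : ℝ × ℝ × Y =>
        |Z (p.1, p.2.1) p.2.2 - w (p.1, p.2.2)| * b p.2.2) S (volume.prod (volume.prod ν)) := by
    intro Z w hZ hw hZM hwM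
    refine Integrable.of_bound (Measurable.aestronglyMeasurable ?_) (B * (2 * M))
      (Eventually.of_forall fun p => ?_)
    · exact ((measurable_comp_assoc hZ).sub (hw.comp (f := fun p : ℝ × ℝ × Y => (p.1, p.2.2))
        (by fun_prop))).abs.mul (hbm.comp (by fun_prop))
    · rw [mul_comm]
      exact abs_weight_mul_abs_sub_le hb0 hbB (hZM _ _) (hwM _) _
  have hI₁ := hdef hUm hw₁m hUM hw₁M
  have hI₂ := hdef hVm hw₂m hVM hw₂M
  unfold traceDefect
  rw [← mul_add, ← integral_add hI₁ hI₂, ← mul_assoc, ← integral_const_mul,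
    ← integral_indicator (measurableSet_slab _), ← integral_indicator hSm, ← Real.norm_eq_abs]
  refine norm_integral_le_of_norm_le ?_ (Eventually.of_forall fun p => ?_)
  · rw [integrable_indicator_iff hSm]
    exact (hI₁.add hI₂).const_mul _
  · by_cases hp : p ∈ slab Y m
    · rw [indicator_of_mem hp]
      by_cases hs : p.2.1 ∈ Ioo t (t + h n)
      · rw [indicator_of_mem (show p ∈ S from ⟨hp.1, hs, mem_univ _⟩), ← sub_mul, norm_mul,
          Real.norm_of_nonneg (rampKernel_nonneg (hh n) _ _), ← mul_sub, norm_mul,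
          Real.norm_of_nonneg (hb0 _), Real.norm_eq_abs, mul_comm, ← add_mul]
        have hk : rampKernel t (h n) p.2.1 ≤ D * (h n)⁻¹ := by
          unfold rampKernel
          rw [div_eq_mul_inv]
          exact mul_le_mul_of_nonneg_right (hD _) (inv_nonneg.2 (hh n).le)
        refine mul_le_mul hk ?_ (mul_nonneg (hb0 _) (abs_nonneg _))
          ((rampKernel_nonneg (hh n) _ _).trans hk)
        rw [mul_comm]
        refine mul_le_mul_of_nonneg_right ?_ (hb0 _)
        refine (abs_abs_sub_abs_le _ _).trans ?_
        refine le_trans (le_of_eq ?_) (abs_sub _ _)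
        congr 1
        ring
      · rw [rampKernel_eq_zero (hh n) hs, indicator_of_notMem fun h' => hs h'.2.1]
        simp
    · rw [indicator_of_notMem hp, indicator_of_notMem fun h' => hp ⟨h'.1, mem_univ _⟩]
      simp

/-- The contraction inequality between a time `t` and the initial time, at which `U` and `V` have
mean traces along sequences. -/
theorem integral_abs_sub_le_of_kato [IsFiniteMeasure ν] {T : EReal} (hg : LipschitzWith C g)
    (hbm : Measurable b) (hb0 : ∀ y, 0 ≤ b y)
    (hbB : ∀ y, b y ≤ B) (hUm : Measurable fun p : (ℝ × ℝ) × Y => U p.1 p.2)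
    (hVm : Measurable fun p : (ℝ × ℝ) × Y => V p.1 p.2)
    (hUM : ∀ z y, |U z y| ≤ M) (hVM : ∀ z y, |V z y| ≤ M)
    (hkato : ∀ φ, IsCutoff (spaceTime T) φ → ∀ᵐ y ∂ν, b y ≠ 0 →
      0 ≤ ∫ z, kruzkovIntegrand g φ z (U z y) (V z y))
    {u₀ v₀ w₁ w₂ : ℝ × Y → ℝ} (hu₀m : Measurable u₀) (hv₀m : Measurable v₀)
    (hw₁m : Measurable w₁) (hw₂m : Measurable w₂) (hu₀M : ∀ q, |u₀ q| ≤ M)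
    (hv₀M : ∀ q, |v₀ q| ≤ M) (hw₁M : ∀ q, |w₁ q| ≤ M) (hw₂M : ∀ q, |w₂ q| ≤ M)
    {t : ℝ} (ht : t ∈ timeInterval T) {h : ℕ → ℝ} (hh : ∀ n, 0 < h n)
    (hh0 : Tendsto h atTop (𝓝 0)) {m : ℝ}
    (hu₀ : Tendsto (fun n => traceDefect ν b U u₀ (m + (C + 1) * t) 0 (h n)) atTop (𝓝 0))
    (hv₀ : Tendsto (fun n => traceDefect ν b V v₀ (m + (C + 1) * t) 0 (h n)) atTop (𝓝 0))
    (hw₁ : Tendsto (fun n => traceDefect ν b U w₁ m t (h n)) atTop (𝓝 0))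
    (hw₂ : Tendsto (fun n => traceDefect ν b V w₂ m t (h n)) atTop (𝓝 0)) :
    ∫ q in Icc (-m) m ×ˢ univ, b q.2 * |w₁ q - w₂ q| ∂(volume.prod ν)
      ≤ ∫ q in Icc (-(m + (C + 1) * t)) (m + (C + 1) * t) ×ˢ univ,
          b q.2 * |u₀ q - v₀ q| ∂(volume.prod ν) := by
  have l1 := tendsto_distAverage (ν := ν) hbm hb0 hbB hUm hVm hUM hVM hw₁m hw₂m hw₁M hw₂M hh
    hw₁ hw₂
  have l0 := tendsto_distAverage (ν := ν) hbm hb0 hbB hUm hVm hUM hVM hu₀m hv₀m hu₀M hv₀M hh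
    hu₀ hv₀
  have ht0 : 0 < t := ht.1
  have e1 : ∀ᶠ n in atTop, t + h n ∈ timeInterval T := by
    have : Tendsto (fun n => t + h n) atTop (𝓝 (t + 0)) := tendsto_const_nhds.add hh0
    rw [add_zero] at this
    exact this.eventually ((isOpen_timeInterval T).mem_nhds ht)
  -- With ε = t/2 and C h < t/2 the radius m + C(t + h) + ε stays below m + (C + 1)t: the added
  -- speed 1 provides this room.
  have e2 : ∀ᶠ n in atTop, (C : ℝ) * h n < t / 2 := by
    have : Tendsto (fun n => (C : ℝ) * h n) atTop (𝓝 (C * 0)) := hh0.const_mul _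
    rw [mul_zero] at this
    exact this.eventually_lt_const (by positivity)
  refine le_of_tendsto l1 ?_
  filter_upwards [e1, e2] with n hn1 hn2
  -- The two averaging lengths are independent: the one at time 0 shrinks first, with the one at t
  -- fixed.
  refine ge_of_tendsto l0 ?_
  filter_upwards [hh0.eventually_le_const ht0] with k hk
  refine (distAverage_le hg hbm hb0 hbB hUm hVm hUM hVM hkato (hh n) (hh k) hk
    (half_pos ht0) hn1).trans (distAverage_mono hbm hb0 hbB hUm hVm hUM hVM ?_ (hh k))
  linarith

end Averages

/-! ### Solutions as their own mean traces at almost every time -/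

/-- The interval (t,t+h) fills half of the ball of radius h around t, so the right average is at
most twice the centred one, which tends to 0 at Lebesgue points. -/
lemma ae_tendsto_average_right {v : ℝ → ℝ} {M : ℝ} (hv : Measurable v) (hvM : ∀ s, |v s| ≤ M)
    {h : ℕ → ℝ} (hh : ∀ n, 0 < h n) (hh0 : Tendsto h atTop (𝓝 0)) :
    ∀ᵐ t, Tendsto (fun n => (h n)⁻¹ * ∫ s in Ioo t (t + h n), |v s - v t|) atTop (𝓝 0) := by
  have hvl : LocallyIntegrable v volume :=
    (memLp_top_of_bound hv.aestronglyMeasurable M (Eventually.of_forall hvM)).locallyIntegrable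
      le_top
  filter_upwards [IsUnifLocDoublingMeasure.ae_tendsto_average_norm_sub volume hvl 1] with t ht
  have ht' := (ht (fun _ : ℕ => t) h
    (tendsto_nhdsWithin_iff.2 ⟨hh0, Eventually.of_forall hh⟩)
    (Eventually.of_forall fun n => Metric.mem_closedBall_self (by simpa using (hh n).le))).const_mul 2
  rw [mul_zero] at ht'
  refine squeeze_zero (fun n => ?_) (fun n => ?_) ht'
  · exact mul_nonneg (inv_nonneg.2 (hh n).le) (integral_nonneg fun _ => abs_nonneg _)
  · have hvol : volume.real (Metric.closedBall t (h n)) = 2 * h n := by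
      rw [Measure.real, Real.volume_closedBall, ENNReal.toReal_ofReal (by linarith [hh n])]
    rw [setAverage_eq, hvol, smul_eq_mul, mul_inv, ← mul_assoc, ← mul_assoc,
      mul_inv_cancel₀ two_ne_zero, one_mul]
    refine mul_le_mul_of_nonneg_left ?_ (inv_nonneg.2 (hh n).le)
    have hc := isCompact_closedBall t (h n)
    refine setIntegral_mono_set (((hvl.integrableOn_isCompact hc).sub
      (integrableOn_const hc.measure_ne_top)).norm)
      (Eventually.of_forall fun _ => abs_nonneg _) (LE.le.eventuallyLE ?_)
    rw [Real.closedBall_eq_Icc]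
    exact fun s hs => ⟨by linarith [hs.1, hh n], hs.2.le⟩

section Trace

variable {Y : Type*} [MeasurableSpace Y] {ν : Measure Y} {M B : ℝ}
  {U : ℝ × ℝ → Y → ℝ} {b : Y → ℝ}

lemma integrableOn_traceDefect [IsFiniteMeasure ν] {w : ℝ × Y → ℝ} (hbm : Measurable b)
    (hb0 : ∀ y, 0 ≤ b y)
    (hbB : ∀ y, b y ≤ B) (hUm : Measurable fun p : (ℝ × ℝ) × Y => U p.1 p.2)
    (hUM : ∀ z y, |U z y| ≤ M) (hw : Measurable w) (hwM : ∀ q, |w q| ≤ M) (m t h : ℝ) :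
    IntegrableOn (fun p : ℝ × ℝ × Y => |U (p.1, p.2.1) p.2.2 - w (p.1, p.2.2)| * b p.2.2)
      (Icc (-m) m ×ˢ Ioo t (t + h) ×ˢ univ) (volume.prod (volume.prod ν)) := by
  have hfin : IsFiniteMeasure ((volume.prod (volume.prod ν)).restrict
      (Icc (-m) m ×ˢ Ioo t (t + h) ×ˢ univ)) := by
    rw [← Measure.prod_restrict, ← Measure.prod_restrict]
    have i1 : IsFiniteMeasure ((volume : Measure ℝ).restrict (Icc (-m) m)) := ⟨by simp⟩
    have i2 : IsFiniteMeasure ((volume : Measure ℝ).restrict (Ioo t (t + h))) := ⟨by simp⟩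
    infer_instance
  refine Integrable.of_bound (Measurable.aestronglyMeasurable ?_) (B * (2 * M))
    (Eventually.of_forall fun p => ?_)
  · exact ((measurable_comp_assoc hUm).sub (hw.comp (f := fun p : ℝ × ℝ × Y => (p.1, p.2.2))
      (by fun_prop))).abs.mul (hbm.comp (by fun_prop))
  · rw [mul_comm]
    exact abs_weight_mul_abs_sub_le hb0 hbB (hUM _ _) (hwM _) _

lemma traceDefect_mono [IsFiniteMeasure ν] {w : ℝ × Y → ℝ} (hbm : Measurable b)
    (hb0 : ∀ y, 0 ≤ b y)
    (hbB : ∀ y, b y ≤ B) (hUm : Measurable fun p : (ℝ × ℝ) × Y => U p.1 p.2)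
    (hUM : ∀ z y, |U z y| ≤ M) (hw : Measurable w) (hwM : ∀ q, |w q| ≤ M) {m m' t h : ℝ}
    (hm : m ≤ m') (hh : 0 < h) : traceDefect ν b U w m t h ≤ traceDefect ν b U w m' t h :=
  mul_le_mul_of_nonneg_left (setIntegral_mono_set
    (integrableOn_traceDefect hbm hb0 hbB hUm hUM hw hwM m' t h)
    (Eventually.of_forall fun _ => mul_nonneg (abs_nonneg _) (hb0 _))
    (LE.le.eventuallyLE (prod_mono (Icc_subset_Icc (neg_le_neg hm) hm) subset_rfl)))
    (inv_nonneg.2 hh.le)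

lemma traceDefect_nonneg {w : ℝ × Y → ℝ} (hb0 : ∀ y, 0 ≤ b y) {m t h : ℝ} (hh : 0 < h) :
    0 ≤ traceDefect ν b U w m t h :=
  mul_nonneg (inv_nonneg.2 hh.le)
    (integral_nonneg fun _ => mul_nonneg (abs_nonneg _) (hb0 _))

lemma traceDefect_eq [IsFiniteMeasure ν] {w : ℝ × Y → ℝ} (hbm : Measurable b)
    (hb0 : ∀ y, 0 ≤ b y)
    (hbB : ∀ y, b y ≤ B) (hUm : Measurable fun p : (ℝ × ℝ) × Y => U p.1 p.2)
    (hUM : ∀ z y, |U z y| ≤ M) (hw : Measurable w) (hwM : ∀ q, |w q| ≤ M) (m t h : ℝ) :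
    traceDefect ν b U w m t h = ∫ q, b q.2 * (h⁻¹ * ∫ s in Ioo t (t + h),
      |U (q.1, s) q.2 - w q|) ∂((volume.restrict (Icc (-m) m)).prod ν) := by
  have hi := integrableOn_traceDefect (ν := ν) hbm hb0 hbB hUm hUM hw hwM m t h
  have i1 : IsFiniteMeasure ((volume : Measure ℝ).restrict (Icc (-m) m)) := ⟨by simp⟩
  have i2 : IsFiniteMeasure ((volume : Measure ℝ).restrict (Ioo t (t + h))) := ⟨by simp⟩
  rw [IntegrableOn, ← Measure.prod_restrict, ← Measure.prod_restrict, Measure.restrict_univ] at hi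
  unfold traceDefect
  rw [← Measure.prod_restrict, ← Measure.prod_restrict, Measure.restrict_univ,
    integral_prod _ hi, integral_prod, ← integral_const_mul]
  · refine integral_congr_ae ?_
    filter_upwards [hi.prod_right_ae] with x hx
    rw [integral_prod_symm _ hx, ← integral_const_mul]
    refine integral_congr_ae (Eventually.of_forall fun y => ?_)
    simp only
    rw [integral_mul_const]
    ring
  · have hm : Measurable fun q : ℝ × Y => ∫ s in Ioo t (t + h), |U (q.1, s) q.2 - w q| := by
      refine (StronglyMeasurable.integral_prod_right (f := fun (q : ℝ × Y) (s : ℝ) =>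
        |U (q.1, s) q.2 - w q|) (Measurable.stronglyMeasurable ?_)).measurable
      exact ((hUm.comp (f := fun r : (ℝ × Y) × ℝ => ((r.1.1, r.2), r.1.2)) (by fun_prop)).sub
        (hw.comp measurable_fst)).abs
    refine Integrable.of_bound ((hbm.comp measurable_snd).mul
      (hm.const_mul _)).aestronglyMeasurable
      (B * (|h⁻¹| * (2 * M * volume.real (Ioo t (t + h))))) (Eventually.of_forall fun q => ?_)
    rw [norm_mul, norm_mul, Real.norm_of_nonneg (hb0 _)]
    refine mul_le_mul (hbB _) (mul_le_mul_of_nonneg_left ?_ (abs_nonneg _)) (by positivity)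
      ((hb0 q.2).trans (hbB _))
    refine norm_setIntegral_le_of_norm_le_const (by simp) fun s _ => ?_
    rw [norm_abs_eq_norm]
    exact abs_sub_le_two_mul (hUM _ _) (hwM _)

/-- For each (x,y), almost every t is a Lebesgue point of s ↦ U(x,s,y). Exchanging the quantifiers
and integrating over bounded x and over y by dominated convergence gives the trace. -/
lemma ae_tendsto_traceDefect_of_radius [IsFiniteMeasure ν] (hbm : Measurable b)
    (hb0 : ∀ y, 0 ≤ b y) (hbB : ∀ y, b y ≤ B)
    (hUm : Measurable fun p : (ℝ × ℝ) × Y => U p.1 p.2) (hUM : ∀ z y, |U z y| ≤ M)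
    {h : ℕ → ℝ} (hh : ∀ n, 0 < h n) (hh0 : Tendsto h atTop (𝓝 0)) (m : ℝ) :
    ∀ᵐ t, Tendsto (fun n => traceDefect ν b U (fun q => U (q.1, t) q.2) m t (h n)) atTop
      (𝓝 0) := by
  have i1 : IsFiniteMeasure ((volume : Measure ℝ).restrict (Icc (-m) m)) := ⟨by simp⟩
  set D : ℕ → ℝ × ℝ × Y → ℝ := fun n r =>
    (h n)⁻¹ * ∫ s in Ioo r.1 (r.1 + h n), |U (r.2.1, s) r.2.2 - U (r.2.1, r.1) r.2.2| with hD
  have hDm : ∀ n, Measurable (D n) := by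
    intro n
    have hA : Measurable fun q : (ℝ × ℝ × Y) × ℝ =>
        |U (q.1.2.1, q.2) q.1.2.2 - U (q.1.2.1, q.1.1) q.1.2.2| := by
      refine (Measurable.sub ?_ ?_).abs
      · exact hUm.comp (f := fun q : (ℝ × ℝ × Y) × ℝ => ((q.1.2.1, q.2), q.1.2.2)) (by fun_prop)
      · exact hUm.comp (f := fun q : (ℝ × ℝ × Y) × ℝ => ((q.1.2.1, q.1.1), q.1.2.2))
          (by fun_prop)
    have hS : MeasurableSet {q : (ℝ × ℝ × Y) × ℝ | q.2 ∈ Ioo q.1.1 (q.1.1 + h n)} :=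
      MeasurableSet.inter
        (measurableSet_lt (f := fun q : (ℝ × ℝ × Y) × ℝ => q.1.1) (g := fun q => q.2)
          (by fun_prop) (by fun_prop))
        (measurableSet_lt (f := fun q : (ℝ × ℝ × Y) × ℝ => q.2) (g := fun q => q.1.1 + h n)
          (by fun_prop) (by fun_prop))
    -- The interval of integration moves with r; an indicator on the product space makes the joint
    -- measurability visible.
    have e : D n = fun r => (h n)⁻¹ * ∫ s,
        {q : (ℝ × ℝ × Y) × ℝ | q.2 ∈ Ioo q.1.1 (q.1.1 + h n)}.indicator (fun q =>
          |U (q.1.2.1, q.2) q.1.2.2 - U (q.1.2.1, q.1.1) q.1.2.2|) (r, s) := by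
      funext r
      simp only [hD]
      rw [← integral_indicator measurableSet_Ioo]
      rfl
    rw [e]
    exact (StronglyMeasurable.integral_prod_right
      (f := fun (r : ℝ × ℝ × Y) (s : ℝ) =>
        {q : (ℝ × ℝ × Y) × ℝ | q.2 ∈ Ioo q.1.1 (q.1.1 + h n)}.indicator (fun q =>
          |U (q.1.2.1, q.2) q.1.2.2 - U (q.1.2.1, q.1.1) q.1.2.2|) (r, s))
      (hA.indicator hS).stronglyMeasurable).measurable.const_mul _
  have hD0 : ∀ n r, |D n r| ≤ 2 * M := by
    intro n r
    have h1 := norm_setIntegral_le_of_norm_le_const (μ := volume) (s := Ioo r.1 (r.1 + h n))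
      (f := fun s => |U (r.2.1, s) r.2.2 - U (r.2.1, r.1) r.2.2|) (C := 2 * M) (by simp)
      fun s _ => by
        rw [norm_abs_eq_norm]; exact abs_sub_le_two_mul (hUM _ _) (hUM _ _)
    rw [Real.volume_real_Ioo_of_le (by linarith [hh n]), add_sub_cancel_left] at h1
    simp only [hD]
    rw [abs_mul, abs_of_pos (inv_pos.2 (hh n)), inv_mul_le_iff₀ (hh n), mul_comm (h n)]
    exact h1
  have hq : ∀ q : ℝ × Y, ∀ᵐ t, Tendsto (fun n => D n (t, q)) atTop (𝓝 0) := fun q =>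
    ae_tendsto_average_right (v := fun s => U (q.1, s) q.2)
      (hUm.comp (f := fun s : ℝ => ((q.1, s), q.2)) (by fun_prop)) (fun s => hUM _ _) hh hh0
  have hms : MeasurableSet {r : ℝ × ℝ × Y | Tendsto (fun n => D n r) atTop (𝓝 0)} := by
    exact measurableSet_tendsto (𝓝 0) hDm
  have hswap := (Measure.ae_ae_comm (μ := (volume : Measure ℝ))
    (ν := (volume.restrict (Icc (-m) m)).prod ν)
    (p := fun t q => Tendsto (fun n => D n (t, q)) atTop (𝓝 0)) hms).2 (Eventually.of_forall hq)
  filter_upwards [hswap] with t ht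
  have hUt : Measurable fun q : ℝ × Y => U (q.1, t) q.2 :=
    hUm.comp (f := fun q : ℝ × Y => ((q.1, t), q.2)) (by fun_prop)
  simp only [traceDefect_eq hbm hb0 hbB hUm hUM hUt fun q => hUM _ _]
  have := tendsto_integral_of_dominated_convergence
    (μ := (volume.restrict (Icc (-m) m)).prod ν) (F := fun n q => b q.2 * D n (t, q))
    (f := fun _ => 0) (fun _ => B * (2 * M)) (fun n => ?_) (integrable_const _)
    (fun n => Eventually.of_forall fun q => ?_) ?_
  · simpa using this
  · exact ((hbm.comp measurable_snd).mul
      ((hDm n).comp (measurable_const.prodMk measurable_id))).aestronglyMeasurable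
  · rw [norm_mul, Real.norm_of_nonneg (hb0 _)]
    exact mul_le_mul (hbB _) (hD0 _ _) (abs_nonneg _) ((hb0 q.2).trans (hbB _))
  · filter_upwards [ht] with q hq
    simpa using hq.const_mul (b q.2)

/-- Almost every time is a time at which the mean trace of `U` is `U` itself. -/
theorem ae_forall_tendsto_traceDefect [IsFiniteMeasure ν] (hbm : Measurable b)
    (hb0 : ∀ y, 0 ≤ b y) (hbB : ∀ y, b y ≤ B)
    (hUm : Measurable fun p : (ℝ × ℝ) × Y => U p.1 p.2) (hUM : ∀ z y, |U z y| ≤ M)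
    {h : ℕ → ℝ} (hh : ∀ n, 0 < h n) (hh0 : Tendsto h atTop (𝓝 0)) :
    ∀ᵐ t, ∀ m, Tendsto (fun n => traceDefect ν b U (fun q => U (q.1, t) q.2) m t (h n)) atTop
      (𝓝 0) := by
  -- Integer radii give one null set; monotonicity in the radius covers every m.
  have hall := ae_all_iff.2 fun k : ℕ =>
    ae_tendsto_traceDefect_of_radius (ν := ν) hbm hb0 hbB hUm hUM hh hh0 k
  filter_upwards [hall] with t ht m
  obtain ⟨k, hk⟩ := exists_nat_ge m
  have hUt : Measurable fun q : ℝ × Y => U (q.1, t) q.2 :=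
    hUm.comp (f := fun q : ℝ × Y => ((q.1, t), q.2)) (by fun_prop)
  exact squeeze_zero (fun n => traceDefect_nonneg hb0 (hh n)) (fun n =>
    traceDefect_mono hbm hb0 hbB hUm hUM hUt (fun q => hUM _ _) hk (hh n)) (ht k)

end Trace

/-! ### Measurable representatives and slicing of the domains -/

/-- Values outside S are replaced by one point of S. Afterwards all bounds and memberships hold
everywhere, which the doubling argument assumes. -/
lemma exists_measurable_forall_mem_ae_eq {α : Type*} [MeasurableSpace α] {μ : Measure α}
    {u : α → ℝ} {S : Set ℝ} (hS : MeasurableSet S) (hne : S.Nonempty)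
    (hu : AEStronglyMeasurable u μ) (huS : ∀ᵐ x ∂μ, u x ∈ S) :
    ∃ v : α → ℝ, Measurable v ∧ (∀ x, v x ∈ S) ∧ ∀ᵐ x ∂μ, u x = v x := by
  classical
  obtain ⟨s, hs⟩ := hne
  refine ⟨fun x => if hu.mk u x ∈ S then hu.mk u x else s, ?_, fun x => ?_, ?_⟩
  · exact Measurable.ite (hu.stronglyMeasurable_mk.measurable hS)
      hu.stronglyMeasurable_mk.measurable measurable_const
  · by_cases h : hu.mk u x ∈ S <;> simp [h, hs]
  · filter_upwards [huS, hu.ae_eq_mk] with x h1 h2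
    rw [← h2, if_pos h1]

lemma MemLp.exists_ae_abs_le {α : Type*} [MeasurableSpace α] {μ : Measure α} {u : α → ℝ}
    (hu : MemLp u ⊤ μ) : ∃ M : ℝ, 0 ≤ M ∧ ∀ᵐ x ∂μ, |u x| ≤ M := by
  refine ⟨(eLpNormEssSup u μ).toReal, ENNReal.toReal_nonneg, ?_⟩
  have h := hu.2
  rw [eLpNorm_exponent_top] at h
  filter_upwards [ae_le_eLpNormEssSup (f := u) (μ := μ)] with x hx
  have := ENNReal.toReal_mono h.ne hx
  simpa using this

/-- Bringing time to the front is what allows statements almost everywhere in (x,t,y) to be sliced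
at fixed t, and conversely. -/
lemma measurePreserving_prod_swap_left {X Z Y : Type*} [MeasurableSpace X] [MeasurableSpace Z]
    [MeasurableSpace Y] (μ : Measure X) (ξ : Measure Z) (ν : Measure Y) [SFinite μ] [SFinite ξ]
    [SFinite ν] :
    MeasurePreserving (fun r : X × Z × Y => (r.2.1, r.1, r.2.2)) (μ.prod (ξ.prod ν))
      (ξ.prod (μ.prod ν)) :=
  ((measurePreserving_prodAssoc ξ μ ν).comp
    ((Measure.measurePreserving_swap (μ := μ) (ν := ξ)).prod (MeasurePreserving.id ν))).comp
    (measurePreserving_prodAssoc μ ξ ν).symm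

section Domains

variable {N : ℕ} {T : EReal}

lemma volume_restrict_solDomain :
    volume.restrict (solDomain N T)
      = volume.prod ((volume.restrict (timeInterval T)).prod (volume.restrict (paramCube N))) := by
  rw [solDomain, Measure.volume_eq_prod, Measure.volume_eq_prod, ← Measure.prod_restrict,
    ← Measure.prod_restrict, Measure.restrict_univ]

lemma volume_restrict_dataDomain :
    volume.restrict (dataDomain N) = volume.prod (volume.restrict (paramCube N)) := by
  rw [dataDomain, Measure.volume_eq_prod, ← Measure.prod_restrict, Measure.restrict_univ]

instance isFiniteMeasure_restrict_paramCube :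
    IsFiniteMeasure (volume.restrict (paramCube N)) :=
  ⟨by rw [Measure.restrict_apply_univ]; exact isCompact_Icc.measure_lt_top⟩

lemma ae_solDomain_of_ae_paramCube {P : (Fin N → ℝ) → Prop}
    (h : ∀ᵐ y ∂volume.restrict (paramCube N), P y) :
    ∀ᵐ p ∂volume.restrict (solDomain N T), P p.2.2 := by
  rw [volume_restrict_solDomain]
  exact (Measure.quasiMeasurePreserving_snd.comp Measure.quasiMeasurePreserving_snd).ae h

lemma ae_solDomain_of_ae_dataDomain {P : ℝ × (Fin N → ℝ) → Prop}
    (h : ∀ᵐ q ∂volume.restrict (dataDomain N), P q) :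
    ∀ᵐ p ∂volume.restrict (solDomain N T), P (p.1, p.2.2) := by
  rw [volume_restrict_dataDomain] at h
  rw [volume_restrict_solDomain]
  exact (Measure.quasiMeasurePreserving_snd.comp
    (measurePreserving_prod_swap_left _ _ _).quasiMeasurePreserving).ae h

lemma ae_ae_of_ae_solDomain {P : ℝ × ℝ × (Fin N → ℝ) → Prop}
    (h : ∀ᵐ p ∂volume.restrict (solDomain N T), P p) :
    ∀ᵐ t ∂volume.restrict (timeInterval T), ∀ᵐ q ∂volume.restrict (dataDomain N),
      P (q.1, t, q.2) := by
  rw [volume_restrict_solDomain] at h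
  rw [volume_restrict_dataDomain]
  exact Measure.ae_ae_of_ae_prod
    ((measurePreserving_prod_swap_left _ _ _).quasiMeasurePreserving.ae h)

lemma ae_solDomain_of_ae_ae {P : ℝ × ℝ × (Fin N → ℝ) → Prop} (hP : MeasurableSet {p | P p})
    (h : ∀ᵐ t ∂volume.restrict (timeInterval T), ∀ᵐ q ∂volume.restrict (dataDomain N),
      P (q.1, t, q.2)) :
    ∀ᵐ p ∂volume.restrict (solDomain N T), P p := by
  rw [volume_restrict_dataDomain] at h
  rw [volume_restrict_solDomain]
  have hm : MeasurableSet {r : ℝ × ℝ × (Fin N → ℝ) | P (r.2.1, r.1, r.2.2)} :=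
    (show Measurable fun r : ℝ × ℝ × (Fin N → ℝ) => (r.2.1, r.1, r.2.2) by fun_prop) hP
  have h' := (Measure.ae_prod_iff_ae_ae hm).2 h
  exact (measurePreserving_prod_swap_left _ _ _).quasiMeasurePreserving.ae h'

lemma volume_paramCube_ne_zero : volume (paramCube N) ≠ 0 := by
  rw [paramCube, Real.volume_Icc_pi]
  refine Finset.prod_ne_zero_iff.2 fun i _ => ?_
  norm_num

/-- A property true almost everywhere on a non-null domain holds somewhere; this shows that the set
of admissible values is nonempty. -/
lemma volume_solDomain_ne_zero (hT : 0 < T) : volume (solDomain N T) ≠ 0 := by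
  have hI : volume (timeInterval T) ≠ 0 := by
    refine ((isOpen_timeInterval T).measure_pos volume ?_).ne'
    obtain ⟨t, ht0, htT⟩ := EReal.lt_iff_exists_real_btwn.1 hT
    exact ⟨t, by exact_mod_cast ht0, htT⟩
  rw [solDomain, Measure.volume_eq_prod, Measure.volume_eq_prod, Measure.prod_prod,
    Measure.prod_prod]
  exact mul_ne_zero (by simp) (mul_ne_zero hI volume_paramCube_ne_zero)

end Domains

/-! ### The weight ρ² on Γ₁ -/

section Contraction

variable {N : ℕ} {T : EReal} {g : ℝ → ℝ} {C : NNReal} {M R : ℝ} {ρ : (Fin N → ℝ) → ℝ}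
  {U V : ℝ × ℝ → (Fin N → ℝ) → ℝ}

lemma setIntegral_weight_eq (ρ : (Fin N → ℝ) → ℝ) {w : ℝ × (Fin N → ℝ) → ℝ} (m : ℝ)
    {Γ₁ : Set (Fin N → ℝ)} (hΓ : MeasurableSet Γ₁) (hΓc : Γ₁ ⊆ paramCube N) :
    ∫ q in Icc (-m) m ×ˢ univ, Γ₁.indicator (fun y => ρ y ^ 2) q.2 * w q
        ∂(volume.prod (volume.restrict (paramCube N)))
      = ∫ z in Icc (-m) m ×ˢ Γ₁, w z * ρ z.2 ^ 2 := by
  have e : (fun q : ℝ × (Fin N → ℝ) => Γ₁.indicator (fun y => ρ y ^ 2) q.2 * w q)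
      = ((univ : Set ℝ) ×ˢ Γ₁).indicator fun q => w q * ρ q.2 ^ 2 := by
    funext q
    by_cases hq : q.2 ∈ Γ₁
    · rw [indicator_of_mem hq, indicator_of_mem (show q ∈ univ ×ˢ Γ₁ from ⟨mem_univ _, hq⟩),
        mul_comm]
    · rw [indicator_of_notMem hq, indicator_of_notMem fun h : q ∈ univ ×ˢ Γ₁ => hq h.2, zero_mul]
  rw [e, ← Measure.prod_restrict, Measure.restrict_univ, Measure.prod_restrict,
    setIntegral_indicator (MeasurableSet.univ.prod hΓ), prod_inter_prod, inter_univ,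
    inter_eq_right.2 hΓc]
  rfl

/-- The weight b, equal to ρ² on Γ₁ and 0 elsewhere, satisfies b ≤ Rρ. Trace defects for ρ thus
control those for b, and b(y) ≠ 0 forces ρ(y) ≠ 0, where Kato's inequality is available. -/
lemma contraction_of_traceDefect (hg : LipschitzWith C g) (hρm : Measurable ρ)
    (hρ0 : ∀ y, 0 ≤ ρ y) (hρR : ∀ y, ρ y ≤ R)
    (hUm : Measurable fun p : (ℝ × ℝ) × (Fin N → ℝ) => U p.1 p.2)
    (hVm : Measurable fun p : (ℝ × ℝ) × (Fin N → ℝ) => V p.1 p.2)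
    (hUM : ∀ z y, |U z y| ≤ M) (hVM : ∀ z y, |V z y| ≤ M)
    (hkato : ∀ φ, IsCutoff (spaceTime T) φ → ∀ᵐ y ∂volume.restrict (paramCube N), ρ y ≠ 0 →
      0 ≤ ∫ z, kruzkovIntegrand g φ z (U z y) (V z y))
    {u₀ v₀ w₁ w₂ : ℝ × (Fin N → ℝ) → ℝ} (hu₀m : Measurable u₀) (hv₀m : Measurable v₀)
    (hw₁m : Measurable w₁) (hw₂m : Measurable w₂) (hu₀M : ∀ q, |u₀ q| ≤ M)
    (hv₀M : ∀ q, |v₀ q| ≤ M) (hw₁M : ∀ q, |w₁ q| ≤ M) (hw₂M : ∀ q, |w₂ q| ≤ M)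
    {t : ℝ} (ht : t ∈ timeInterval T) {h : ℕ → ℝ} (hh : ∀ n, 0 < h n)
    (hh0 : Tendsto h atTop (𝓝 0))
    (hu₀ : ∀ m, Tendsto (fun n => traceDefect (volume.restrict (paramCube N)) ρ U u₀ m 0 (h n))
      atTop (𝓝 0))
    (hv₀ : ∀ m, Tendsto (fun n => traceDefect (volume.restrict (paramCube N)) ρ V v₀ m 0 (h n))
      atTop (𝓝 0))
    (hw₁ : ∀ m, Tendsto (fun n => traceDefect (volume.restrict (paramCube N)) ρ U w₁ m t (h n))
      atTop (𝓝 0))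
    (hw₂ : ∀ m, Tendsto (fun n => traceDefect (volume.restrict (paramCube N)) ρ V w₂ m t (h n))
      atTop (𝓝 0)) (m : ℝ) {Γ₁ : Set (Fin N → ℝ)} (hΓ : MeasurableSet Γ₁)
    (hΓc : Γ₁ ⊆ paramCube N) :
    ∫ z in Icc (-m) m ×ˢ Γ₁, |w₁ z - w₂ z| * ρ z.2 ^ 2
      ≤ ∫ z in Icc (-(m + (C + 1) * t)) (m + (C + 1) * t) ×ˢ Γ₁,
        |u₀ z - v₀ z| * ρ z.2 ^ 2 := by
  set b := Γ₁.indicator fun y => ρ y ^ 2 with hb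
  have hbm : Measurable b := (hρm.pow_const 2).indicator hΓ
  have hb0 : ∀ y, 0 ≤ b y := fun y => indicator_nonneg (fun y _ => sq_nonneg (ρ y)) y
  have hbρ : ∀ y, b y ≤ R * ρ y := fun y => by
    have h1 : b y ≤ ρ y ^ 2 := indicator_le_self' (fun y _ => sq_nonneg (ρ y)) y
    refine h1.trans ?_
    rw [sq]
    exact mul_le_mul_of_nonneg_right (hρR y) (hρ0 y)
  have hR : ∀ y, 0 ≤ R := fun y : Fin N → ℝ => (hρ0 y).trans (hρR y)
  have hbB : ∀ y, b y ≤ R * R := fun y =>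
    (hbρ y).trans (mul_le_mul_of_nonneg_left (hρR y) (hR y))
  have htr : ∀ {Z : ℝ × ℝ → (Fin N → ℝ) → ℝ} {w : ℝ × (Fin N → ℝ) → ℝ} {m s : ℝ},
      Measurable (fun p : (ℝ × ℝ) × (Fin N → ℝ) => Z p.1 p.2) → Measurable w →
      (∀ z y, |Z z y| ≤ M) → (∀ q, |w q| ≤ M) →
      Tendsto (fun n => traceDefect (volume.restrict (paramCube N)) ρ Z w m s (h n)) atTop (𝓝 0) →
      Tendsto (fun n => traceDefect (volume.restrict (paramCube N)) b Z w m s (h n)) atTop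
        (𝓝 0) := by
    intro Z w m s hZ hw hZM hwM hlim
    have hlim' := hlim.const_mul R
    rw [mul_zero] at hlim'
    refine squeeze_zero (fun n => traceDefect_nonneg hb0 (hh n)) (fun n => ?_) hlim'
    unfold traceDefect
    rw [mul_left_comm, ← integral_const_mul R]
    refine mul_le_mul_of_nonneg_left (integral_mono
      (integrableOn_traceDefect (ν := volume.restrict (paramCube N)) hbm hb0 hbB hZ hZM hw hwM m s (h n))
      ((integrableOn_traceDefect (ν := volume.restrict (paramCube N)) hρm hρ0 hρR hZ hZM hw hwM m s (h n)).const_mul R) fun p => ?_)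
      (inv_nonneg.2 (hh n).le)
    simp only
    rw [mul_left_comm]
    exact mul_le_mul_of_nonneg_left (hbρ _) (abs_nonneg _)
  have key := integral_abs_sub_le_of_kato (ν := volume.restrict (paramCube N)) hg hbm hb0 hbB
    hUm hVm hUM hVM (T := T) (fun φ hφ => ?_) hu₀m hv₀m hw₁m hw₂m hu₀M hv₀M hw₁M hw₂M ht hh hh0
    (m := m) (htr hUm hu₀m hUM hu₀M (hu₀ _)) (htr hVm hv₀m hVM hv₀M (hv₀ _))
    (htr hUm hw₁m hUM hw₁M (hw₁ _)) (htr hVm hw₂m hVM hw₂M (hw₂ _))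
  · rwa [setIntegral_weight_eq ρ (w := fun q => |w₁ q - w₂ q|) m hΓ hΓc,
      setIntegral_weight_eq ρ (w := fun q => |u₀ q - v₀ q|) _ hΓ hΓc] at key
  · filter_upwards [hkato φ hφ] with y hy hby
    refine hy fun h0 => hby ?_
    exact le_antisymm ((hbρ y).trans (by rw [h0, mul_zero])) (hb0 y)

end Contraction

/-! ### Passage to representatives -/

section Transfer

variable {N : ℕ} {T : EReal} {ρ ρ' : (Fin N → ℝ) → ℝ} {u : ℝ × ℝ × (Fin N → ℝ) → ℝ}
  {U : ℝ × ℝ → (Fin N → ℝ) → ℝ} {w w' : ℝ × (Fin N → ℝ) → ℝ}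

/-- Once t + h < T, the averaging region lies in the solution domain, so almost everywhere equal
functions have equal defects. -/
lemma IsMeanTrace.tendsto_traceDefect {t : ℝ} (hw : IsMeanTrace ρ u t w) (ht : 0 ≤ t)
    (htT : (t : EReal) < T)
    (huU : ∀ᵐ p ∂volume.restrict (solDomain N T), u p = U (p.1, p.2.1) p.2.2)
    (hww : ∀ᵐ q ∂volume.restrict (dataDomain N), w q = w' q)
    (hρρ : ∀ᵐ y ∂volume.restrict (paramCube N), ρ y = ρ' y) {h : ℕ → ℝ} (hh : ∀ n, 0 < h n)
    (hh0 : Tendsto h atTop (𝓝 0)) (m : ℝ) :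
    Tendsto (fun n => traceDefect (volume.restrict (paramCube N)) ρ' U w' m t (h n)) atTop
      (𝓝 0) := by
  refine ((hw (Icc (-m) m) isCompact_Icc).comp
    (tendsto_nhdsWithin_iff.2 ⟨hh0, Eventually.of_forall hh⟩)).congr' ?_
  have e1 : ∀ᶠ n in atTop, ((t + h n : ℝ) : EReal) < T := by
    have h1 : Tendsto (fun n => t + h n) atTop (𝓝 t) := by
      simpa using tendsto_const_nhds.add hh0
    exact h1.eventually
      ((isOpen_lt continuous_coe_real_ereal continuous_const).mem_nhds (show t ∈ {s : ℝ | (s : EReal) < T} from htT))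
  filter_upwards [e1] with n hn
  have hsub : Icc (-m) m ×ˢ Ioo t (t + h n) ×ˢ paramCube N ⊆ solDomain N T := by
    refine prod_mono (subset_univ _) (prod_mono (fun s hs => ⟨ht.trans_lt hs.1, ?_⟩) subset_rfl)
    exact lt_trans (EReal.coe_lt_coe_iff.2 hs.2) hn
  simp only [Function.comp_apply, traceDefect]
  congr 1
  rw [← Measure.prod_restrict, ← Measure.prod_restrict, Measure.restrict_univ, Measure.prod_restrict,
    Measure.prod_restrict]
  refine integral_congr_ae (ae_restrict_of_ae_restrict_of_subset hsub ?_)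
  filter_upwards [huU, ae_solDomain_of_ae_dataDomain hww, ae_solDomain_of_ae_paramCube hρρ]
    with p h1 h2 h3
  rw [h1, h2, h3]

lemma setIntegral_congr_dataDomain {v v' : ℝ × (Fin N → ℝ) → ℝ}
    (hww : ∀ᵐ q ∂volume.restrict (dataDomain N), w q = w' q)
    (hvv : ∀ᵐ q ∂volume.restrict (dataDomain N), v q = v' q)
    (hρρ : ∀ᵐ y ∂volume.restrict (paramCube N), ρ y = ρ' y) (A : Set ℝ) {Γ₁ : Set (Fin N → ℝ)}
    (hΓc : Γ₁ ⊆ paramCube N) :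
    ∫ z in A ×ˢ Γ₁, |w z - v z| * ρ z.2 ^ 2 = ∫ z in A ×ˢ Γ₁, |w' z - v' z| * ρ' z.2 ^ 2 := by
  have hρ2 : ∀ᵐ q ∂volume.restrict (dataDomain N), ρ q.2 = ρ' q.2 := by
    rw [volume_restrict_dataDomain]
    exact Measure.quasiMeasurePreserving_snd.ae hρρ
  refine integral_congr_ae (ae_restrict_of_ae_restrict_of_subset
    (prod_mono (subset_univ _) hΓc : A ×ˢ Γ₁ ⊆ dataDomain N) ?_)
  filter_upwards [hww, hvv, hρ2] with q h1 h2 h3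
  rw [h1, h2, h3]

end Transfer

/-! ### Contraction and uniqueness for weak entropy solutions -/

section Solutions

variable {N : ℕ} {T : EReal} {J K : Set ℝ} {f g : ℝ → ℝ} {C : NNReal} {M R : ℝ}
  {ρ ρ' : (Fin N → ℝ) → ℝ} {u₀ v₀ : ℝ × (Fin N → ℝ) → ℝ} {u v : ℝ × ℝ × (Fin N → ℝ) → ℝ}
  {U V : ℝ × ℝ → (Fin N → ℝ) → ℝ}

lemma IsWeakEntropySolution.isKruzkov (hu : IsWeakEntropySolution J f ρ T u₀ u)
    (hJ : J.OrdConnected) (hf : ContDiffOn ℝ 2 f J) (hKJ : K ⊆ J)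
    (hK : K.OrdConnected) (hC : ∀ s ∈ K, |derivWithin f J s| ≤ C) (hg : LipschitzWith C g)
    (hfg : EqOn f g K) (hKM : ∀ k ∈ K, |k| ≤ M)
    (hUm : Measurable fun p : (ℝ × ℝ) × (Fin N → ℝ) => U p.1 p.2) (hUK : ∀ z y, U z y ∈ K)
    (hρm : Measurable ρ') (hρ0 : ∀ y, 0 ≤ ρ' y) (hρR : ∀ y, ρ' y ≤ R)
    (huU : ∀ᵐ p ∂volume.restrict (solDomain N T), u p = U (p.1, p.2.1) p.2.2)
    (hρρ : ∀ᵐ y ∂volume.restrict (paramCube N), ρ y = ρ' y) :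
    IsKruzkov ((volume.restrict (paramCube N)).restrict {y | ρ' y ≠ 0}) (spaceTime T) K g U := by
  refine isKruzkov_of_entropy hJ hf hKJ hK hC hg hfg hKM hUm hUK hρm hρ0 hρR
    fun k hk ε hε Φ hΦ hΦ0 => ?_
  refine (hu.entropy_ineq (sqrtEntropy ε k) (convexOn_sqrtEntropy ε k)
    (contDiff_sqrtEntropy hε k).contDiffOn k (hKJ hk) Φ hΦ hΦ0).trans_eq (integral_congr_ae ?_)
  filter_upwards [huU, ae_solDomain_of_ae_paramCube hρρ] with p h1 h2
  rw [h1, h2]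

lemma exists_measurable_uncurried {S : Set ℝ} (hS : MeasurableSet S) (hne : S.Nonempty)
    (hu : AEStronglyMeasurable u (volume.restrict (solDomain N T)))
    (huS : ∀ᵐ p ∂volume.restrict (solDomain N T), u p ∈ S) :
    ∃ U : ℝ × ℝ → (Fin N → ℝ) → ℝ, (Measurable fun p : (ℝ × ℝ) × (Fin N → ℝ) => U p.1 p.2) ∧
      (∀ z y, U z y ∈ S) ∧
      ∀ᵐ p ∂volume.restrict (solDomain N T), u p = U (p.1, p.2.1) p.2.2 := by
  obtain ⟨V, hVm, hVS, hV⟩ := exists_measurable_forall_mem_ae_eq hS hne hu huS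
  refine ⟨fun z y => V (z.1, z.2, y), ?_, fun z y => hVS _, hV⟩
  exact hVm.comp (f := fun p : (ℝ × ℝ) × (Fin N → ℝ) => (p.1.1, p.1.2, p.2)) (by fun_prop)

lemma exists_measurable_bounded {w : ℝ × (Fin N → ℝ) → ℝ} {M : ℝ} (hM : 0 ≤ M)
    (hw : MemLp w ⊤ (volume.restrict (dataDomain N)))
    (hwM : ∀ᵐ q ∂volume.restrict (dataDomain N), |w q| ≤ M) :
    ∃ w' : ℝ × (Fin N → ℝ) → ℝ, Measurable w' ∧ (∀ q, |w' q| ≤ M) ∧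
      ∀ᵐ q ∂volume.restrict (dataDomain N), w q = w' q := by
  obtain ⟨w', h1, h2, h3⟩ := exists_measurable_forall_mem_ae_eq (S := Icc (-M) M)
    measurableSet_Icc (nonempty_Icc.2 (by linarith)) hw.1
    (hwM.mono fun q hq => abs_le.1 hq)
  exact ⟨w', h1, fun q => abs_le.2 (h2 q), h3⟩

/-- Everything is reduced to measurable representatives with values in a bounded part of K. The
exceptional times come from the traces and slices of the two solutions only, hence do not depend on
m or Γ₁. -/
theorem IsWeakEntropySolution.contraction (hJ : J.OrdConnected) (hf : ContDiffOn ℝ 2 f J)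
    (hKJ : K ⊆ J) (hK : K.OrdConnected) (hC : ∀ s ∈ K, |derivWithin f J s| ≤ C)
    (hρ : IsBoundedDensity ρ) (hT : 0 < T) (hu : IsWeakEntropySolution J f ρ T u₀ u)
    (hv : IsWeakEntropySolution J f ρ T v₀ v)
    (huvK : ∀ᵐ p ∂volume.restrict (solDomain N T), u p ∈ K ∧ v p ∈ K) :
    (∀ᵐ t ∂volume.restrict (timeInterval T), ∀ m : ℝ, 0 < m →
      ∀ Γ₁ : Set (Fin N → ℝ), MeasurableSet Γ₁ → Γ₁ ⊆ paramCube N →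
        ∫ z in Icc (-m) m ×ˢ Γ₁, |u (z.1, t, z.2) - v (z.1, t, z.2)| * ρ z.2 ^ 2
          ≤ ∫ z in Icc (-(m + (C + 1) * t)) (m + (C + 1) * t) ×ˢ Γ₁,
            |u₀ z - v₀ z| * ρ z.2 ^ 2) ∧
    (∀ t ∈ timeInterval T, ∀ w₁ w₂ : ℝ × (Fin N → ℝ) → ℝ,
      MemLp w₁ ⊤ (volume.restrict (dataDomain N)) →
      MemLp w₂ ⊤ (volume.restrict (dataDomain N)) →
      IsMeanTrace ρ u t w₁ → IsMeanTrace ρ v t w₂ → ∀ m : ℝ, 0 < m →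
      ∀ Γ₁ : Set (Fin N → ℝ), MeasurableSet Γ₁ → Γ₁ ⊆ paramCube N →
        ∫ z in Icc (-m) m ×ˢ Γ₁, |w₁ z - w₂ z| * ρ z.2 ^ 2
          ≤ ∫ z in Icc (-(m + (C + 1) * t)) (m + (C + 1) * t) ×ˢ Γ₁,
            |u₀ z - v₀ z| * ρ z.2 ^ 2) := by
  obtain ⟨Mu, hMu0, hMu⟩ := MemLp.exists_ae_abs_le hu.memLp
  obtain ⟨Mv, hMv0, hMv⟩ := MemLp.exists_ae_abs_le hv.memLp
  obtain ⟨Mu₀, hMu₀0, hMu₀⟩ := MemLp.exists_ae_abs_le hu.data_memLp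
  obtain ⟨Mv₀, hMv₀0, hMv₀⟩ := MemLp.exists_ae_abs_le hv.data_memLp
  obtain ⟨R, hR0, hR⟩ := MemLp.exists_ae_abs_le hρ.memLp
  set M := Mu + Mv + Mu₀ + Mv₀ with hM
  have hM0 : 0 ≤ M := by positivity
  -- Truncation makes the constants k bounded while keeping the derivative bound C of K, so the
  -- speed does not depend on M. The data are only bounded by M and need not lie in K.
  set K' := K ∩ Icc (-M) M with hK'
  have hK'o : K'.OrdConnected := hK.inter ordConnected_Icc
  have hK'M : ∀ k ∈ K', |k| ≤ M := fun k hk => abs_le.2 hk.2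
  have hK'J : K' ⊆ J := inter_subset_left.trans hKJ
  have hK'C : ∀ s ∈ K', |derivWithin f J s| ≤ C := fun s hs => hC s hs.1
  have huK' : ∀ᵐ p ∂volume.restrict (solDomain N T), u p ∈ K' := by
    filter_upwards [huvK, hMu] with p h1 h2
    exact ⟨h1.1, abs_le.1 (h2.trans (by linarith))⟩
  have hvK' : ∀ᵐ p ∂volume.restrict (solDomain N T), v p ∈ K' := by
    filter_upwards [huvK, hMv] with p h1 h2
    exact ⟨h1.2, abs_le.1 (h2.trans (by linarith))⟩
  have hne : K'.Nonempty := by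
    have : (ae (volume.restrict (solDomain N T))).NeBot := by
      rw [ae_neBot, ne_eq, Measure.restrict_eq_zero]
      exact volume_solDomain_ne_zero hT
    obtain ⟨p, hp⟩ := huK'.exists
    exact ⟨_, hp⟩
  have hlip : LipschitzOnWith C f K' := by
    refine hK'o.convex.lipschitzOnWith_of_nnnorm_hasDerivWithin_le (f' := derivWithin f J)
      (fun x hx => ?_) fun x hx => ?_
    · exact ((hf.differentiableOn (by norm_num) x (hK'J hx)).hasDerivWithinAt).mono hK'J
    · exact NNReal.coe_le_coe.1 (by simpa using hK'C x hx)
  -- A global Lipschitz extension gives a continuous flux on all of ℝ² without altering it on K'.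
  obtain ⟨g, hg, hfg⟩ := hlip.extend_real
  obtain ⟨U, hUm, hUK, huU⟩ := exists_measurable_uncurried hK'o.measurableSet hne hu.memLp.1 huK'
  obtain ⟨V, hVm, hVK, hvV⟩ := exists_measurable_uncurried hK'o.measurableSet hne hv.memLp.1 hvK'
  obtain ⟨ρ', hρm, hρS, hρρ⟩ := exists_measurable_forall_mem_ae_eq (S := Icc 0 R)
    measurableSet_Icc (nonempty_Icc.2 hR0) hρ.memLp.1 (by
      filter_upwards [hR, ae_restrict_mem (measurableSet_paramCube N)] with y h1 h2
      exact ⟨hρ.nonneg y h2, (le_abs_self _).trans h1⟩)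
  have hρ0 : ∀ y, 0 ≤ ρ' y := fun y => (hρS y).1
  have hρR : ∀ y, ρ' y ≤ R := fun y => (hρS y).2
  obtain ⟨u₀', hu₀m, hu₀M, hu₀⟩ := exists_measurable_bounded hM0 hu.data_memLp
    (hMu₀.mono fun q hq => hq.trans (by linarith))
  obtain ⟨v₀', hv₀m, hv₀M, hv₀⟩ := exists_measurable_bounded hM0 hv.data_memLp
    (hMv₀.mono fun q hq => hq.trans (by linarith))
  have kU := hu.isKruzkov hJ hf hK'J hK'o hK'C hg hfg hK'M hUm hUK hρm hρ0 hρR huU hρρ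
  have kV := hv.isKruzkov hJ hf hK'J hK'o hK'C hg hfg hK'M hVm hVK hρm hρ0 hρR hvV hρρ
  have hkato : ∀ φ, IsCutoff (spaceTime T) φ → ∀ᵐ y ∂volume.restrict (paramCube N), ρ' y ≠ 0 →
      0 ≤ ∫ z, kruzkovIntegrand g φ z (U z y) (V z y) := by
    intro φ hφ
    have hne : MeasurableSet {y | ρ' y ≠ 0} := hρm (measurableSet_singleton 0).compl
    exact (ae_restrict_iff' hne).1
      (IsKruzkov.kato (isOpen_spaceTime T) kU kV hg hUm hVm hUK hVK hK'M hφ)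
  set h : ℕ → ℝ := fun n => 1 / (n + 1)
  have hh : ∀ n, 0 < h n := fun n => by positivity
  have hh0 : Tendsto h atTop (𝓝 0) := tendsto_one_div_add_atTop_nhds_zero_nat
  have hT0 : ((0 : ℝ) : EReal) < T := by exact_mod_cast hT
  have tu := hu.initial.tendsto_traceDefect le_rfl hT0 huU hu₀ hρρ hh hh0
  have tv := hv.initial.tendsto_traceDefect le_rfl hT0 hvV hv₀ hρρ hh hh0
  refine ⟨?_, ?_⟩
  · have aU := ae_restrict_of_ae (s := timeInterval T)
      (ae_forall_tendsto_traceDefect (ν := volume.restrict (paramCube N)) hρm hρ0 hρR hUm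
        (fun z y => hK'M _ (hUK z y)) hh hh0)
    have aV := ae_restrict_of_ae (s := timeInterval T)
      (ae_forall_tendsto_traceDefect (ν := volume.restrict (paramCube N)) hρm hρ0 hρR hVm
        (fun z y => hK'M _ (hVK z y)) hh hh0)
    filter_upwards [aU, aV, ae_ae_of_ae_solDomain huU, ae_ae_of_ae_solDomain hvV,
      ae_restrict_mem (isOpen_timeInterval T).measurableSet] with t hUt hVt euU evV ht m _ Γ₁ hΓ hΓc
    rw [setIntegral_congr_dataDomain (w := fun z => u (z.1, t, z.2)) euU evV hρρ _ hΓc,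
      setIntegral_congr_dataDomain hu₀ hv₀ hρρ _ hΓc]
    have hslice : Measurable fun q : ℝ × (Fin N → ℝ) => (((q.1, t), q.2) : (ℝ × ℝ) × _) := by
      fun_prop
    exact contraction_of_traceDefect hg hρm hρ0 hρR hUm hVm (fun z y => hK'M _ (hUK z y))
      (fun z y => hK'M _ (hVK z y)) hkato hu₀m hv₀m (hUm.comp hslice) (hVm.comp hslice) hu₀M
      hv₀M (fun q => hK'M _ (hUK _ _)) (fun q => hK'M _ (hVK _ _)) ht hh hh0 tu tv hUt hVt m hΓ hΓc
  · intro t ht w₁ w₂ hw₁ hw₂ tw₁ tw₂ m _ Γ₁ hΓ hΓc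
    obtain ⟨M₁, hM₁0, hM₁⟩ := MemLp.exists_ae_abs_le hw₁
    obtain ⟨M₂, hM₂0, hM₂⟩ := MemLp.exists_ae_abs_le hw₂
    obtain ⟨w₁', hw₁m, hw₁M, hw₁e⟩ := exists_measurable_bounded hM₁0 hw₁ hM₁
    obtain ⟨w₂', hw₂m, hw₂M, hw₂e⟩ := exists_measurable_bounded hM₂0 hw₂ hM₂
    -- The prescribed traces have their own bounds, so a common larger bound is used; it does not
    -- enter the speed.
    have l0 : M ≤ M + M₁ + M₂ := by linarith
    have l1 : M₁ ≤ M + M₁ + M₂ := by linarith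
    have l2 : M₂ ≤ M + M₁ + M₂ := by linarith
    rw [setIntegral_congr_dataDomain hw₁e hw₂e hρρ _ hΓc,
      setIntegral_congr_dataDomain hu₀ hv₀ hρρ _ hΓc]
    exact contraction_of_traceDefect hg hρm hρ0 hρR hUm hVm
      (fun z y => (hK'M _ (hUK z y)).trans l0) (fun z y => (hK'M _ (hVK z y)).trans l0) hkato
      hu₀m hv₀m hw₁m hw₂m (fun q => (hu₀M q).trans l0) (fun q => (hv₀M q).trans l0)
      (fun q => (hw₁M q).trans l1) (fun q => (hw₂M q).trans l2) ht hh hh0 tu tv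
      (tw₁.tendsto_traceDefect ht.1.le ht.2 huU hw₁e hρρ hh hh0)
      (tw₂.tendsto_traceDefect ht.1.le ht.2 hvV hw₂e hρρ hh hh0) m hΓ hΓc

/-- Bounded solutions take values in J ∩ [-M,M], where f' is bounded, so the contraction applies
with zero right-hand side. At almost every t the weighted distance vanishes on each bounded
interval, and Fubini recovers all of space-time. -/
theorem IsWeakEntropySolution.unique (hJ : J.OrdConnected) (hf : ContDiffOn ℝ 2 f J)
    (hf' : ∀ M : ℝ, ∃ C : ℝ, ∀ s ∈ J, |s| ≤ M → |derivWithin f J s| ≤ C)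
    (hρ : IsBoundedDensity ρ) (hT : 0 < T) (hu : IsWeakEntropySolution J f ρ T u₀ u)
    (hv : IsWeakEntropySolution J f ρ T u₀ v) :
    ∀ᵐ p ∂volume.restrict (solDomain N T), ρ p.2.2 ≠ 0 → u p = v p := by
  obtain ⟨Mu, hMu0, hMu⟩ := MemLp.exists_ae_abs_le hu.memLp
  obtain ⟨Mv, hMv0, hMv⟩ := MemLp.exists_ae_abs_le hv.memLp
  obtain ⟨R, hR0, hR⟩ := MemLp.exists_ae_abs_le hρ.memLp
  set M := Mu + Mv
  obtain ⟨C, hC⟩ := hf' M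
  have huK : ∀ᵐ p ∂volume.restrict (solDomain N T),
      u p ∈ J ∩ Icc (-M) M ∧ v p ∈ J ∩ Icc (-M) M := by
    filter_upwards [hMu, hMv, hu.mem, hv.mem] with p h1 h2 h3 h4
    exact ⟨⟨h3, abs_le.1 (h1.trans (by linarith))⟩, ⟨h4, abs_le.1 (h2.trans (by linarith))⟩⟩
  have hcon := (IsWeakEntropySolution.contraction (C := C.toNNReal) (K := J ∩ Icc (-M) M) hJ hf
    inter_subset_left (hJ.inter ordConnected_Icc)
    (fun s hs => (hC s hs.1 (abs_le.2 hs.2)).trans (Real.le_coe_toNNReal C)) hρ hT hu hv huK).1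
  obtain ⟨ρ', hρm, hρS, hρρ⟩ := exists_measurable_forall_mem_ae_eq (S := Icc 0 R)
    measurableSet_Icc (nonempty_Icc.2 hR0) hρ.memLp.1 (by
      filter_upwards [hR, ae_restrict_mem (measurableSet_paramCube N)] with y h1 h2
      exact ⟨hρ.nonneg y h2, (le_abs_self _).trans h1⟩)
  have hMne : (Icc (-M) M).Nonempty := nonempty_Icc.2 (by linarith [add_nonneg hMu0 hMv0])
  obtain ⟨U, hUm, hUM, huU⟩ := exists_measurable_uncurried measurableSet_Icc hMne hu.memLp.1
    (huK.mono fun p hp => hp.1.2)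
  obtain ⟨V, hVm, hVM, hvV⟩ := exists_measurable_uncurried measurableSet_Icc hMne hv.memLp.1
    (huK.mono fun p hp => hp.2.2)
  -- Returning from almost every slice to almost every point requires a measurable set, hence the
  -- representatives.
  have hmeas : MeasurableSet {p : ℝ × ℝ × (Fin N → ℝ) |
      |U (p.1, p.2.1) p.2.2 - V (p.1, p.2.1) p.2.2| * ρ' p.2.2 ^ 2 = 0} :=
    measurableSet_eq_fun
      (((measurable_comp_assoc hUm).sub (measurable_comp_assoc hVm)).abs.mul
        ((hρm.comp (by fun_prop)).pow_const 2)) measurable_const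
  have hzero := ae_solDomain_of_ae_ae (T := T) hmeas ?_
  · filter_upwards [hzero, huU, hvV, ae_solDomain_of_ae_paramCube hρρ] with p h1 h2 h3 h4 h5
    rw [h4] at h5
    rw [h2, h3]
    rcases mul_eq_zero.1 h1 with h | h
    · exact sub_eq_zero.1 (abs_eq_zero.1 h)
    · exact absurd (pow_eq_zero_iff two_ne_zero |>.1 h) h5
  · filter_upwards [hcon, ae_ae_of_ae_solDomain huU, ae_ae_of_ae_solDomain hvV]
      with t ht euU evV
    -- The radii n + 1 are positive, as the contraction demands, and exhaust ℝ.
    have hball : ∀ n : ℕ, ∀ᵐ q ∂volume, q ∈ Icc (-((n : ℝ) + 1)) (n + 1) ×ˢ paramCube N →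
        |U (q.1, t) q.2 - V (q.1, t) q.2| * ρ' q.2 ^ 2 = 0 := by
      intro n
      have h1 := ht (n + 1) (by positivity) (paramCube N) (measurableSet_paramCube N) subset_rfl
      rw [setIntegral_congr_dataDomain (w := fun z => u (z.1, t, z.2)) euU evV hρρ _ subset_rfl]
        at h1
      simp only [sub_self, abs_zero, zero_mul, integral_zero] at h1
      have hS : MeasurableSet (Icc (-((n : ℝ) + 1)) (n + 1) ×ˢ paramCube N) :=
        measurableSet_Icc.prod (measurableSet_paramCube N)
      rw [← ae_restrict_iff' hS]
      have h0 : ∀ q : ℝ × (Fin N → ℝ), 0 ≤ |U (q.1, t) q.2 - V (q.1, t) q.2| * ρ' q.2 ^ 2 :=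
        fun q => by positivity
      have hslice : Measurable fun q : ℝ × (Fin N → ℝ) => (((q.1, t), q.2) : (ℝ × ℝ) × _) := by
        fun_prop
      have hfin : IsFiniteMeasure ((volume : Measure (ℝ × (Fin N → ℝ))).restrict
          (Icc (-((n : ℝ) + 1)) (n + 1) ×ˢ paramCube N)) := by
        refine ⟨?_⟩
        rw [Measure.restrict_apply_univ]
        exact (isCompact_Icc.prod isCompact_Icc).measure_lt_top
      have hint : Integrable (fun q : ℝ × (Fin N → ℝ) =>
          |U (q.1, t) q.2 - V (q.1, t) q.2| * ρ' q.2 ^ 2)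
          (volume.restrict (Icc (-((n : ℝ) + 1)) (n + 1) ×ˢ paramCube N)) := by
        refine Integrable.of_bound (((hUm.comp hslice).sub (hVm.comp hslice)).abs.mul
          ((hρm.comp measurable_snd).pow_const 2)).aestronglyMeasurable (2 * M * R ^ 2)
          (Eventually.of_forall fun q => ?_)
        rw [Real.norm_of_nonneg (h0 q)]
        have hb := abs_sub_le_two_mul (abs_le.2 (hUM (q.1, t) q.2)) (abs_le.2 (hVM (q.1, t) q.2))
        exact mul_le_mul hb (pow_le_pow_left₀ (hρS _).1 (hρS _).2 2) (by positivity)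
          ((abs_nonneg _).trans hb)
      exact (integral_eq_zero_iff_of_nonneg h0 hint).1
        (le_antisymm h1 (integral_nonneg h0))
    have hD : MeasurableSet (dataDomain N) := MeasurableSet.univ.prod (measurableSet_paramCube N)
    rw [ae_restrict_iff' hD]
    filter_upwards [ae_all_iff.2 hball] with q hq hqD
    obtain ⟨n, hn⟩ := exists_nat_ge |q.1|
    exact hq n ⟨abs_le.1 (hn.trans (by linarith)), hqD.2⟩

end Solutions

end

theorem theorem2p4 (J : Set ℝ) (hJ : J.OrdConnected) (f : ℝ → ℝ) (hf : ContDiffOn ℝ 2 f J)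
    (hf' : ∀ M : ℝ, ∃ C : ℝ, ∀ s ∈ J, |s| ≤ M → |derivWithin f J s| ≤ C) :
    (∀ K : Set ℝ, K ⊆ J → K.OrdConnected → (∃ C : ℝ, ∀ s ∈ K, |derivWithin f J s| ≤ C) →
      ∃ α : ℝ, 0 < α ∧
        ∀ (N : ℕ) (ρ : (Fin N → ℝ) → ℝ), IsBoundedDensity ρ →
        ∀ T : EReal, 0 < T →
        ∀ (u₀ v₀ : ℝ × (Fin N → ℝ) → ℝ) (u v : ℝ × ℝ × (Fin N → ℝ) → ℝ),
          IsWeakEntropySolution J f ρ T u₀ u → IsWeakEntropySolution J f ρ T v₀ v →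
          (∀ᵐ p ∂volume.restrict (solDomain N T), u p ∈ K ∧ v p ∈ K) →
          (∀ᵐ t ∂volume.restrict (timeInterval T), ∀ m : ℝ, 0 < m →
            ∀ Γ₁ : Set (Fin N → ℝ), MeasurableSet Γ₁ → Γ₁ ⊆ paramCube N →
              ∫ z in Icc (-m) m ×ˢ Γ₁, |u (z.1, t, z.2) - v (z.1, t, z.2)| * ρ z.2 ^ 2
                ≤ ∫ z in Icc (-(m + α * t)) (m + α * t) ×ˢ Γ₁, |u₀ z - v₀ z| * ρ z.2 ^ 2) ∧
          (∀ t ∈ timeInterval T, ∀ w₁ w₂ : ℝ × (Fin N → ℝ) → ℝ,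
            MemLp w₁ ⊤ (volume.restrict (dataDomain N)) →
            MemLp w₂ ⊤ (volume.restrict (dataDomain N)) →
            IsMeanTrace ρ u t w₁ → IsMeanTrace ρ v t w₂ → ∀ m : ℝ, 0 < m →
            ∀ Γ₁ : Set (Fin N → ℝ), MeasurableSet Γ₁ → Γ₁ ⊆ paramCube N →
              ∫ z in Icc (-m) m ×ˢ Γ₁, |w₁ z - w₂ z| * ρ z.2 ^ 2
                ≤ ∫ z in Icc (-(m + α * t)) (m + α * t) ×ˢ Γ₁, |u₀ z - v₀ z| * ρ z.2 ^ 2)) ∧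
    (∀ (N : ℕ) (ρ : (Fin N → ℝ) → ℝ), IsBoundedDensity ρ →
      ∀ T : EReal, 0 < T →
      ∀ (u₀ : ℝ × (Fin N → ℝ) → ℝ) (u v : ℝ × ℝ × (Fin N → ℝ) → ℝ),
        IsWeakEntropySolution J f ρ T u₀ u → IsWeakEntropySolution J f ρ T u₀ v →
        ∀ᵐ p ∂volume.restrict (solDomain N T), ρ p.2.2 ≠ 0 → u p = v p) := by
  -- The given C can be negative only for empty K, so `toNNReal` loses nothing; adding 1 also makes
  -- α positive when C = 0.
  refine ⟨fun K hKJ hK ⟨C, hC⟩ => ⟨C.toNNReal + 1, by positivity, ?_⟩, ?_⟩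
  · intro N ρ hρ T hT u₀ v₀ u v hu hv huv
    exact IsWeakEntropySolution.contraction hJ hf hKJ hK
      (fun s hs => (hC s hs).trans (Real.le_coe_toNNReal C)) hρ hT hu hv huv
  · intro N ρ hρ T hT u₀ u v hu hv
    exact IsWeakEntropySolution.unique hJ hf hf' hρ hT hu hv
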